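/- Let $E/\mathbb{Q}$ be an elliptic curve, let $n=2m-1$ be an odd positive integer, and let $e_n$ be the Weil pairing on $E[n]=E(\overline{\mathbb{Q}})[n]$. Let $R=\mathrm{Map}_{\mathbb{Q}}(E[n],\overline{\mathbb{Q}})$ be the étale $\mathbb{Q}$-algebra of Galois-equivariant maps $E[n]\to\overline{\mathbb{Q}}$; it is a product of number fields, one field $\mathbb{Q}(T)$ for each Galois orbit of $T\in E[n]$. Let $\mathcal{O}_R$ be its ring of integers and $\mathrm{Disc}(R)$ the product of the discriminants of its constituent fields. Identify $R\otimes_{\mathbb{Q}}R$ with the algebra of Galois-equivariant maps $E[n]\times E[n]\to\overline{\mathbb{Q}}$. Let $\xi$ be a continuous $1$-cocycle $\mathrm{Gal}(\overline{\mathbb{Q}}/\mathbb{Q})\to E[n]$. Let $\gamma:E[n]\to\overline{\mathbb{Q}}^\times$ and $\alpha\in R^\times$ satisfy $\gamma^n=\alpha$ and $e_n(\xi_\sigma,T)=(\sigma\gamma)(T)/\gamma(T)$ for all $\sigma$ and $T$, where $(\sigma\gamma)(T)=\sigma(\gamma(\sigma^{-1}T))$. Write $(\alpha)=\mathfrak{b}\mathfrak{c}^n$,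 where $\mathfrak{c}$ is an invertible fractional ideal of $R$ and $\mathfrak{b}\subset\mathcal{O}_R$ is an integral ideal not divisible by the $n$th power of any prime ideal. Put $\varepsilon(S,T)=e_n(S,T)^m$ and $\rho(S,T)=\gamma(S)\gamma(T)/\gamma(S+T)$. Then $\varepsilon,\rho\in R\otimes_{\mathbb{Q}}R$. Let $A_\rho=(R,+,*_{\varepsilon\rho})$ be the obstruction algebra, that is, the $\mathbb{Q}$-vector space $R$ with the multiplication $$(z_1*_{\varepsilon\rho}z_2)(T)=\sum_{T_1+T_2=T}\varepsilon(T_1,T_2)\rho(T_1,T_2)z_1(T_1)z_2(T_2).$$ Then $A_\rho\otimes_{\mathbb{Q}}\overline{\mathbb{Q}}\cong\mathrm{Mat}_n(\overline{\mathbb{Q}})$, the reduced trace $\mathrm{Trd}$ of $A_\rho$ takes values in $\mathbb{Q}$, and $\mathcal{O}=(\mathfrak{c}^{-1},+,*_{\varepsilon\rho})$ is an order in $A_\rho$. The discriminant $\det(\mathrm{Trd}(r_i*_{\varepsilon\rho}r_j))_{i,j}$ of $\mathcal{O}$, for any $\mathbb{Z}$-basis $r_1,\dots,r_{n^2}$ of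 $\mathfrak{c}^{-1}$, is $$n^{n^2}\,(\mathrm{Norm}\,\mathfrak{b})^{2/n}\,\mathrm{Disc}(R),\qquad \mathrm{Norm}\,\mathfrak{b}=\#(\mathcal{O}_R/\mathfrak{b}).$$ -/

import Mathlib

open scoped nonZeroDivisors TensorProduct

noncomputable section

namespace ObstructionOrder

/-! ### Rational functions on a Weierstrass curve and the Weil pairing -/

section WeilPairing

variable {F : Type*} [Field F] [DecidableEq F] {W : WeierstrassCurve.Affine F}

/-- The maximal ideal of an affine point, as an invertible fractional ideal of the coordinate ring.
The point at infinity contributes the unit ideal. -/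
def pointIdeal : W.Point → (FractionalIdeal W.CoordinateRing⁰ W.FunctionField)ˣ
  | .zero => 1
  | .some _ _ h => WeierstrassCurve.Affine.CoordinateRing.XYIdeal' (W := W) h

/-- The rational function `G` is defined at the affine point `P` and takes the value `v` there:
`G = a / b` with `a`, `b` in the coordinate ring, `b(P) ≠ 0` and `v = a(P) / b(P)`. -/
def HasValueAt (G : W.FunctionField) : W.Point → F → Prop
  | .zero, _ => False
  | .some _ _ h, v => ∃ a b : W.CoordinateRing,
      algebraMap W.CoordinateRing W.FunctionField a =
        G * algebraMap W.CoordinateRing W.FunctionField b ∧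
      AdjoinRoot.evalEval h.1 b ≠ 0 ∧
      v = AdjoinRoot.evalEval h.1 a / AdjoinRoot.evalEval h.1 b

/-- `div G = [n]^*(T) - [n]^*(0) = ∑_{nP = T} (P) - ∑_{nQ = 0} (Q)`.  As the divisor has degree `0`,
its affine part determines the order at infinity, so the condition is an equality of
fractional ideals of the coordinate ring.  (Used over an algebraically closed field
of characteristic prime to `n` and for `T` an `n`-torsion point.) -/
def HasPullbackDivisor (n : ℕ) (T : W.Point) (G : W.FunctionField) : Prop :=
  FractionalIdeal.spanSingleton W.CoordinateRing⁰ G =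
    ((∏ᶠ P : {P : W.Point // n • P = T}, pointIdeal P.1) /
      (∏ᶠ Q : {Q : W.Point // n • Q = 0}, pointIdeal Q.1) :
      (FractionalIdeal W.CoordinateRing⁰ W.FunctionField)ˣ)

/-- `ζ` is the Weil pairing of `S` and `T`: for a rational function `G` with divisor
`[n]^*(T) - [n]^*(0)` one has `G(P + S) = ζ G(P)` whenever both sides are defined. -/
def IsWeilPairingValue (n : ℕ) (S T : W.Point) (ζ : F) : Prop :=
  ∃ G : W.FunctionField, HasPullbackDivisor n T G ∧
    ∀ (P : W.Point) (v v' : F), HasValueAt G P v → HasValueAt G (P + S) v' → v' = ζ * v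

open Classical in
/-- The Weil pairing `e_n(S, T)` of two `n`-torsion points over an algebraically closed field. -/
def weilPairing (n : ℕ) (S T : W.Point) : F :=
  if h : ∃ ζ : F, IsWeilPairingValue n S T ζ then h.choose else 1

end WeilPairing

/-! ### The Galois module `E[n]` -/

/-- The algebraic closure of `ℚ`. -/
abbrev QBar : Type := AlgebraicClosure ℚ

instance : Algebra ℚ QBar := AlgebraicClosure.instAlgebra ℚ

instance : DecidableEq QBar := Classical.decEq _

/-- The absolute Galois group of `ℚ`, with its Krull topology. -/
abbrev GalQ : Type := QBar ≃ₐ[ℚ] QBar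

open WeierstrassCurve.Affine in
/-- The group `E(ℚ̄)` of geometric points. -/
abbrev GeomPoint (E : WeierstrassCurve ℚ) : Type := (E.toAffine⁄QBar).Point

/-- The group `E[n]` of geometric `n`-torsion points. -/
abbrev Torsion (E : WeierstrassCurve ℚ) (n : ℕ) : Type :=
  ↥(AddSubgroup.torsionBy (GeomPoint E) (n : ℤ))

/-- `Gal(ℚ̄/ℚ)` acts on `E[n]` through the coordinates. -/
instance (E : WeierstrassCurve ℚ) (n : ℕ) : MulAction GalQ (Torsion E n) where
  smul σ T := ⟨WeierstrassCurve.Affine.Point.map (W' := E.toAffine) (σ : QBar →ₐ[ℚ] QBar) T.1, by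
    have h : (n : ℤ) • T.1 = 0 := T.2
    change (n : ℤ) • WeierstrassCurve.Affine.Point.map (W' := E.toAffine)
      (σ : QBar →ₐ[ℚ] QBar) T.1 = 0
    rw [← map_zsmul, h, map_zero]⟩
  one_smul T := by
    apply Subtype.ext
    rcases T with ⟨_ | _, _⟩ <;> rfl
  mul_smul σ τ T := by
    apply Subtype.ext
    rcases T with ⟨_ | _, _⟩ <;> rfl

/-- The field of definition `ℚ(P)` of a geometric point `P`. -/
def fieldOfDefinition (E : WeierstrassCurve ℚ) : GeomPoint E → IntermediateField ℚ QBar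
  | .zero => ⊥
  | .some x y _ => IntermediateField.adjoin ℚ {x, y}

instance (E : WeierstrassCurve ℚ) (P : GeomPoint E) : NumberField (fieldOfDefinition E P) where
  to_charZero := inferInstance
  to_finiteDimensional := by
    have h : FiniteDimensional ℚ (fieldOfDefinition E P) := by
      rcases P with _ | ⟨x, y, _⟩
      · exact inferInstanceAs (FiniteDimensional ℚ (⊥ : IntermediateField ℚ QBar))
      · exact IntermediateField.finiteDimensional_adjoin fun z _ =>
          (AlgebraicClosure.isAlgebraic ℚ).isAlgebraic z |>.isIntegral
    convert h

/-! ### Étale algebras -/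

/-- The Galois equivariant maps `X → ℚ̄`. -/
def equivariantMaps (X : Type) [MulAction GalQ X] : Subalgebra ℚ (X → QBar) where
  carrier := {z | ∀ (σ : GalQ) (x : X), z (σ • x) = σ (z x)}
  mul_mem' ha hb σ x := by simp [ha σ x, hb σ x]
  add_mem' ha hb σ x := by simp [ha σ x, hb σ x]
  algebraMap_mem' q σ x := by simp

/-- The étale `ℚ`-algebra `Map_ℚ(X, ℚ̄)` of a finite `Gal(ℚ̄/ℚ)`-set `X`: the Galois equivariant
maps, with pointwise operations. -/
def EtaleAlgebra (X : Type) [MulAction GalQ X] : Type := ↥(equivariantMaps X)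

instance (X : Type) [MulAction GalQ X] : CommRing (EtaleAlgebra X) :=
  inferInstanceAs (CommRing ↥(equivariantMaps X))

instance (X : Type) [MulAction GalQ X] : Algebra ℚ (EtaleAlgebra X) :=
  inferInstanceAs (Algebra ℚ ↥(equivariantMaps X))

instance (X : Type) [MulAction GalQ X] : CoeFun (EtaleAlgebra X) fun _ => X → QBar :=
  ⟨Subtype.val⟩

/-- The étale algebra `R` of `E[n]`. -/
abbrev R (E : WeierstrassCurve ℚ) (n : ℕ) : Type := EtaleAlgebra (Torsion E n)

/-- The étale algebra of `E[n] × E[n]`, which is `R ⊗ R`. -/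
abbrev R₂ (E : WeierstrassCurve ℚ) (n : ℕ) : Type := EtaleAlgebra (Torsion E n × Torsion E n)

/-- The ring of integers of `R`, the product of the rings of integers of the constituent fields. -/
abbrev OR (E : WeierstrassCurve ℚ) (n : ℕ) : Type := ↥(integralClosure ℤ (R E n))

/-- `Disc(R)`: the product of the discriminants of the constituent fields `ℚ(T)` of `R`, where `T`
runs through representatives of the Galois orbits on `E[n]`. -/
def discR (E : WeierstrassCurve ℚ) (n : ℕ) : ℤ :=
  ∏ᶠ o : MulAction.orbitRel.Quotient GalQ (Torsion E n),
    NumberField.discr (fieldOfDefinition E (Quotient.out o : Torsion E n).1)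

/-- The inverse `c⁻¹` of an invertible fractional ideal `c` of `R`, as a subgroup of `R`. -/
def invLattice {E : WeierstrassCurve ℚ} {n : ℕ}
    (c : (FractionalIdeal (OR E n)⁰ (R E n))ˣ) : Submodule ℤ (R E n) :=
  Submodule.restrictScalars ℤ (((c⁻¹ : (FractionalIdeal (OR E n)⁰ (R E n))ˣ) :
    FractionalIdeal (OR E n)⁰ (R E n)) : Submodule (OR E n) (R E n))

/-- The multiplication `z₁ *_τ z₂ = Tr(τ · (z₁ ⊗ z₂))` on `R`, for `τ ∈ R ⊗ R`.  In terms of maps,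
it is `T ↦ ∑_{T₁ + T₂ = T} τ(T₁, T₂) z₁(T₁) z₂(T₂)`. -/
def twistedMul {E : WeierstrassCurve ℚ} {n : ℕ} (τ : R₂ E n) (z₁ z₂ : R E n) : R E n :=
  ⟨fun T => ∑ᶠ p : {p : Torsion E n × Torsion E n // p.1 + p.2 = T},
      τ p.1 * z₁ p.1.1 * z₂ p.1.2, by
    intro σ T
    have hadd : ∀ S S' : Torsion E n, σ • (S + S') = σ • S + σ • S' := fun S S' =>
      Subtype.ext (map_add (WeierstrassCurve.Affine.Point.map (W' := E.toAffine)
        (σ : QBar →ₐ[ℚ] QBar)) S.1 S'.1)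
    let e : {p : Torsion E n × Torsion E n // p.1 + p.2 = T} ≃
        {p : Torsion E n × Torsion E n // p.1 + p.2 = σ • T} :=
      (MulAction.toPerm σ : Equiv.Perm (Torsion E n × Torsion E n)).subtypeEquiv fun p => by
        change _ ↔ σ • p.1 + σ • p.2 = σ • T
        rw [← hadd, smul_left_cancel_iff]
    beta_reduce
    rw [← finsum_comp_equiv e]
    have key : ∀ p : {p : Torsion E n × Torsion E n // p.1 + p.2 = T},
        τ (e p).1 * z₁ (e p).1.1 * z₂ (e p).1.2 =
          σ (τ p.1 * z₁ p.1.1 * z₂ p.1.2) := fun p => by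
      rw [map_mul, map_mul, ← τ.2 σ p.1, ← z₁.2 σ p.1.1, ← z₂.2 σ p.1.2]
      rfl
    simp only [key]
    exact (AddMonoidHom.map_finsum_of_injective (σ : QBar →+ QBar) σ.injective _).symm⟩

/-! ### Orders, reduced traces and discriminants

A `ℚ`-algebra structure on a vector space `A` is given by its multiplication `mul`; the ring axioms
follow from the existence of a splitting. -/

section Orders

variable {A : Type*} [AddCommGroup A] [Module ℚ A]

/-- `L` is an order in the algebra `(A, mul)`: a finitely generated subgroup that spans `A`,
contains a two-sided identity of `A`, and is closed under multiplication. -/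
def IsOrder (mul : A → A → A) (L : Submodule ℤ A) : Prop :=
  L.FG ∧ Submodule.span ℚ (L : Set A) = ⊤ ∧
    (∃ e ∈ L, ∀ a, mul e a = a ∧ mul a e = a) ∧
    ∀ a ∈ L, ∀ b ∈ L, mul a b ∈ L

/-- The `ℚ̄`-linear isomorphism `φ : A ⊗ ℚ̄ ≅ Mat_n(ℚ̄)` is an isomorphism of algebras. -/
def IsSplitting (n : ℕ) (mul : A → A → A)
    (φ : (QBar ⊗[ℚ] A) ≃ₗ[QBar] Matrix (Fin n) (Fin n) QBar) : Prop :=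
  ∀ a b : A, φ (1 ⊗ₜ mul a b) = φ (1 ⊗ₜ a) * φ (1 ⊗ₜ b)

/-- `t` is the reduced trace of the central simple algebra `(A, mul)` of dimension `n²` over `ℚ`:
`t(a) = tr(φ(a))` for an isomorphism `φ : A ⊗ ℚ̄ ≅ Mat_n(ℚ̄)` of `ℚ̄`-algebras. -/
def IsReducedTrace (n : ℕ) (mul : A → A → A) (t : A → ℚ) : Prop :=
  ∃ φ : (QBar ⊗[ℚ] A) ≃ₗ[QBar] Matrix (Fin n) (Fin n) QBar, IsSplitting n mul φ ∧
    ∀ a : A, algebraMap ℚ QBar (t a) = (φ (1 ⊗ₜ a)).trace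

/-- `d` is the discriminant `det(Trd(r_i r_j))` of the order `L` in the central simple algebra
`(A, mul)` of dimension `n²`.  It is part of the definition that the reduced trace and a `ℤ`-basis
`r_1, …, r_{n²}` of `L` exist. -/
def IsDiscriminant (n : ℕ) (mul : A → A → A) (L : Submodule ℤ A) (d : ℚ) : Prop :=
  (∃ t : A → ℚ, IsReducedTrace n mul t) ∧ Nonempty (Module.Basis (Fin (n ^ 2)) ℤ L) ∧
    ∀ t : A → ℚ, IsReducedTrace n mul t → ∀ r : Module.Basis (Fin (n ^ 2)) ℤ L,
      (Matrix.of fun i j => t (mul (r i : A) (r j : A))).det = d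

end Orders

end ObstructionOrder

end

open ObstructionOrder

/-!
Multiplication by `γ` is an isomorphism of `A_ρ ⊗ ℚ̄` with the twisted group algebra of `E[n]` over
`ℚ̄`, with multiplication `u_S u_T = ε(S, T) u_{S + T}`: the factor `ρ` is a coboundary over `ℚ̄`
(`scaleMap_twistedMul`).  As `ε = e_n^m` with `n = 2m - 1`, the commutator pairing
`ε(S, T) / ε(T, S)` is the Weil pairing.  Its nondegeneracy makes the twisted group algebra
simple, hence a matrix algebra (`TwistedAlgebra.exists_algEquiv_matrix`), and forces the trace of
every `u_T` with `T ≠ 0` to vanish, so that the reduced trace is `z ↦ n γ(0) z(0)`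
(`TwistedAlgebra.trace_eq`).  Since `ε(T, -T) = 1`, the Gram matrix of a family `r_i` is
`n A P Aᵀ`, where `A` is the matrix of the `γ(T) r_i(T)` and `P` is the permutation matrix of
`T ↦ -T`, which is even.  The determinant is therefore `n^(n²) q² det(r_i(T))²` with `q = ∏ γ(T)`
(`det_trace_eq`); the number `q` is rational because the points of `E[n]` sum to zero.

As `b` is not divisible by the `n`-th power of a prime, `c⁻¹` consists of the `z` for which
`z^n α = (γ z)^n` is integral (`mem_of_pow_mul_isIntegral`, `mem_iff_isIntegral_mul`).  In terms of
the twisted group algebra, `c⁻¹` is thus the set of elements of `R` with integral coefficients, and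
it is closed under multiplication because the values of `ε` are roots of unity.  The determinant
`det(r_i(T))²` of the ring of integers is `Disc(R)` (`exists_basis_discOf_eq_discR`).  If `s` is the
ratio of the determinants of `c⁻¹` and of the ring of integers, taking norms in `(α) = b c^n` gives
`(q² s)^n = (Norm b)²` (`exists_hasDisc_of_eq_span_mul_pow`), and `q² s` is the positive `n`-th
root.

The properties of the Weil pairing are proved for a Weierstrass curve over an algebraically closed
field of characteristic zero.  The `x`-coordinate of `nP` is a fraction of degree `n²` in that of
`P`, by the recursion for `x((n + 1)P) + x((n - 1)P)` and `x((n + 1)P) x((n - 1)P)`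
(`exists_isMulFraction`); this gives surjectivity of multiplication by `n` and the `n²` points of
`E[n]` (`nsmul_surjective`, `ncard_torsion`).  The coordinate ring is a Dedekind domain, which
provides orders at the affine points; the order at infinity is defined by the condition that
principal divisors have degree zero.  Translations are automorphisms of the function field obtained
from the group law on the generic point, and they move divisors as expected (`ord_translation`).
Combined with Mathlib's embedding of the points into the class group, this yields the criterion for
a divisor to be principal (`divisorSum_divisor`, `exists_divisor_eq`).  A function `G` with divisor
`[n]^*(T) - [n]^*(0)` is an eigenfunction of translation by `S ∈ E[n]`, with eigenvalue
`e_n(S, T)`, from which the pairing is seen to be bilinear, alternating, nondegenerate and Galois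
equivariant (`weilPairing_add_right`, `weilPairing_self`, `eq_zero_of_weilPairing_eq_one`,
`weilPairing_conj`).
-/

open scoped nonZeroDivisors TensorProduct

noncomputable section

set_option linter.unusedSectionVars false

namespace ObstructionOrder

/-! ### Multiplication by `n` on `x`-coordinates -/

section

variable {F : Type*} [Field F] [DecidableEq F] {W : WeierstrassCurve.Affine F}
open WeierstrassCurve.Affine Polynomial

/-- The elementary symmetric functions of `x(P + Q)` and `x(P - Q)` are rational functions of the
symmetric functions of `x(P)` and `x(Q)`. -/
lemma add_sub_x {x₁ y₁ x₂ y₂ : F} (h₁ : W.Nonsingular x₁ y₁) (h₂ : W.Nonsingular x₂ y₂)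
    (hx : x₁ ≠ x₂) : ∃ x₃ y₃ x₄ y₄, ∃ (h₃ : W.Nonsingular x₃ y₃) (h₄ : W.Nonsingular x₄ y₄),
      Point.some x₁ y₁ h₁ + Point.some x₂ y₂ h₂ = Point.some x₃ y₃ h₃ ∧
      Point.some x₁ y₁ h₁ - Point.some x₂ y₂ h₂ = Point.some x₄ y₄ h₄ ∧
      (x₃ + x₄) * (x₁ - x₂) ^ 2 = 2 * (x₁ + x₂) * (x₁ * x₂) + W.b₂ * (x₁ * x₂) +
        W.b₄ * (x₁ + x₂) + W.b₆ ∧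
      (x₃ * x₄) * (x₁ - x₂) ^ 2 = (x₁ * x₂) ^ 2 - W.b₄ * (x₁ * x₂) - W.b₆ * (x₁ + x₂) - W.b₈ := by
  have e₁ := (W.equation_iff x₁ y₁).mp h₁.1
  have e₂ := (W.equation_iff x₂ y₂).mp h₂.1
  have hx' : x₁ - x₂ ≠ 0 := sub_ne_zero.mpr hx
  rw [sub_eq_add_neg, Point.neg_some]
  refine ⟨_, _, _, _, _, _, Point.add_of_X_ne hx, Point.add_of_X_ne hx, ?_, ?_⟩
  · rw [slope_of_X_ne hx, slope_of_X_ne hx]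
    simp only [addX, negY, WeierstrassCurve.b₂, WeierstrassCurve.b₄, WeierstrassCurve.b₆]
    field_simp
    linear_combination (2 : F) * e₁ + 2 * e₂
  · rw [slope_of_X_ne hx, slope_of_X_ne hx]
    simp only [addX, negY, WeierstrassCurve.b₈, WeierstrassCurve.b₄, WeierstrassCurve.b₆]
    field_simp
    grind

/-- Gauss's lemma for the product of the linear forms `aX + bY` and `cX + dY`: if neither has its
coefficients in a common prime ideal, nor does the product. -/
lemma not_sym2_mem_prime {R : Type*} [CommRing R] (M : Ideal R) [hM : M.IsPrime] {a b c d : R}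
    (hab : IsCoprime a b) (hcd : IsCoprime c d) (h₁ : a * c ∈ M) (h₂ : a * d + b * c ∈ M)
    (h₃ : b * d ∈ M) : False := by
  have key : ∀ {a b : R}, IsCoprime a b → a ∈ M → b ∈ M → False := fun ⟨u, v, h⟩ ha hb =>
    hM.ne_top ((Ideal.eq_top_iff_one _).mpr
      (h ▸ M.add_mem (M.mul_mem_left u ha) (M.mul_mem_left v hb)))
  rcases hM.mem_or_mem h₁ with ha | hc
  · rcases hM.mem_or_mem h₃ with hb | hd
    · exact key hab ha hb
    · have : b * c ∈ M := (M.add_mem_iff_right (M.mul_mem_right d ha)).mp h₂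
      exact (hM.mem_or_mem this).elim (key hab ha) (fun hc => key hcd hc hd)
  · rcases hM.mem_or_mem h₃ with hb | hd
    · have : a * d ∈ M := (M.add_mem_iff_left (M.mul_mem_left b hc)).mp h₂
      exact (hM.mem_or_mem this).elim (fun ha => key hab ha hb) (key hcd hc)
    · exact key hcd hc hd

lemma exists_combination_of_no_prime {R : Type*} [CommRing R] {a b c : R}
    (h : ∀ M : Ideal R, M.IsPrime → a ∈ M → b ∈ M → c ∈ M → False) :
    ∃ u v w, u * a + v * b + w * c = 1 := by
  by_contra hne
  have htop : Ideal.span {a, b, c} ≠ ⊤ := fun htop => hne <| by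
    have := (Ideal.eq_top_iff_one _).mp htop
    simp only [Ideal.mem_span_insert, Ideal.mem_span_singleton'] at this
    obtain ⟨u, _, ⟨v, _, ⟨w, rfl⟩, rfl⟩, e⟩ := this
    exact ⟨u, v, w, by rw [e]; ring⟩
  obtain ⟨M, hM, hle⟩ := Ideal.exists_le_maximal _ htop
  have hs := Ideal.span_le.mp hle
  exact h M hM.isPrime (hs (by simp)) (hs (by simp)) (hs (by simp))

/-- The three binary forms giving `x(P + Q) x(P - Q)`, `x(P + Q) + x(P - Q)` and a common
denominator have no common zero, as long as the curve is nonsingular. -/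
lemma addSubForms_coprime [W.IsElliptic] {A B : F[X]} (hAB : IsCoprime A B) :
    ∃ u v w : F[X],
      u * ((X * A) ^ 2 - C W.b₄ * (X * A) * B - C W.b₆ * (X * B + A) * B - C W.b₈ * B ^ 2) +
      v * (2 * (X * B + A) * (X * A) + C W.b₂ * (X * A) * B + C W.b₄ * (X * B + A) * B +
        C W.b₆ * B ^ 2) + w * ((A - X * B) ^ 2) = 1 := by
  apply exists_combination_of_no_prime
  intro M hM h₁ h₂ h₃
  have key : ∀ i, (![X * A, X * B + A, B] : Fin 3 → F[X]) i ∈ M := by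
    intro i
    have := WeierstrassCurve.addSubMapCoeff_condition (W.map C) ![X * A, X * B + A, B] i
    refine hM.mem_of_pow_mem 4 ?_
    rw [← this, Fin.sum_univ_three]
    refine M.add_mem (M.add_mem (M.mul_mem_left _ ?_) (M.mul_mem_left _ ?_)) (M.mul_mem_left _ ?_)
    · simpa [WeierstrassCurve.addSubMap] using h₁
    · simpa [WeierstrassCurve.addSubMap] using h₂
    · have e : (A - X * B) ^ 2 = (X * B + A) ^ 2 - 4 * (X * A) * B := by ring
      simpa [WeierstrassCurve.addSubMap, e] using h₃
  exact not_sym2_mem_prime M (a := X) (b := 1) isCoprime_one_right hAB (key 0)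
    (by simpa using key 1) (by simpa using key 2)

/-- Multiplication by `n` on the curve is generically given on `x`-coordinates by the fraction
`A / B` in lowest terms, of degree `n²`. -/
structure IsMulFraction (W : WeierstrassCurve.Affine F) (n : ℕ) (A B : F[X]) : Prop where
  coprime : IsCoprime A B
  monic : A.Monic
  natDegree_num : A.natDegree = n ^ 2
  natDegree_den : B.natDegree + 1 = n ^ 2
  leadingCoeff_den : B.leadingCoeff = n ^ 2
  finite : {P : W.Point | ¬ ∃ x y h x' y' h', P = Point.some x y h ∧
    n • P = Point.some x' y' h' ∧ B.eval x ≠ 0 ∧ x' * B.eval x = A.eval x}.Finite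

lemma finite_setOf_x (s : Set F) (hs : s.Finite) :
    {P : W.Point | ∃ x y h, P = Point.some x y h ∧ x ∈ s}.Finite := by
  have : {P : W.Point | ∃ x y h, P = Point.some x y h ∧ x ∈ s} ⊆
      ⋃ x ∈ s, {P : W.Point | ∃ y h, P = Point.some x y h} := by
    rintro P ⟨x, y, h, e, hx⟩
    exact Set.mem_biUnion hx ⟨y, h, e⟩
  refine (hs.biUnion fun x _ => ?_).subset this
  by_cases hne : ∃ y, W.Nonsingular x y
  · obtain ⟨y, h⟩ := hne
    refine (Set.toFinite {Point.some x y h, -Point.some x y h}).subset ?_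
    rintro P ⟨y', h', rfl⟩
    exact Point.X_eq_iff.mp rfl
  · refine Set.finite_empty.subset ?_
    rintro P ⟨y', h', rfl⟩
    exact hne ⟨y', h'⟩

lemma finite_setOf_eval_eq_zero {p : F[X]} (hp : p ≠ 0) :
    {P : W.Point | ∃ x y h, P = Point.some x y h ∧ p.eval x = 0}.Finite :=
  finite_setOf_x {x | p.eval x = 0} (by
    refine (p.roots.toFinset.finite_toSet).subset fun x hx => ?_
    simpa [hp] using hx)

lemma exists_point_of_x [IsAlgClosed F] [W.IsElliptic] (x : F) :
    ∃ y, W.Nonsingular x y := by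
  obtain ⟨y, hy⟩ := IsAlgClosed.exists_root (p := (X ^ 2 + C (W.a₁ * x + W.a₃) * X -
    C (x ^ 3 + W.a₂ * x ^ 2 + W.a₄ * x + W.a₆) : F[X])) (by
      have : (X ^ 2 + C (W.a₁ * x + W.a₃) * X -
        C (x ^ 3 + W.a₂ * x ^ 2 + W.a₄ * x + W.a₆) : F[X]).degree = 2 := by compute_degree!
      rw [this]; decide)
  refine ⟨y, ?_⟩
  rw [← equation_iff_nonsingular]
  rw [WeierstrassCurve.Affine.equation_iff]
  simp [IsRoot] at hy
  linear_combination hy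

instance [IsAlgClosed F] [W.IsElliptic] : Infinite W.Point := by
  have : Infinite F := IsAlgClosed.instInfinite
  choose y hy using exists_point_of_x (W := W)
  exact Infinite.of_injective (fun x : F => Point.some x (y x) (hy x)) fun x x' h => by
    simpa using (Point.some.inj h).1

/-- Polynomials agree if they agree at the `x`-coordinates of all but finitely many points. -/
lemma eq_of_eventually_eval [IsAlgClosed F] [W.IsElliptic] {p q : F[X]} {s : Set W.Point}
    (hs : s.Finite)
    (h : ∀ x y h, Point.some x y h ∉ s → p.eval x = q.eval x) : p = q := by
  choose y hy using exists_point_of_x (W := W)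
  apply Polynomial.eq_of_infinite_eval_eq
  have : Infinite F := IsAlgClosed.instInfinite
  have hfin : {x : F | Point.some x (y x) (hy x) ∈ s}.Finite := by
    refine Set.Finite.preimage (f := fun x : F => Point.some x (y x) (hy x)) ?_ hs
    intro x _ x' _ h
    simpa using (Point.some.inj h).1
  exact (hfin.infinite_compl).mono fun x hx => h x _ (hy x) hx

end

section

variable {F : Type*} [Field F] [DecidableEq F] {W : WeierstrassCurve.Affine F}
open WeierstrassCurve.Affine Polynomial

lemma isMulFraction_one : IsMulFraction W 1 X 1 where
  coprime := isCoprime_one_right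
  monic := monic_X
  natDegree_num := by simp
  natDegree_den := by simp
  leadingCoeff_den := by simp
  finite := (Set.finite_singleton (0 : W.Point)).subset <| by
    rintro (_ | ⟨x, y, h⟩) hP
    · rfl
    · exact (hP ⟨x, y, h, x, y, h, rfl, one_smul _ _, by simp, by simp⟩).elim

/-- The duplication formula for `x`-coordinates. -/
lemma two_smul_x {x y : F} (h : W.Nonsingular x y)
    (hB : 4 * x ^ 3 + W.b₂ * x ^ 2 + 2 * W.b₄ * x + W.b₆ ≠ 0) :
    ∃ x' y' h', 2 • Point.some x y h = Point.some x' y' h' ∧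
      x' * (4 * x ^ 3 + W.b₂ * x ^ 2 + 2 * W.b₄ * x + W.b₆) =
        x ^ 4 - W.b₄ * x ^ 2 - 2 * W.b₆ * x - W.b₈ := by
  have e := (W.equation_iff x y).mp h.1
  have hy : y ≠ W.negY x y := by
    intro hy
    apply hB
    have hy' : 2 * y + W.a₁ * x + W.a₃ = 0 := by
      simp only [negY] at hy; linear_combination hy
    simp only [WeierstrassCurve.b₂, WeierstrassCurve.b₄, WeierstrassCurve.b₆]
    linear_combination (2 * y + W.a₁ * x + W.a₃) * hy' - 4 * e
  rw [two_smul, Point.add_self_of_Y_ne hy]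
  refine ⟨_, _, _, rfl, ?_⟩
  rw [slope_of_Y_ne rfl hy]
  have hy' : 2 * y + W.a₁ * x + W.a₃ ≠ 0 := fun h0 => hy (by
    simp only [negY]; linear_combination h0)
  have hd : y - W.negY x y = 2 * y + W.a₁ * x + W.a₃ := by simp only [negY]; ring
  have hψ : 4 * x ^ 3 + W.b₂ * x ^ 2 + 2 * W.b₄ * x + W.b₆ = (2 * y + W.a₁ * x + W.a₃) ^ 2 := by
    simp only [WeierstrassCurve.b₂, WeierstrassCurve.b₄, WeierstrassCurve.b₆]
    linear_combination -4 * e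
  have key : (3 * x ^ 2 + 2 * W.a₂ * x + W.a₄ - W.a₁ * y) ^ 2 +
      W.a₁ * (3 * x ^ 2 + 2 * W.a₂ * x + W.a₄ - W.a₁ * y) * (2 * y + W.a₁ * x + W.a₃) -
      (W.a₂ + 2 * x) * (2 * y + W.a₁ * x + W.a₃) ^ 2 =
      x ^ 4 - W.b₄ * x ^ 2 - 2 * W.b₆ * x - W.b₈ := by
    simp only [WeierstrassCurve.b₄, WeierstrassCurve.b₆, WeierstrassCurve.b₈]
    grind
  rw [hψ, hd, ← key]
  simp only [addX]
  generalize 2 * y + W.a₁ * x + W.a₃ = d at hy' ⊢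
  field_simp
  ring

lemma isMulFraction_two [CharZero F] [W.IsElliptic] : IsMulFraction W 2
    (X ^ 4 - C W.b₄ * X ^ 2 - 2 * C W.b₆ * X - C W.b₈)
    (4 * X ^ 3 + C W.b₂ * X ^ 2 + 2 * C W.b₄ * X + C W.b₆) where
  coprime := by
    obtain ⟨u, v, w, h⟩ := addSubForms_coprime (W := W) (A := X) (B := 1) isCoprime_one_right
    exact ⟨u, v, by rw [← h]; ring⟩
  monic := by monicity!
  natDegree_num := by compute_degree!
  natDegree_den := by
    have : (4 * X ^ 3 + C W.b₂ * X ^ 2 + 2 * C W.b₄ * X + C W.b₆ : F[X]).natDegree = 3 := by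
      compute_degree!
    rw [this]; norm_num
  leadingCoeff_den := by
    have : (4 * X ^ 3 + C W.b₂ * X ^ 2 + 2 * C W.b₄ * X + C W.b₆ : F[X]).natDegree = 3 := by
      compute_degree!
    rw [leadingCoeff, this]
    have h4 : (4 : F[X]) = C 4 := rfl
    have h2 : (2 : F[X]) = C 2 := rfl
    rw [h4, h2]
    simp [coeff_X_pow, mul_assoc]
    norm_num
  finite := by
    have hne : (4 * X ^ 3 + C W.b₂ * X ^ 2 + 2 * C W.b₄ * X + C W.b₆ : F[X]) ≠ 0 := by
      apply ne_zero_of_natDegree_gt (n := 2)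
      have : (4 * X ^ 3 + C W.b₂ * X ^ 2 + 2 * C W.b₄ * X + C W.b₆ : F[X]).natDegree = 3 := by
        compute_degree!
      rw [this]; norm_num
    refine ((Set.finite_singleton (0 : W.Point)).union
      (finite_setOf_eval_eq_zero hne)).subset ?_
    rintro (_ | ⟨x, y, h⟩) hP
    · exact Or.inl rfl
    · refine Or.inr ⟨x, y, h, rfl, ?_⟩
      by_contra hB
      have hB' : 4 * x ^ 3 + W.b₂ * x ^ 2 + 2 * W.b₄ * x + W.b₆ ≠ 0 := by simpa using hB
      obtain ⟨x', y', h', e, e'⟩ := two_smul_x h hB'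
      exact hP ⟨x, y, h, x', y', h', rfl, e, hB, by simpa using e'⟩

/-- If the fraction `A' / B'` in lowest terms is a root of `F₃ t² - F₂ t + F₁`, a polynomial whose
coefficients have no common factor, the other root is a fraction `A / B` in lowest terms such that
the polynomial is equal to `(B t - A) (B' t - A')`: by Gauss's lemma the two agree up to a unit. -/
lemma exists_fraction_of_mul_eq {A' B' F₁ F₂ F₃ : F[X]} (hc : IsCoprime A' B') (hB' : B' ≠ 0)
    (hF₃ : F₃ ≠ 0) (hF : ∃ u v w : F[X], u * F₁ + v * F₂ + w * F₃ = 1)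
    (h : (F₂ * B' - A' * F₃) * A' * F₃ = F₁ * (F₃ * B') * B') :
    ∃ A B : F[X], IsCoprime A B ∧ A * A' = F₁ ∧ A * B' + B * A' = F₂ ∧ B * B' = F₃ := by
  -- the fraction `F₂ / F₃ - A' / B'` in lowest terms
  have hden : F₃ * B' ≠ 0 := mul_ne_zero hF₃ hB'
  obtain ⟨A, B, hAB, g, hg, hA, hB⟩ : ∃ A B : F[X], IsCoprime A B ∧ ∃ g, g ≠ 0 ∧
      F₂ * B' - A' * F₃ = g * A ∧ F₃ * B' = g * B := by
    have hg : EuclideanDomain.gcd (F₂ * B' - A' * F₃) (F₃ * B') ≠ 0 := fun h0 =>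
      hden (EuclideanDomain.gcd_eq_zero_iff.mp h0).2
    obtain ⟨A, hA⟩ := EuclideanDomain.gcd_dvd_left (F₂ * B' - A' * F₃) (F₃ * B')
    obtain ⟨B, hB⟩ := EuclideanDomain.gcd_dvd_right (F₂ * B' - A' * F₃) (F₃ * B')
    refine ⟨A, B, ?_, _, hg, hA, hB⟩
    have := EuclideanDomain.gcd_eq_gcd_ab (F₂ * B' - A' * F₃) (F₃ * B')
    refine ⟨EuclideanDomain.gcdA (F₂ * B' - A' * F₃) (F₃ * B'),
      EuclideanDomain.gcdB (F₂ * B' - A' * F₃) (F₃ * B'), mul_left_cancel₀ hg ?_⟩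
    linear_combination -this - EuclideanDomain.gcdA (F₂ * B' - A' * F₃) (F₃ * B') * hA -
      EuclideanDomain.gcdB (F₂ * B' - A' * F₃) (F₃ * B') * hB
  have hB0 : B ≠ 0 := fun h0 => hden (by rw [hB, h0, mul_zero])
  have e₂ : (A * B' + B * A') * F₃ = F₂ * (B * B') := by
    apply mul_left_cancel₀ hg
    linear_combination (-F₃ * B') * hA + (F₂ * B' - A' * F₃) * hB
  have e₁ : (A * A') * F₃ = F₁ * (B * B') := by
    apply mul_left_cancel₀ hg
    linear_combination (-A' * F₃) * hA + (F₁ * B') * hB + h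
  obtain ⟨u, v, w, huvw⟩ := hF
  obtain ⟨u', v', w', huvw'⟩ : ∃ u v w, u * (A * A') + v * (A * B' + B * A') + w * (B * B') = 1 :=
    exists_combination_of_no_prime fun M hM h₁ h₂ h₃ => not_sym2_mem_prime M hAB hc h₁ h₂ h₃
  have d₁ : F₃ ∣ B * B' := ⟨u * (A * A') + v * (A * B' + B * A') + w * (B * B'), by
    linear_combination (-B * B') * huvw - u * e₁ - v * e₂⟩
  have d₂ : B * B' ∣ F₃ := ⟨u' * F₁ + v' * F₂ + w' * F₃, by
    linear_combination (-F₃) * huvw' + u' * e₁ + v' * e₂⟩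
  obtain ⟨c, hc'⟩ := associated_of_dvd_dvd d₂ d₁
  refine ⟨c * A, c * B, ?_, ?_, ?_, ?_⟩
  · exact (isCoprime_mul_unit_left c.isUnit A B).mpr hAB
  · apply mul_right_cancel₀ (mul_ne_zero hB0 hB')
    linear_combination e₁ + (A * A') * hc'
  · apply mul_right_cancel₀ (mul_ne_zero hB0 hB')
    linear_combination e₂ + (A * B' + B * A') * hc'
  · rw [← hc']; ring

end

section

variable {F : Type*} [Field F] [DecidableEq F] {W : WeierstrassCurve.Affine F}
open WeierstrassCurve.Affine Polynomial

lemma IsMulFraction.sub_X_mul [CharZero F] {n : ℕ} {A B : F[X]} (hn : 1 ≤ n)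
    (h : IsMulFraction W (n + 1) A B) : (A - X * B).natDegree = (n + 1) ^ 2 ∧
      (A - X * B).leadingCoeff = 1 - ((n : F) + 1) ^ 2 := by
  have hB : B.natDegree + 1 = (n + 1) ^ 2 := h.natDegree_den
  have hc : (A - X * B).coeff ((n + 1) ^ 2) = 1 - ((n : F) + 1) ^ 2 := by
    rw [coeff_sub, ← hB, coeff_X_mul, hB, ← h.natDegree_num, coeff_natDegree, h.monic,
      coeff_natDegree, h.leadingCoeff_den]
    push_cast; ring
  have hc0 : (A - X * B).coeff ((n + 1) ^ 2) ≠ 0 := by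
    rw [hc]
    have : (1 : F) - ((n : F) + 1) ^ 2 = -((n * (n + 2) : ℕ) : F) := by push_cast; ring
    rw [this, neg_ne_zero, Nat.cast_ne_zero]
    positivity
  have hle : (A - X * B).natDegree ≤ (n + 1) ^ 2 := by
    refine (natDegree_sub_le _ _).trans (max_le h.natDegree_num.le ?_)
    refine natDegree_mul_le.trans ?_
    rw [natDegree_X]; omega
  have hdeg := natDegree_eq_of_le_of_coeff_ne_zero hle hc0
  exact ⟨hdeg, by rw [leadingCoeff, hdeg, hc]⟩

lemma IsMulFraction.numerator_form {n : ℕ} {A B : F[X]} (h : IsMulFraction W n A B) :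
    ((X * A) ^ 2 - C W.b₄ * (X * A) * B - C W.b₆ * (X * B + A) * B - C W.b₈ * B ^ 2).Monic ∧
    ((X * A) ^ 2 - C W.b₄ * (X * A) * B - C W.b₆ * (X * B + A) * B -
      C W.b₈ * B ^ 2).natDegree = 2 * n ^ 2 + 2 := by
  have hA := h.natDegree_num
  have hB := h.natDegree_den
  have hm : ((X * A) ^ 2 : F[X]).Monic := (monic_X.mul h.monic).pow 2
  have hdeg : ((X * A) ^ 2 : F[X]).natDegree = 2 * n ^ 2 + 2 := by
    rw [(monic_X.mul h.monic).natDegree_pow, monic_X.natDegree_mul h.monic, natDegree_X, hA]; ring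
  have hXB : (X * B + A).natDegree ≤ n ^ 2 := by
    refine (natDegree_add_le _ _).trans (max_le ?_ hA.le)
    refine natDegree_mul_le.trans ?_
    rw [natDegree_X]; omega
  have hXA : (X * A).natDegree ≤ n ^ 2 + 1 := by
    refine natDegree_mul_le.trans ?_
    rw [natDegree_X]; omega
  have hrest : (C W.b₄ * (X * A) * B + C W.b₆ * (X * B + A) * B + C W.b₈ * B ^ 2).natDegree ≤
      2 * n ^ 2 := by
    refine (natDegree_add_le _ _).trans (max_le ((natDegree_add_le _ _).trans (max_le ?_ ?_)) ?_)
    · refine natDegree_mul_le.trans (le_trans (add_le_add_left (natDegree_C_mul_le _ _) _) ?_)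
      omega
    · refine natDegree_mul_le.trans (le_trans (add_le_add_left (natDegree_C_mul_le _ _) _) ?_)
      omega
    · refine (natDegree_C_mul_le _ _).trans (natDegree_pow_le.trans ?_)
      omega
  have hlt : (C W.b₄ * (X * A) * B + C W.b₆ * (X * B + A) * B + C W.b₈ * B ^ 2).degree <
      ((X * A) ^ 2 : F[X]).degree := by
    apply degree_lt_degree
    omega
  have e : (X * A) ^ 2 - C W.b₄ * (X * A) * B - C W.b₆ * (X * B + A) * B - C W.b₈ * B ^ 2 =
    (X * A) ^ 2 - (C W.b₄ * (X * A) * B + C W.b₆ * (X * B + A) * B + C W.b₈ * B ^ 2) := by ring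
  rw [e]
  exact ⟨hm.sub_of_left hlt, by rw [natDegree_sub_eq_left_of_natDegree_lt (by omega), hdeg]⟩

/-- The recursion step: `x((n + 2)P)` and `x(nP)` are the two roots of a quadratic polynomial that
is determined by `x((n + 1)P)` and `x(P)`. -/
lemma isMulFraction_step [IsAlgClosed F] [CharZero F] [W.IsElliptic] {n : ℕ} (hn : 1 ≤ n)
    {A' B' A B : F[X]} (h' : IsMulFraction W n A' B') (h : IsMulFraction W (n + 1) A B) :
    ∃ A'' B'', IsMulFraction W (n + 2) A'' B'' := by
  obtain ⟨hdeg, hlead⟩ := h.sub_X_mul hn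
  obtain ⟨hm₁, hdeg₁⟩ := h.numerator_form
  have hD : A - X * B ≠ 0 := ne_zero_of_natDegree_gt (n := 0) (by rw [hdeg]; positivity)
  have hB' : B' ≠ 0 := fun h0 => by
    have := h'.leadingCoeff_den
    rw [h0, leadingCoeff_zero, eq_comm, pow_eq_zero_iff two_ne_zero, Nat.cast_eq_zero] at this
    omega
  have hfin := (h'.finite.union h.finite).union (finite_setOf_eval_eq_zero (W := W) hD)
  -- at a point outside a finite set the addition law can be evaluated
  obtain ⟨bad, hbad, hgen⟩ : ∃ bad : Set W.Point, bad.Finite ∧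
      ∀ x y hP, Point.some x y hP ∉ bad → ∃ x₁ x₂ x₃ y₃ h₃,
      x₁ * B.eval x = A.eval x ∧ x₂ * B'.eval x = A'.eval x ∧ A.eval x - x * B.eval x ≠ 0 ∧
      (n + 2) • Point.some x y hP = Point.some x₃ y₃ h₃ ∧
      (x₃ + x₂) * (x₁ - x) ^ 2 = 2 * (x₁ + x) * (x₁ * x) + W.b₂ * (x₁ * x) +
        W.b₄ * (x₁ + x) + W.b₆ ∧
      (x₃ * x₂) * (x₁ - x) ^ 2 = (x₁ * x) ^ 2 - W.b₄ * (x₁ * x) - W.b₆ * (x₁ + x) - W.b₈ := by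
    refine ⟨_, hfin, fun x y hP hnot => ?_⟩
    simp only [Set.mem_union, not_or] at hnot
    obtain ⟨⟨hn₁, hn₂⟩, hn₃⟩ := hnot
    obtain ⟨x', y', _, x₂, y₂, h₂, e, e₂, hB₂, hA₂⟩ := not_not.mp hn₁
    obtain ⟨rfl, rfl⟩ := Point.some.inj e
    obtain ⟨x', y', _, x₁, y₁, h₁, e', e₁, hB₁, hA₁⟩ := not_not.mp hn₂
    obtain ⟨rfl, rfl⟩ := Point.some.inj e'
    have hD' : A.eval x - x * B.eval x ≠ 0 := fun h0 => hn₃ ⟨x, y, hP, rfl, by simpa using h0⟩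
    have hx : x₁ ≠ x := by
      rintro rfl
      exact hD' (by rw [← hA₁, sub_self])
    obtain ⟨x₃, y₃, x₄, y₄, h₃, h₄, a₃, a₄, s, p⟩ := add_sub_x h₁ hP hx
    have : Point.some x₄ y₄ h₄ = Point.some x₂ y₂ h₂ := by
      rw [← a₄, ← e₂, ← e₁, succ_nsmul, add_sub_cancel_right]
    obtain ⟨rfl, rfl⟩ := Point.some.inj this
    exact ⟨x₁, x₄, x₃, y₃, h₃, hA₁, hA₂, hD', by rw [← a₃, ← e₁, ← succ_nsmul], s, p⟩
  obtain ⟨A'', B'', hco, hA'', hS, hB''⟩ := exists_fraction_of_mul_eq h'.coprime hB'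
    (pow_ne_zero 2 hD) (addSubForms_coprime (W := W) h.coprime) (by
      apply eq_of_eventually_eval hbad
      intro x y hP hnot
      obtain ⟨x₁, x₂, x₃, y₃, h₃, hA₁, hA₂, -, -, s, p⟩ := hgen x y hP hnot
      simp only [eval_mul, eval_add, eval_sub, eval_pow, eval_X, eval_C, eval_ofNat, ← hA₁, ← hA₂]
      generalize B.eval x = b
      generalize B'.eval x = b'
      linear_combination (b' ^ 2 * b ^ 4 * x₂ * (x₁ - x) ^ 2) * (-s) +
        b' ^ 2 * b ^ 4 * (x₁ - x) ^ 2 * p)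
  have hn0 : (n : F) ≠ 0 := Nat.cast_ne_zero.mpr (by omega)
  have hA''m : A''.Monic := h'.monic.of_mul_monic_right (hA'' ▸ hm₁)
  have hB''0 : B'' ≠ 0 := fun h0 => pow_ne_zero 2 hD (by rw [← hB'', h0, zero_mul])
  refine ⟨A'', B'', hco, hA''m, ?_, ?_, ?_, ?_⟩
  · have := congrArg natDegree hA''
    rw [hA''m.natDegree_mul h'.monic, hdeg₁, h'.natDegree_num] at this
    linarith
  · have := congrArg natDegree hB''
    rw [natDegree_mul hB''0 hB', natDegree_pow, hdeg] at this
    have := h'.natDegree_den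
    linarith
  · have := congrArg leadingCoeff hB''
    rw [leadingCoeff_mul, leadingCoeff_pow, hlead, h'.leadingCoeff_den] at this
    apply mul_right_cancel₀ (pow_ne_zero 2 hn0)
    rw [this]; push_cast; ring
  · refine (hbad.insert 0).subset fun P hP => ?_
    by_contra hnot
    rcases P with _ | ⟨x, y, hxy⟩
    · exact hnot (Or.inl rfl)
    · obtain ⟨x₁, x₂, x₃, y₃, h₃, hA₁, hA₂, hD', e, s, p⟩ := hgen x y hxy fun h => hnot (Or.inr h)
      have eB : B''.eval x * B'.eval x = (A.eval x - x * B.eval x) ^ 2 := by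
        rw [← eval_mul, hB'']; simp
      have hB0 : B''.eval x ≠ 0 := fun h0 => pow_ne_zero 2 hD' (by rw [← eB, h0, zero_mul])
      have hB'0 : B'.eval x ≠ 0 := fun h0 => pow_ne_zero 2 hD' (by rw [← eB, h0, mul_zero])
      refine hP ⟨x, y, hxy, x₃, y₃, h₃, rfl, e, hB0, ?_⟩
      have eS : A''.eval x * B'.eval x + B''.eval x * A'.eval x =
          2 * (x * B.eval x + A.eval x) * (x * A.eval x) + W.b₂ * (x * A.eval x) * B.eval x +
          W.b₄ * (x * B.eval x + A.eval x) * B.eval x + W.b₆ * B.eval x ^ 2 := by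
        rw [← eval_mul, ← eval_mul, ← eval_add, hS]; simp
      rw [← hA₁] at eB eS
      rw [← hA₂] at eS
      apply mul_right_cancel₀ hB'0
      linear_combination (B.eval x ^ 2) * s + (x₃ + x₂) * eB - eS

theorem exists_isMulFraction [IsAlgClosed F] [CharZero F] [W.IsElliptic] {n : ℕ} (hn : n ≠ 0) :
    ∃ A B, IsMulFraction W n A B := by
  have key : ∀ k, (∃ A B, IsMulFraction W (k + 1) A B) ∧ ∃ A B, IsMulFraction W (k + 2) A B := by
    intro k
    induction k with
    | zero => exact ⟨⟨_, _, isMulFraction_one⟩, ⟨_, _, isMulFraction_two⟩⟩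
    | succ k ih =>
      obtain ⟨⟨A', B', h'⟩, ⟨A, B, h⟩⟩ := ih
      exact ⟨⟨A, B, h⟩, isMulFraction_step (by omega) h' h⟩
  obtain ⟨k, rfl⟩ := Nat.exists_eq_succ_of_ne_zero hn
  exact (key k).1

/-- Away from finitely many values of `c`, the polynomial `A - c B` has `n²` distinct roots: at a
multiple root the Wronskian `A' B - A B'` vanishes. -/
lemma IsMulFraction.roots [CharZero F] [IsAlgClosed F] {n : ℕ} {A B : F[X]} (hn : n ≠ 0)
    (h : IsMulFraction W n A B) : ∃ s : Set F, s.Finite ∧ ∀ c ∉ s,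
      (A - C c * B).roots.toFinset.card = n ^ 2 := by
  have hA := h.natDegree_num
  have hB := h.natDegree_den
  have hn2 : n ^ 2 ≠ 0 := pow_ne_zero 2 hn
  have hlt : ∀ c, (A - C c * B).natDegree = n ^ 2 := fun c => by
    have : (C c * B).natDegree < A.natDegree :=
      lt_of_le_of_lt (natDegree_C_mul_le _ _) (by omega)
    rw [natDegree_sub_eq_left_of_natDegree_lt this, hA]
  have hW : derivative A * B - A * derivative B ≠ 0 := by
    intro h0
    have hdvd : A ∣ derivative A := h.coprime.dvd_of_dvd_mul_right ⟨_, sub_eq_zero.mp h0⟩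
    have hlt := natDegree_derivative_lt (p := A) (by omega)
    have := derivative_eq_zero.mp (eq_zero_of_dvd_of_natDegree_lt hdvd hlt)
    omega
  refine ⟨(fun x => A.eval x / B.eval x) '' {x | (derivative A * B - A * derivative B).eval x = 0},
    Set.Finite.image _ (((derivative A * B - A * derivative B).roots.toFinset.finite_toSet).subset
      fun x hx => by simpa [hW] using hx), fun c hc => ?_⟩
  have hne : A - C c * B ≠ 0 := ne_zero_of_natDegree_gt (n := 0) (by rw [hlt]; positivity)
  have hnodup : (A - C c * B).roots.Nodup := by
    rw [nodup_roots_iff_of_splits hne (IsAlgClosed.splits _)]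
    rw [separable_def]
    refine isCoprime_of_irreducible_dvd (fun h0 => hne h0.1) fun z hz hd₁ hd₂ => ?_
    obtain ⟨x, hx⟩ := IsAlgClosed.exists_root z hz.degree_pos.ne'
    have e₁ : A.eval x - c * B.eval x = 0 := by simpa using hx.dvd hd₁
    have e₂ : (derivative A).eval x - c * (derivative B).eval x = 0 := by simpa using hx.dvd hd₂
    have hBx : B.eval x ≠ 0 := fun h0 => by
      obtain ⟨u, v, huv⟩ := h.coprime
      have := congrArg (eval x) huv
      rw [h0, mul_zero, sub_zero] at e₁
      simp [h0, e₁] at this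
    refine hc ⟨x, ?_, ?_⟩
    · simp only [Set.mem_ofPred_eq, eval_sub, eval_mul]
      linear_combination B.eval x * e₂ - (derivative B).eval x * e₁
    · change A.eval x / B.eval x = c
      rw [div_eq_iff hBx]; linear_combination e₁
  rw [Multiset.toFinset_card_of_nodup hnodup, (IsAlgClosed.card_roots_eq_natDegree), hlt]

end

/-! ### The number of `n`-torsion points -/

section

variable {F : Type*} [Field F] [DecidableEq F] {W : WeierstrassCurve.Affine F}
open WeierstrassCurve.Affine Polynomial

lemma finite_setOf_two_torsion [CharZero F] [W.IsElliptic] :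
    {P : W.Point | -P = P}.Finite := by
  refine (isMulFraction_two (W := W)).finite.subset ?_
  rintro P hP ⟨x, y, h, x', y', h', -, e, -⟩
  rw [two_smul] at e
  nth_rewrite 1 [← show -P = P from hP] at e
  rw [neg_add_cancel] at e
  cases e

/-- All but finitely many points `Q` have `n²` preimages under multiplication by `n`.  As `Q ≠ -Q`,
the `x`-coordinate is injective on the fiber, and it identifies the fiber with the set of roots of
`A - c B`, for `c` the `x`-coordinate of `Q`. -/
lemma exists_finite_card_fiber [CharZero F] [IsAlgClosed F] [W.IsElliptic] {n : ℕ} (hn : n ≠ 0) :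
    ∃ s : Set W.Point, s.Finite ∧ ∀ Q ∉ s, {P : W.Point | n • P = Q}.ncard = n ^ 2 := by
  obtain ⟨A, B, h⟩ := exists_isMulFraction (W := W) hn
  obtain ⟨t, ht, hroots⟩ := h.roots hn
  obtain ⟨bad, hbad, hgood⟩ : ∃ bad : Set W.Point, bad.Finite ∧ ∀ P ∉ bad,
    ∃ x y h x' y' h', P = Point.some x y h ∧
    n • P = Point.some x' y' h' ∧ B.eval x ≠ 0 ∧ x' * B.eval x = A.eval x :=
    ⟨_, h.finite, fun P hP => not_not.mp hP⟩
  refine ⟨{0} ∪ {P | -P = P} ∪ (fun P => n • P) '' bad ∪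
    {P | ∃ x y h, P = Point.some x y h ∧ x ∈ t} ∪ {P | ∃ x y h, P = Point.some x y h ∧
      x ∈ (fun P : W.Point => A.eval (P.xRep 0) / B.eval (P.xRep 0)) '' bad}, ?_, ?_⟩
  · exact ((((Set.finite_singleton 0).union finite_setOf_two_torsion).union (hbad.image _)).union
      (finite_setOf_x t ht)).union (finite_setOf_x _ (hbad.image _))
  intro Q hQ
  simp only [Set.mem_union, not_or] at hQ
  obtain ⟨⟨⟨⟨hQ0, hQ2⟩, hQbad⟩, hQt⟩, hQx⟩ := hQ
  rcases Q with _ | ⟨c, d, hcd⟩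
  · exact (hQ0 rfl).elim
  have hct : c ∉ t := fun hc => hQt ⟨c, d, hcd, rfl, hc⟩
  have hne : A - C c * B ≠ 0 := fun h0 => by
    have := hroots c hct
    rw [h0, roots_zero] at this
    exact pow_ne_zero 2 hn (by simpa using this.symm)
  rw [← hroots c hct, ← Set.ncard_coe_finset]
  have hinj : Set.InjOn (fun P : W.Point => P.xRep 0)
      {P : W.Point | n • P = Point.some c d hcd} := by
    intro P hP P' hP' hx
    have hP₁ : n • P = Point.some c d hcd := hP
    have hP₂ : n • P' = Point.some c d hcd := hP'
    rcases P with _ | ⟨x, y, hxy⟩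
    · exact absurd ((smul_zero n).symm.trans hP₁) (Point.some_ne_zero hcd).symm
    rcases P' with _ | ⟨x', y', hxy'⟩
    · exact absurd ((smul_zero n).symm.trans hP₂) (Point.some_ne_zero hcd).symm
    rcases Point.X_eq_iff.mp (show x = x' from hx) with e | e
    · exact e
    · refine (hQ2 ?_).elim
      change -Point.some c d hcd = Point.some c d hcd
      nth_rewrite 2 [← hP₁]
      rw [e, smul_neg, hP₂]
  rw [← hinj.ncard_image]
  congr 1
  ext r
  simp only [Set.mem_image, Finset.mem_coe, Multiset.mem_toFinset, mem_roots hne, IsRoot.def,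
    eval_sub, eval_mul, eval_C, Set.mem_ofPred_eq]
  constructor
  · rintro ⟨P, hP, rfl⟩
    obtain ⟨x, y, hxy, x', y', h', e, e', -, e''⟩ := hgood P fun hb => hQbad ⟨P, hb, hP⟩
    rw [hP] at e'
    obtain ⟨rfl, rfl⟩ := Point.some.inj e'
    rw [e, Point.xRep_some]
    simp [e'']
  · intro hr
    obtain ⟨y, hy⟩ := exists_point_of_x (W := W) r
    have hB : B.eval r ≠ 0 := fun h0 => by
      obtain ⟨u, v, huv⟩ := h.coprime
      have := congrArg (eval r) huv
      rw [h0, mul_zero, sub_zero] at hr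
      simp [h0, hr] at this
    have hnb : Point.some r y hy ∉ bad := fun hb => hQx ⟨c, d, hcd, rfl, _, hb, by
      simp only [Point.xRep_some, Matrix.cons_val_zero]
      rw [div_eq_iff hB]; linear_combination hr⟩
    obtain ⟨x, y', hxy, x', y'', h', e, e', -, e''⟩ := hgood _ hnb
    obtain ⟨rfl, rfl⟩ := Point.some.inj e
    have hxc : x' = c := mul_right_cancel₀ hB (by linear_combination e'' + hr)
    subst hxc
    rcases Point.X_eq_iff (h₁ := h') (h₂ := hcd) |>.mp rfl with e₁ | e₁
    · exact ⟨_, e'.trans e₁, rfl⟩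
    · exact ⟨-Point.some r y hy, by rw [smul_neg, e', e₁, neg_neg], by simp⟩

/-- Multiplication by a positive integer is surjective on the points over an algebraically closed
field of characteristic zero. -/
theorem nsmul_surjective [CharZero F] [IsAlgClosed F] [W.IsElliptic] {n : ℕ} (hn : n ≠ 0) :
    Function.Surjective (fun P : W.Point => n • P) := by
  obtain ⟨s, hs, hcard⟩ := exists_finite_card_fiber (W := W) hn
  have hex : ∀ Q ∉ s, ∃ P : W.Point, n • P = Q := fun Q hQ => by
    have := (Set.nonempty_of_ncard_ne_zero (by rw [hcard Q hQ]; exact pow_ne_zero 2 hn))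
    exact this
  intro Q
  obtain ⟨R, hR⟩ := (hs.union (hs.image (fun R => Q - R))).exists_notMem
  simp only [Set.mem_union, not_or] at hR
  obtain ⟨P₁, h₁⟩ := hex R hR.1
  obtain ⟨P₂, h₂⟩ := hex (Q - R) fun h => hR.2 ⟨Q - R, h, by simp⟩
  exact ⟨P₁ + P₂, by simp only [smul_add, h₁, h₂]; abel⟩

/-- Over an algebraically closed field of characteristic zero, `E[n]` has `n²` elements. -/
theorem ncard_torsion [CharZero F] [IsAlgClosed F] [W.IsElliptic] {n : ℕ} (hn : n ≠ 0) :
    {P : W.Point | n • P = 0}.ncard = n ^ 2 := by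
  obtain ⟨s, hs, hcard⟩ := exists_finite_card_fiber (W := W) hn
  obtain ⟨Q, hQ⟩ := hs.exists_notMem
  obtain ⟨P₀, h₀⟩ := nsmul_surjective (W := W) hn Q
  rw [← hcard Q hQ, ← Set.ncard_image_of_injective _ (add_right_injective P₀)]
  congr 1
  ext P
  simp only [Set.mem_image, Set.mem_ofPred_eq]
  refine ⟨?_, fun h => ⟨P - P₀, ?_, by abel⟩⟩
  · rintro ⟨P, hP, rfl⟩
    rw [smul_add, hP, add_zero]; exact h₀
  · rw [smul_sub, h]; exact sub_eq_zero.mpr h₀.symm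

end

/-! ### The coordinate ring as a Dedekind domain -/

section

variable {F : Type*} [Field F] [DecidableEq F] {W : WeierstrassCurve.Affine F}
open WeierstrassCurve.Affine Polynomial

lemma XYIdeal_isMaximal {x y : F} (h : W.Nonsingular x y) :
    (CoordinateRing.XYIdeal W x (C y)).IsMaximal :=
  Ideal.Quotient.maximal_of_isField _ <| MulEquiv.isField (Field.toIsField F)
    (CoordinateRing.quotientXYIdealEquiv (W' := W) (x := x) (y := C y) (by
      simpa [WeierstrassCurve.Affine.Equation, evalEval] using h.1)).toMulEquiv

/-- Evaluation of elements of the coordinate ring at an affine point. -/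
def evalPt {x y : F} (h : W.Nonsingular x y) : W.CoordinateRing →+* F := AdjoinRoot.evalEval h.1

lemma evalPt_mk {x y : F} (h : W.Nonsingular x y) (p : F[X][X]) :
    evalPt h (CoordinateRing.mk W p) = p.evalEval x y := AdjoinRoot.evalEval_mk h.1 p

lemma ker_evalPt {x y : F} (h : W.Nonsingular x y) :
    RingHom.ker (evalPt h) = CoordinateRing.XYIdeal W x (C y) := by
  refine ((XYIdeal_isMaximal h).eq_of_le (RingHom.ker_ne_top _) ?_).symm
  rw [CoordinateRing.XYIdeal, Ideal.span_le]
  rintro a (rfl | rfl)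
  · rw [SetLike.mem_coe, RingHom.mem_ker, CoordinateRing.XClass, evalPt_mk]
    simp [evalEval]
  · rw [SetLike.mem_coe, RingHom.mem_ker, CoordinateRing.YClass, evalPt_mk]
    simp

lemma mem_XYIdeal_iff {x y : F} (h : W.Nonsingular x y) (a : W.CoordinateRing) :
    a ∈ CoordinateRing.XYIdeal W x (C y) ↔ evalPt h a = 0 := by
  rw [← ker_evalPt h, RingHom.mem_ker]

lemma XYIdeal_ne_bot {x : F} {y : F[X]} : CoordinateRing.XYIdeal W x y ≠ ⊥ := fun h =>
  CoordinateRing.XClass_ne_zero (W' := W) x <| by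
    rw [← Ideal.mem_bot, ← h]; exact Ideal.subset_span (by simp)

instance : Module.Finite F[X] W.CoordinateRing := Module.Finite.of_basis (CoordinateRing.basis W)

instance : IsNoetherianRing W.CoordinateRing := IsNoetherianRing.of_finite F[X] _

instance : Algebra.FiniteType F W.CoordinateRing :=
  Algebra.FiniteType.trans (S := F[X]) inferInstance inferInstance

lemma isMaximal_of_isPrime {p : Ideal W.CoordinateRing} (hp : p.IsPrime) (h0 : p ≠ ⊥) :
    p.IsMaximal := by
  obtain ⟨a, ha, ha0⟩ := Submodule.exists_mem_ne_zero_of_ne_bot h0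
  have : Algebra.IsIntegral F[X] W.CoordinateRing := Algebra.IsIntegral.of_finite _ _
  have hb : p.comap (algebraMap F[X] W.CoordinateRing) ≠ ⊥ :=
    Ideal.comap_ne_bot_of_integral_mem ha0 ha (Algebra.IsIntegral.isIntegral a)
  have : (p.comap (algebraMap F[X] W.CoordinateRing)).IsMaximal :=
    IsPrime.to_maximal_ideal hb
  exact Ideal.isMaximal_of_isIntegral_of_isMaximal_comap p this

/-- Over an algebraically closed field every maximal ideal of the coordinate ring is the ideal of
a point. -/
lemma exists_eq_XYIdeal [IsAlgClosed F] [W.IsElliptic] (M : Ideal W.CoordinateRing)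
    [hM : M.IsMaximal] : ∃ x y, ∃ _ : W.Nonsingular x y, M = CoordinateRing.XYIdeal W x (C y) := by
  let _ := Ideal.Quotient.field M
  have : Module.Finite F (W.CoordinateRing ⧸ M) :=
    finite_of_finite_type_of_isJacobsonRing F (W.CoordinateRing ⧸ M)
  have hbij : Function.Bijective (algebraMap F (W.CoordinateRing ⧸ M)) :=
    IsAlgClosed.algebraMap_bijective_of_isIntegral
  obtain ⟨x, hx⟩ := hbij.2 (Ideal.Quotient.mk M (CoordinateRing.mk W (C X)))
  obtain ⟨y, hy⟩ := hbij.2 (Ideal.Quotient.mk M (CoordinateRing.mk W X))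
  have key : ∀ p : F[X][X], algebraMap F (W.CoordinateRing ⧸ M) (p.evalEval x y) =
      Ideal.Quotient.mk M (CoordinateRing.mk W p) := by
    intro p
    have : (algebraMap F (W.CoordinateRing ⧸ M)).comp (evalEvalRingHom x y) =
        (Ideal.Quotient.mk M).comp (CoordinateRing.mk W) := by
      apply Polynomial.ringHom_ext
      · intro a
        induction a using Polynomial.induction_on' with
        | add p q hp hq => simp only [map_add, hp, hq]
        | monomial n a =>
          rw [← C_mul_X_pow_eq_monomial]
          have hC : Ideal.Quotient.mk M (CoordinateRing.mk W (C (C a))) = algebraMap F _ a := rfl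
          simp only [map_mul, map_pow, RingHom.comp_apply, hC, ← hx,
            coe_evalRingHom, eval_C, eval_X]
      · simpa using hy
    exact DFunLike.congr_fun this p
  have heq : W.Equation x y := by
    apply hbij.1
    rw [key, CoordinateRing.mk, AdjoinRoot.mk_self, map_zero, map_zero]
  have hns : W.Nonsingular x y := (equation_iff_nonsingular).mp heq
  refine ⟨x, y, hns, ((XYIdeal_isMaximal hns).eq_of_le hM.ne_top ?_).symm⟩
  rw [CoordinateRing.XYIdeal, Ideal.span_le]
  rintro a (rfl | rfl)
  · rw [SetLike.mem_coe, ← Ideal.Quotient.eq_zero_iff_mem, CoordinateRing.XClass, ← key]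
    rw [show evalEval x y (C (X - C x)) = 0 by simp [evalEval], map_zero]
  · rw [SetLike.mem_coe, ← Ideal.Quotient.eq_zero_iff_mem, CoordinateRing.YClass, ← key]
    rw [show evalEval x y (X - C (C y)) = 0 by simp, map_zero]

lemma isUnit_XYIdeal {x y : F} (h : W.Nonsingular x y) :
    IsUnit ((CoordinateRing.XYIdeal W x (C y) : Ideal W.CoordinateRing) :
      FractionalIdeal W.CoordinateRing⁰ W.FunctionField) :=
  ⟨CoordinateRing.XYIdeal' (W := W) h, CoordinateRing.XYIdeal'_eq h⟩

/-- A Noetherian domain all of whose maximal ideals are invertible is a Dedekind domain. -/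
lemma isDedekindDomain_of_isUnit_maximal {A K : Type*} [CommRing A] [IsDomain A]
    [IsNoetherianRing A] [Field K] [Algebra A K] [IsFractionRing A K]
    (h : ∀ M : Ideal A, M.IsMaximal → IsUnit (M : FractionalIdeal A⁰ K)) : IsDedekindDomain A := by
  have key : ∀ I : Ideal A, I ≠ ⊥ → IsUnit (I : FractionalIdeal A⁰ K) := by
    intro I
    induction I using IsNoetherian.induction with
    | hgt I ih =>
      intro hI
      by_cases htop : I = ⊤
      · rw [htop, FractionalIdeal.coeIdeal_top]; exact isUnit_one
      obtain ⟨M, hM, hIM⟩ := Ideal.exists_le_maximal I htop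
      obtain ⟨u, hu⟩ := h M hM
      -- `J = M⁻¹ I` is an integral ideal strictly containing `I`
      obtain ⟨J, hJ⟩ : ∃ J : Ideal A, (J : FractionalIdeal A⁰ K) = ↑u⁻¹ * I :=
        FractionalIdeal.le_one_iff_exists_coeIdeal.mp (by
          rw [← Units.inv_mul u, hu]
          exact mul_le_mul_right (FractionalIdeal.coeIdeal_le_coeIdeal K |>.mpr hIM) _)
      have hMJ : M * J = I := by
        rw [← FractionalIdeal.coeIdeal_inj (K := K), FractionalIdeal.coeIdeal_mul, hJ, ← hu,
          Units.mul_inv_cancel_left]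
      have hle : I ≤ J := hMJ ▸ Ideal.mul_le_right
      have hlt : I < J := by
        refine lt_of_le_of_ne hle fun he => ?_
        obtain ⟨r, hr, hr'⟩ := Submodule.exists_sub_one_mem_and_smul_eq_zero_of_fg_of_le_smul M I
          (IsNoetherian.noetherian I) (by rw [smul_eq_mul]; nth_rewrite 1 [← hMJ]; rw [← he])
        obtain ⟨a, ha, ha0⟩ := Submodule.exists_mem_ne_zero_of_ne_bot hI
        have := hr' a ha
        rw [smul_eq_mul, mul_eq_zero, or_iff_left ha0] at this
        rw [this, zero_sub, neg_mem_iff] at hr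
        exact hM.ne_top ((Ideal.eq_top_iff_one M).mpr hr)
      have hJu := ih J hlt (ne_bot_of_gt hlt)
      rw [← hMJ, FractionalIdeal.coeIdeal_mul, ← hu]
      exact u.isUnit.mul hJu
  rw [isDedekindDomain_iff_mul_inv_cancel (K := K)]
  intro I hI
  obtain ⟨a, J, ha, rfl⟩ := FractionalIdeal.exists_eq_spanSingleton_mul I
  have hJ : J ≠ ⊥ := by rintro rfl; simp at hI
  rw [FractionalIdeal.mul_inv_cancel_iff_isUnit]
  refine IsUnit.mul ?_ (key J hJ)
  have ha' : algebraMap A K a ≠ 0 := by simpa using ha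
  exact IsUnit.of_mul_eq_one (FractionalIdeal.spanSingleton A⁰ (algebraMap A K a)) (by
    rw [FractionalIdeal.spanSingleton_mul_spanSingleton, inv_mul_cancel₀ ha',
      FractionalIdeal.spanSingleton_one])

instance [IsAlgClosed F] [W.IsElliptic] : IsDedekindDomain W.CoordinateRing :=
  isDedekindDomain_of_isUnit_maximal (K := W.FunctionField) fun M hM => by
    obtain ⟨x, y, h, rfl⟩ := exists_eq_XYIdeal M
    exact isUnit_XYIdeal h

end

/-! ### Values and orders of rational functions -/

section

variable {F : Type*} [Field F] [DecidableEq F] {W : WeierstrassCurve.Affine F}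
open WeierstrassCurve.Affine Polynomial IsDedekindDomain

lemma hasValueAt_some {x y : F} (h : W.Nonsingular x y) {f : W.FunctionField} {v : F} :
    HasValueAt f (.some x y h) v ↔ ∃ a b : W.CoordinateRing,
      algebraMap W.CoordinateRing W.FunctionField a =
        f * algebraMap W.CoordinateRing W.FunctionField b ∧
      evalPt h b ≠ 0 ∧ v = evalPt h a / evalPt h b := Iff.rfl

lemma HasValueAt.ne_zero {P : W.Point} {f : W.FunctionField} {v : F} (hf : HasValueAt f P v) :
    P ≠ 0 := by
  rintro rfl
  exact hf

lemma hasValueAt_algebraMap {x y : F} (h : W.Nonsingular x y) (a : W.CoordinateRing) :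
    HasValueAt (algebraMap W.CoordinateRing W.FunctionField a) (.some x y h) (evalPt h a) :=
  (hasValueAt_some h).mpr ⟨a, 1, by simp, by simp, by simp⟩

lemma evalPt_algebraMap {x y : F} (h : W.Nonsingular x y) (c : F) :
    evalPt h (algebraMap F W.CoordinateRing c) = c := by
  have : algebraMap F W.CoordinateRing c = CoordinateRing.mk W (C (C c)) := rfl
  rw [this, evalPt_mk]
  simp [evalEval]

lemma hasValueAt_const {P : W.Point} (hP : P ≠ 0) (c : F) :
    HasValueAt (algebraMap F W.FunctionField c) P c := by
  rcases P with _ | ⟨x, y, h⟩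
  · exact (hP rfl).elim
  · have := hasValueAt_algebraMap h (algebraMap F W.CoordinateRing c)
    rwa [evalPt_algebraMap, ← IsScalarTower.algebraMap_apply] at this

lemma HasValueAt.add {P : W.Point} {f g : W.FunctionField} {v w : F} (hf : HasValueAt f P v)
    (hg : HasValueAt g P w) : HasValueAt (f + g) P (v + w) := by
  rcases P with _ | ⟨x, y, h⟩
  · exact hf
  · obtain ⟨a, b, e, hb, rfl⟩ := (hasValueAt_some h).mp hf
    obtain ⟨a', b', e', hb', rfl⟩ := (hasValueAt_some h).mp hg
    refine (hasValueAt_some h).mpr ⟨a * b' + a' * b, b * b', ?_, ?_, ?_⟩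
    · simp only [map_add, map_mul, e, e']; ring
    · rw [map_mul]; exact mul_ne_zero hb hb'
    · simp only [map_add, map_mul]; field_simp

lemma HasValueAt.mul {P : W.Point} {f g : W.FunctionField} {v w : F} (hf : HasValueAt f P v)
    (hg : HasValueAt g P w) : HasValueAt (f * g) P (v * w) := by
  rcases P with _ | ⟨x, y, h⟩
  · exact hf
  · obtain ⟨a, b, e, hb, rfl⟩ := (hasValueAt_some h).mp hf
    obtain ⟨a', b', e', hb', rfl⟩ := (hasValueAt_some h).mp hg
    refine (hasValueAt_some h).mpr ⟨a * a', b * b', ?_, ?_, ?_⟩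
    · simp only [map_mul, e, e']; ring
    · rw [map_mul]; exact mul_ne_zero hb hb'
    · simp only [map_mul]; field_simp

lemma HasValueAt.neg {P : W.Point} {f : W.FunctionField} {v : F} (hf : HasValueAt f P v) :
    HasValueAt (-f) P (-v) := by
  have := (hasValueAt_const hf.ne_zero (-1)).mul hf
  simpa using this

lemma HasValueAt.sub {P : W.Point} {f g : W.FunctionField} {v w : F} (hf : HasValueAt f P v)
    (hg : HasValueAt g P w) : HasValueAt (f - g) P (v - w) := by
  rw [sub_eq_add_neg, sub_eq_add_neg]; exact hf.add hg.neg

lemma HasValueAt.inv {P : W.Point} {f : W.FunctionField} {v : F} (hf : HasValueAt f P v)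
    (hv : v ≠ 0) : HasValueAt f⁻¹ P v⁻¹ := by
  rcases P with _ | ⟨x, y, h⟩
  · exact hf
  · obtain ⟨a, b, e, hb, rfl⟩ := (hasValueAt_some h).mp hf
    have ha : evalPt h a ≠ 0 := fun h0 => hv (by rw [h0, zero_div])
    have hf0 : f ≠ 0 := by
      rintro rfl
      rw [zero_mul, map_eq_zero_iff _ (IsFractionRing.injective _ _)] at e
      exact ha (by rw [e, map_zero])
    refine (hasValueAt_some h).mpr ⟨b, a, ?_, ha, inv_div _ _⟩
    rw [e, inv_mul_cancel_left₀ hf0]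

lemma HasValueAt.div {P : W.Point} {f g : W.FunctionField} {v w : F} (hf : HasValueAt f P v)
    (hg : HasValueAt g P w) (hw : w ≠ 0) : HasValueAt (f / g) P (v / w) := by
  rw [div_eq_mul_inv, div_eq_mul_inv]; exact hf.mul (hg.inv hw)

lemma HasValueAt.eq {P : W.Point} {f : W.FunctionField} {v w : F} (hf : HasValueAt f P v)
    (hf' : HasValueAt f P w) : v = w := by
  rcases P with _ | ⟨x, y, h⟩
  · exact hf.elim
  · obtain ⟨a, b, e, hb, rfl⟩ := (hasValueAt_some h).mp hf
    obtain ⟨a', b', e', hb', rfl⟩ := (hasValueAt_some h).mp hf'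
    have : a * b' = a' * b := by
      apply IsFractionRing.injective W.CoordinateRing W.FunctionField
      rw [map_mul, map_mul, e, e']; ring
    have := congrArg (evalPt h) this
    rw [map_mul, map_mul] at this
    field_simp
    linear_combination this

/-- The prime of the coordinate ring at an affine point. -/
def place {x y : F} (h : W.Nonsingular x y) : HeightOneSpectrum W.CoordinateRing :=
  ⟨CoordinateRing.XYIdeal W x (C y), (XYIdeal_isMaximal h).isPrime, XYIdeal_ne_bot⟩

lemma mem_place_iff {x y : F} (h : W.Nonsingular x y) (a : W.CoordinateRing) :
    a ∈ (place h).asIdeal ↔ evalPt h a = 0 := mem_XYIdeal_iff h a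

lemma place_inj {x y x' y' : F} {h : W.Nonsingular x y} {h' : W.Nonsingular x' y'} :
    place h = place h' ↔ Point.some x y h = Point.some x' y' h' := by
  constructor
  · intro e
    have h₁ : evalPt h' (CoordinateRing.mk W (C (X - C x))) = 0 := by
      rw [← mem_place_iff, ← e, mem_place_iff, evalPt_mk]; simp [evalEval]
    have h₂ : evalPt h' (CoordinateRing.mk W (X - C (C y))) = 0 := by
      rw [← mem_place_iff, ← e, mem_place_iff, evalPt_mk]; simp [evalEval]
    rw [evalPt_mk] at h₁ h₂
    simp only [evalEval, eval_C, eval_sub, eval_X, sub_eq_zero] at h₁ h₂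
    simp only [Point.some.injEq]
    exact ⟨h₁.symm, h₂.symm⟩
  · intro e
    obtain ⟨rfl, rfl⟩ := Point.some.inj e
    rfl

variable [IsAlgClosed F] [W.IsElliptic]

lemma exists_eq_place (v : HeightOneSpectrum W.CoordinateRing) :
    ∃ x y, ∃ h : W.Nonsingular x y, v = place h := by
  have := v.isMaximal
  obtain ⟨x, y, h, e⟩ := exists_eq_XYIdeal v.asIdeal
  exact ⟨x, y, h, HeightOneSpectrum.ext e⟩

/-- The order of vanishing of a function at a point.  At infinity it is minus the sum of the
orders at the affine points, so that principal divisors have degree zero by definition. -/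
def ord : W.Point → W.FunctionField → ℤ
  | .zero, f => -∑ᶠ v : HeightOneSpectrum W.CoordinateRing,
      FractionalIdeal.count W.FunctionField v (FractionalIdeal.spanSingleton W.CoordinateRing⁰ f)
  | .some _ _ h, f => FractionalIdeal.count W.FunctionField (place h)
      (FractionalIdeal.spanSingleton W.CoordinateRing⁰ f)

lemma ord_some {x y : F} (h : W.Nonsingular x y) (f : W.FunctionField) :
    ord (.some x y h) f = FractionalIdeal.count W.FunctionField (place h)
      (FractionalIdeal.spanSingleton W.CoordinateRing⁰ f) := rfl

lemma ord_zero_eq (f : W.FunctionField) :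
    ord 0 f = -∑ᶠ v : HeightOneSpectrum W.CoordinateRing,
      FractionalIdeal.count W.FunctionField v (FractionalIdeal.spanSingleton W.CoordinateRing⁰ f) :=
  rfl

lemma finite_support_count (f : W.FunctionField) :
    (Function.support fun v : HeightOneSpectrum W.CoordinateRing =>
      FractionalIdeal.count W.FunctionField v
        (FractionalIdeal.spanSingleton W.CoordinateRing⁰ f)).Finite :=
  FractionalIdeal.finite_factors (FractionalIdeal.spanSingleton W.CoordinateRing⁰ f)

lemma ord_mul (P : W.Point) {f g : W.FunctionField} (hf : f ≠ 0) (hg : g ≠ 0) :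
    ord P (f * g) = ord P f + ord P g := by
  have key : ∀ v, FractionalIdeal.count W.FunctionField v
      (FractionalIdeal.spanSingleton W.CoordinateRing⁰ (f * g)) =
      FractionalIdeal.count W.FunctionField v
      (FractionalIdeal.spanSingleton W.CoordinateRing⁰ f) + FractionalIdeal.count W.FunctionField v
      (FractionalIdeal.spanSingleton W.CoordinateRing⁰ g) := fun v => by
    rw [← FractionalIdeal.spanSingleton_mul_spanSingleton, FractionalIdeal.count_mul]
    · exact FractionalIdeal.spanSingleton_ne_zero_iff.mpr hf
    · exact FractionalIdeal.spanSingleton_ne_zero_iff.mpr hg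
  rcases P with _ | ⟨x, y, h⟩
  · change -_ = -_ + -_
    rw [← neg_add, ← finsum_add_distrib (finite_support_count f) (finite_support_count g)]
    simp only [key]
  · exact key _

lemma ord_one (P : W.Point) : ord P (1 : W.FunctionField) = 0 := by
  have := ord_mul P (one_ne_zero (α := W.FunctionField)) one_ne_zero
  rw [mul_one] at this
  linarith

lemma ord_inv (P : W.Point) (f : W.FunctionField) : ord P f⁻¹ = -ord P f := by
  by_cases hf : f = 0
  · subst hf
    have : ord P (0 : W.FunctionField) = 0 := by
      rcases P with _ | ⟨x, y, h⟩
      · change -_ = _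
        simp [FractionalIdeal.count_zero]
      · rw [ord_some]; simp [FractionalIdeal.count_zero]
    rw [inv_zero, this, neg_zero]
  · have := ord_mul P hf (inv_ne_zero hf)
    rw [mul_inv_cancel₀ hf, ord_one] at this
    linarith

lemma ord_div (P : W.Point) {f g : W.FunctionField} (hf : f ≠ 0) (hg : g ≠ 0) :
    ord P (f / g) = ord P f - ord P g := by
  rw [div_eq_mul_inv, ord_mul P hf (inv_ne_zero hg), ord_inv, sub_eq_add_neg]

lemma ord_neg (P : W.Point) (f : W.FunctionField) : ord P (-f) = ord P f := by
  by_cases hf : f = 0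
  · rw [hf, neg_zero]
  have h1 : (-1 : W.FunctionField) ≠ 0 := neg_ne_zero.mpr one_ne_zero
  have := ord_mul P h1 h1
  rw [neg_mul_neg, one_mul, ord_one] at this
  rw [neg_eq_neg_one_mul, ord_mul P h1 hf]
  omega

lemma ord_algebraMap_nonneg {x y : F} (h : W.Nonsingular x y) (a : W.CoordinateRing) :
    0 ≤ ord (.some x y h) (algebraMap W.CoordinateRing W.FunctionField a) := by
  rw [ord_some, ← FractionalIdeal.coeIdeal_span_singleton]
  exact FractionalIdeal.count_coe_nonneg _ _ _

lemma ord_algebraMap_pos_iff {x y : F} (h : W.Nonsingular x y) {a : W.CoordinateRing}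
    (ha : a ≠ 0) : 0 < ord (.some x y h) (algebraMap W.CoordinateRing W.FunctionField a) ↔
      evalPt h a = 0 := by
  classical
  have ha' : Ideal.span {a} ≠ 0 := by simpa using ha
  rw [ord_some, ← FractionalIdeal.coeIdeal_span_singleton,
    FractionalIdeal.count_coe _ _ ha', Nat.cast_pos, pos_iff_ne_zero,
    Associates.count_ne_zero_iff_dvd ha' (place h).irreducible, Ideal.dvd_span_singleton,
    mem_place_iff]

lemma ord_algebraMap_eq_zero {x y : F} (h : W.Nonsingular x y) {a : W.CoordinateRing}
    (ha : evalPt h a ≠ 0) :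
    ord (.some x y h) (algebraMap W.CoordinateRing W.FunctionField a) = 0 := by
  have ha0 : a ≠ 0 := by rintro rfl; simp at ha
  exact le_antisymm (not_lt.mp (mt (ord_algebraMap_pos_iff h ha0).mp ha))
    (ord_algebraMap_nonneg h a)

lemma HasValueAt.ord_nonneg {P : W.Point} {f : W.FunctionField} {v : F} (hf : HasValueAt f P v)
    (h0 : f ≠ 0) : 0 ≤ ord P f ∧ (0 < ord P f ↔ v = 0) := by
  rcases P with _ | ⟨x, y, h⟩
  · exact hf.elim
  · obtain ⟨a, b, e, hb, rfl⟩ := (hasValueAt_some h).mp hf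
    have hb0 : b ≠ 0 := by rintro rfl; simp at hb
    have hb0' : algebraMap W.CoordinateRing W.FunctionField b ≠ 0 := by simpa using hb0
    have ha0 : a ≠ 0 := by
      rintro rfl
      rw [map_zero, eq_comm, mul_eq_zero] at e
      exact e.elim h0 hb0'
    have : ord (.some x y h) f =
        ord (.some x y h) (algebraMap W.CoordinateRing W.FunctionField a) := by
      rw [e, ord_mul _ h0 hb0', ord_algebraMap_eq_zero h hb, add_zero]
    rw [this, ord_algebraMap_pos_iff h ha0, div_eq_zero_iff, or_iff_left hb]
    exact ⟨ord_algebraMap_nonneg h a, Iff.rfl⟩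

lemma exists_span_eq_place_pow_mul {x y : F} (h : W.Nonsingular x y) {a : W.CoordinateRing}
    (ha : a ≠ 0) : ∃ (k : ℕ) (I : Ideal W.CoordinateRing),
      Ideal.span {a} = (place h).asIdeal ^ k * I ∧ ¬ (place h).asIdeal ∣ I ∧
      ord (.some x y h) (algebraMap W.CoordinateRing W.FunctionField a) = k := by
  classical
  have hM : Prime (place h).asIdeal := (place h).prime
  have ha' : Ideal.span {a} ≠ 0 := by simpa using ha
  obtain ⟨I, e, hI⟩ := (FiniteMultiplicity.of_prime_left hM ha').exists_eq_pow_mul_and_not_dvd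
  generalize multiplicity (place h).asIdeal (Ideal.span {a}) = k at e
  refine ⟨k, I, e, hI, ?_⟩
  have hI0 : I ≠ 0 := by rintro rfl; exact hI (dvd_zero _)
  rw [ord_some, ← FractionalIdeal.coeIdeal_span_singleton, e, FractionalIdeal.coeIdeal_mul,
    FractionalIdeal.coeIdeal_pow, FractionalIdeal.count_mul, FractionalIdeal.count_pow_self,
    FractionalIdeal.count_coe _ _ hI0, add_eq_left, Nat.cast_eq_zero]
  · by_contra hc
    exact hI ((Associates.count_ne_zero_iff_dvd hI0 (place h).irreducible).mp hc)
  · exact pow_ne_zero _ (FractionalIdeal.coeIdeal_ne_zero.mpr (place h).ne_bot)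
  · exact FractionalIdeal.coeIdeal_ne_zero.mpr hI0

/-- Every affine point has a uniformizer in the coordinate ring. -/
lemma exists_ord_eq_one {x y : F} (h : W.Nonsingular x y) : ∃ a : W.CoordinateRing, a ≠ 0 ∧
    ord (.some x y h) (algebraMap W.CoordinateRing W.FunctionField a) = 1 := by
  obtain ⟨a, ha, ha2⟩ : ∃ a ∈ (place h).asIdeal, a ∉ (place h).asIdeal ^ 2 := by
    have : ¬ (place h).asIdeal ≤ (place h).asIdeal ^ 2 := fun hle => by
      have := Ideal.pow_right_strictAnti _ (place h).ne_bot (place h).isPrime.ne_top one_lt_two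
      simp only [pow_one] at this
      exact absurd hle this.not_ge
    exact Set.not_subset.mp this
  have ha0 : a ≠ 0 := by rintro rfl; exact ha2 (Ideal.zero_mem _)
  obtain ⟨k, I, e, -, hk⟩ := exists_span_eq_place_pow_mul h ha0
  refine ⟨a, ha0, ?_⟩
  have hpos := (ord_algebraMap_pos_iff h ha0).mpr ((mem_place_iff h a).mp ha)
  rw [hk] at hpos ⊢
  have : k < 2 := by
    by_contra! hk2
    apply ha2
    have : Ideal.span {a} ≤ (place h).asIdeal ^ 2 := by
      rw [e]; exact Ideal.mul_le_left.trans (Ideal.pow_le_pow_right hk2)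
    exact this (Ideal.mem_span_singleton_self a)
  omega

/-- A function without a pole at an affine point has a value there. -/
lemma exists_hasValueAt {x y : F} (h : W.Nonsingular x y) {f : W.FunctionField}
    (hf : f ≠ 0) (hord : 0 ≤ ord (.some x y h) f) : ∃ v, HasValueAt f (.some x y h) v := by
  obtain ⟨a, b, hb, rfl⟩ := IsFractionRing.div_surjective (A := W.CoordinateRing) f
  have hb0 : b ≠ 0 := nonZeroDivisors.ne_zero hb
  have ha0 : a ≠ 0 := by rintro rfl; simp at hf
  obtain ⟨k, I, eI, -, hk⟩ := exists_span_eq_place_pow_mul h ha0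
  obtain ⟨j, J, eJ, hJ, hj⟩ := exists_span_eq_place_pow_mul h hb0
  have hb' : algebraMap W.CoordinateRing W.FunctionField b ≠ 0 := by simpa using hb0
  have ha' : algebraMap W.CoordinateRing W.FunctionField a ≠ 0 := by simpa using ha0
  have hkj := ord_div (.some x y h) ha' hb'
  rw [hk, hj] at hkj
  rw [hkj] at hord
  have hjk : j ≤ k := by omega
  -- any `d ∈ J` outside the prime clears the denominator of `a / b`
  obtain ⟨d, hdJ, hdM⟩ : ∃ d ∈ J, d ∉ (place h).asIdeal := by
    rw [Ideal.dvd_iff_le] at hJ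
    exact Set.not_subset.mp hJ
  have hmem : a * d ∈ Ideal.span {b} := by
    have h₁ : a * d ∈ Ideal.span {a} * J :=
      Ideal.mul_mem_mul (Ideal.mem_span_singleton_self a) hdJ
    rw [eI, ← Nat.add_sub_cancel' hjk, pow_add] at h₁
    rw [eJ]
    have h₂ : (place h).asIdeal ^ j * (place h).asIdeal ^ (k - j) * I * J =
        ((place h).asIdeal ^ j * J) * ((place h).asIdeal ^ (k - j) * I) := by ring
    rw [h₂] at h₁
    have hle : ((place h).asIdeal ^ j * J) * ((place h).asIdeal ^ (k - j) * I) ≤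
        (place h).asIdeal ^ j * J := Ideal.mul_le_left
    exact hle h₁
  obtain ⟨c, hc⟩ := Ideal.mem_span_singleton'.mp hmem
  have hd : evalPt h d ≠ 0 := fun h0 => hdM ((mem_place_iff h d).mpr h0)
  have key : algebraMap W.CoordinateRing W.FunctionField c *
      algebraMap W.CoordinateRing W.FunctionField b =
      algebraMap W.CoordinateRing W.FunctionField a *
        algebraMap W.CoordinateRing W.FunctionField d := by rw [← map_mul, ← map_mul, hc]
  refine ⟨_, (hasValueAt_some h).mpr ⟨c, d, ?_, hd, rfl⟩⟩
  generalize algebraMap W.CoordinateRing W.FunctionField a = a' at key ⊢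
  generalize algebraMap W.CoordinateRing W.FunctionField b = b' at key hb' ⊢
  generalize algebraMap W.CoordinateRing W.FunctionField c = c' at key ⊢
  generalize algebraMap W.CoordinateRing W.FunctionField d = d' at key ⊢
  field_simp
  exact key

end

/-! ### Translations -/

section

variable {F : Type*} [Field F] [DecidableEq F] {W : WeierstrassCurve.Affine F}
open WeierstrassCurve.Affine Polynomial IsDedekindDomain

variable (W) in
/-- The coordinate function `x`, as an element of the function field. -/
def xFun : W.FunctionField := algebraMap W.CoordinateRing _ (CoordinateRing.mk W (C X))

variable (W) in
/-- The coordinate function `y`, as an element of the function field. -/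
def yFun : W.FunctionField := algebraMap W.CoordinateRing _ (CoordinateRing.mk W X)

lemma equation_xFun_yFun : (W⁄W.FunctionField).Equation (xFun W) (yFun W) := by
  have h : CoordinateRing.mk W (X ^ 2 + C (C W.a₁ * X + C W.a₃) * X -
    C (X ^ 3 + C W.a₂ * X ^ 2 + C W.a₄ * X + C W.a₆)) = 0 := AdjoinRoot.mk_self
  have h' := congrArg (algebraMap W.CoordinateRing W.FunctionField) h
  have hC : ∀ a, algebraMap W.CoordinateRing W.FunctionField (CoordinateRing.mk W (C (C a))) =
    algebraMap F W.FunctionField a := fun _ => rfl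
  simp only [map_add, map_sub, map_mul, map_pow, hC, map_zero] at h'
  rw [WeierstrassCurve.Affine.equation_iff]
  change yFun W ^ 2 + algebraMap F _ W.a₁ * xFun W * yFun W + algebraMap F _ W.a₃ * yFun W =
    xFun W ^ 3 + algebraMap F _ W.a₂ * xFun W ^ 2 + algebraMap F _ W.a₄ * xFun W +
      algebraMap F _ W.a₆
  rw [xFun, yFun]
  linear_combination h'

variable (W) in
/-- A point of `W`, as a constant point with coordinates in the function field. -/
def constPoint : W.Point →+ (W⁄W.FunctionField).Point :=
  WeierstrassCurve.Affine.Point.map (W' := W) (Algebra.ofId F W.FunctionField)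

lemma constPoint_some {x y : F} (h : W.Nonsingular x y) : ∃ h', constPoint W (.some x y h) =
    .some (algebraMap F W.FunctionField x) (algebraMap F W.FunctionField y) h' := ⟨_, rfl⟩

variable [IsAlgClosed F] [W.IsElliptic]

instance {K : Type*} [Field K] [Algebra F K] : (W⁄K).IsElliptic :=
  inferInstanceAs (WeierstrassCurve.map W (algebraMap F K)).IsElliptic

variable (W) in
/-- The generic point `(x, y)`, with coordinates in the function field. -/
def genericPoint : (W⁄W.FunctionField).Point :=
  .some (xFun W) (yFun W)
    ((equation_iff_nonsingular (W := W⁄W.FunctionField)).mp equation_xFun_yFun)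

lemma algHom_ext_functionField {A : Type*} [Field A] [Algebra F A]
    {f g : W.FunctionField →ₐ[F] A} (hx : f (xFun W) = g (xFun W)) (hy : f (yFun W) = g (yFun W)) :
    f = g := by
  have key : ∀ p : F[X][X], f (algebraMap W.CoordinateRing _ (CoordinateRing.mk W p)) =
      g (algebraMap W.CoordinateRing _ (CoordinateRing.mk W p)) := by
    intro p
    have : ((f : W.FunctionField →+* A).comp (algebraMap W.CoordinateRing _)).comp
        (CoordinateRing.mk W) = ((g : W.FunctionField →+* A).comp
          (algebraMap W.CoordinateRing _)).comp (CoordinateRing.mk W) := by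
      apply Polynomial.ringHom_ext
      · intro a
        induction a using Polynomial.induction_on' with
        | add p q hp hq => simp only [map_add, hp, hq]
        | monomial n a =>
          rw [← C_mul_X_pow_eq_monomial]
          have hC : algebraMap W.CoordinateRing W.FunctionField (CoordinateRing.mk W (C (C a))) =
            algebraMap F _ a := rfl
          simp only [map_mul, map_pow, RingHom.comp_apply, hC, RingHom.coe_coe, AlgHom.commutes]
          congr 2
      · exact hy
    exact DFunLike.congr_fun this p
  apply AlgHom.ext
  intro z
  obtain ⟨a, b, -, rfl⟩ := IsFractionRing.div_surjective (A := W.CoordinateRing) z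
  obtain ⟨p, rfl⟩ := AdjoinRoot.mk_surjective a
  obtain ⟨q, rfl⟩ := AdjoinRoot.mk_surjective b
  rw [map_div₀, map_div₀]
  exact congrArg₂ _ (key p) (key q)

lemma genericPoint_notMem_range : genericPoint W ∉ Set.range (constPoint W) := by
  rintro ⟨_ | ⟨x, y, h⟩, e⟩
  · exact absurd e.symm (Point.some_ne_zero _)
  · obtain ⟨h', e'⟩ := constPoint_some h
    rw [e'] at e
    have hx := (Point.some.inj e).1
    apply CoordinateRing.XClass_ne_zero (W' := W) x
    apply IsFractionRing.injective W.CoordinateRing W.FunctionField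
    have hC : algebraMap W.CoordinateRing W.FunctionField (CoordinateRing.mk W (C (C x))) =
        algebraMap F _ x := rfl
    rw [CoordinateRing.XClass, map_zero, C_sub, map_sub, map_sub, hC, hx, xFun, sub_self]

/-- A nonconstant point over the function field is the image of the generic point under an
embedding of the function field into itself. -/
lemma exists_algHom_of_point {P : (W⁄W.FunctionField).Point}
    (hP : P ∉ Set.range (constPoint W)) : ∃ f : W.FunctionField →ₐ[F] W.FunctionField,
      Point.map (W' := W) f (genericPoint W) = P := by
  rcases P with _ | ⟨x, y, h⟩
  · exact (hP ⟨0, rfl⟩).elim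
  have heq := (WeierstrassCurve.Affine.equation_iff x y).mp h.1
  change y ^ 2 + algebraMap F _ W.a₁ * x * y + algebraMap F _ W.a₃ * y =
    x ^ 3 + algebraMap F _ W.a₂ * x ^ 2 + algebraMap F _ W.a₄ * x + algebraMap F _ W.a₆ at heq
  let g : W.CoordinateRing →ₐ[F] W.FunctionField :=
    AdjoinRoot.liftAlgHom W.polynomial (aeval x) y (by
      simp only [WeierstrassCurve.Affine.polynomial, eval₂_add, eval₂_sub, eval₂_mul, eval₂_pow,
        eval₂_X, eval₂_C, RingHom.coe_coe, map_add, map_mul, map_pow, aeval_C, aeval_X]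
      linear_combination heq)
  have hgX : g (CoordinateRing.mk W (C X)) = x := by
    change AdjoinRoot.liftAlgHom W.polynomial (aeval x) y _ (AdjoinRoot.mk _ _) = x
    simp
  have hgY : g (CoordinateRing.mk W X) = y := by
    change AdjoinRoot.liftAlgHom W.polynomial (aeval x) y _ (AdjoinRoot.mk _ _) = y
    simp
  have hg : Function.Injective g := by
    rw [← AlgHom.coe_toRingHom, RingHom.injective_iff_ker_eq_bot]
    by_contra hne
    have hmax := isMaximal_of_isPrime (RingHom.ker_isPrime g.toRingHom) hne
    obtain ⟨x₀, y₀, h₀, e⟩ := exists_eq_XYIdeal (RingHom.ker g.toRingHom)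
    have hC : ∀ a, g (CoordinateRing.mk W (C (C a))) = algebraMap F _ a := fun a => g.commutes a
    have e₁ : g (CoordinateRing.XClass W x₀) = 0 := by
      change CoordinateRing.XClass W x₀ ∈ RingHom.ker g.toRingHom
      rw [e]; exact Ideal.subset_span (by simp)
    have e₂ : g (CoordinateRing.YClass W (C y₀)) = 0 := by
      change CoordinateRing.YClass W (C y₀) ∈ RingHom.ker g.toRingHom
      rw [e]; exact Ideal.subset_span (by simp)
    rw [CoordinateRing.XClass, C_sub, map_sub, map_sub, hC, hgX, sub_eq_zero] at e₁
    rw [CoordinateRing.YClass, map_sub, map_sub, hC, hgY, sub_eq_zero] at e₂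
    apply hP
    obtain ⟨h', e'⟩ := constPoint_some h₀
    refine ⟨.some x₀ y₀ h₀, e'.trans ?_⟩
    simp only [Point.some.injEq]
    exact ⟨e₁.symm, e₂.symm⟩
  let f := IsFractionRing.liftAlgHom (K := W.FunctionField) hg
  have hf : ∀ a, f (algebraMap W.CoordinateRing _ a) = g a := fun a =>
    IsFractionRing.lift_algebraMap hg a
  refine ⟨f, ?_⟩
  rw [genericPoint, Point.map_some]
  simp only [Point.some.injEq]
  exact ⟨(hf _).trans hgX, (hf _).trans hgY⟩

lemma exists_translation (S : W.Point) : ∃ f : W.FunctionField →ₐ[F] W.FunctionField,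
    Point.map (W' := W) f (genericPoint W) = genericPoint W + constPoint W S :=
  exists_algHom_of_point fun ⟨P, hP⟩ => genericPoint_notMem_range
    ⟨P - S, by rw [map_sub, hP, add_sub_cancel_right]⟩

/-- The translation `f ↦ (P ↦ f(P + S))` on the function field: the embedding that sends the generic
point to its sum with the constant point `S`. -/
def translation (S : W.Point) : W.FunctionField →ₐ[F] W.FunctionField :=
  (exists_translation S).choose

lemma map_translation_genericPoint (S : W.Point) :
    Point.map (W' := W) (translation S) (genericPoint W) = genericPoint W + constPoint W S :=
  (exists_translation S).choose_spec

lemma algHom_eq_of_map_genericPoint {f g : W.FunctionField →ₐ[F] W.FunctionField}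
    (h : Point.map (W' := W) f (genericPoint W) = Point.map (W' := W) g (genericPoint W)) :
    f = g := by
  rw [genericPoint, Point.map_some, Point.map_some] at h
  obtain ⟨hx, hy⟩ := Point.some.inj h
  exact algHom_ext_functionField hx hy

lemma map_constPoint (f : W.FunctionField →ₐ[F] W.FunctionField) (P : W.Point) :
    Point.map (W' := W) f (constPoint W P) = constPoint W P := by
  rw [constPoint]
  refine (Point.map_map (W' := W) (Algebra.ofId F W.FunctionField) f P).trans ?_
  congr 1
  congr 1
  ext

lemma translation_add (S S' : W.Point) :
    translation (S + S') = (translation S).comp (translation S') := by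
  apply algHom_eq_of_map_genericPoint
  rw [← Point.map_map, map_translation_genericPoint, map_translation_genericPoint, map_add
    (Point.map (W' := W) (translation S)), map_translation_genericPoint, map_constPoint, map_add]
  abel

lemma translation_add_apply (S S' : W.Point) (f : W.FunctionField) :
    translation (S + S') f = translation S (translation S' f) := by
  rw [translation_add]; rfl

lemma translation_zero : translation (0 : W.Point) = AlgHom.id F W.FunctionField := by
  apply algHom_eq_of_map_genericPoint
  rw [map_translation_genericPoint, map_zero, add_zero]
  rfl

end

/-! ### The effect of translations on values and orders -/

section

variable {F : Type*} [Field F] [DecidableEq F] {W : WeierstrassCurve.Affine F}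
open WeierstrassCurve.Affine Polynomial IsDedekindDomain
variable [IsAlgClosed F] [W.IsElliptic]

lemma hasValueAt_xFun {x y : F} (h : W.Nonsingular x y) :
    HasValueAt (xFun W) (.some x y h) x := by
  have := hasValueAt_algebraMap h (CoordinateRing.mk W (C X))
  rw [evalPt_mk, show evalEval x y (C X) = x by simp [evalEval]] at this
  exact this

lemma hasValueAt_yFun {x y : F} (h : W.Nonsingular x y) :
    HasValueAt (yFun W) (.some x y h) y := by
  have := hasValueAt_algebraMap h (CoordinateRing.mk W X)
  rw [evalPt_mk, show evalEval x y X = y by simp [evalEval]] at this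
  exact this

/-- The pullback `f` of functions corresponds to a map of curves sending the affine point `P` to
the affine point `Q`. -/
def Carries (f : W.FunctionField →ₐ[F] W.FunctionField) (P Q : W.Point) : Prop :=
  ∀ g v, HasValueAt g Q v → HasValueAt (f g) P v

lemma Carries.comp {f f' : W.FunctionField →ₐ[F] W.FunctionField} {P Q T : W.Point}
    (h : Carries f P Q) (h' : Carries f' Q T) : Carries (f.comp f') P T :=
  fun g v hg => h _ v (h' g v hg)

/-- It is enough to know the values of the coordinate functions. -/
lemma carries_of_coordinates {f : W.FunctionField →ₐ[F] W.FunctionField} {P : W.Point} (hP : P ≠ 0)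
    {x y : F} (h : W.Nonsingular x y) (hx : HasValueAt (f (xFun W)) P x)
    (hy : HasValueAt (f (yFun W)) P y) : Carries f P (.some x y h) := by
  have hpoly : ∀ p : F[X], HasValueAt
      (f (algebraMap W.CoordinateRing _ (CoordinateRing.mk W (C p)))) P (p.eval x) := by
    intro p
    induction p using Polynomial.induction_on with
    | C a =>
      have hC : algebraMap W.CoordinateRing W.FunctionField (CoordinateRing.mk W (C (C a))) =
            algebraMap F _ a := rfl
      rw [hC, AlgHom.commutes, eval_C]
      exact hasValueAt_const hP a
    | add p q hp hq =>
      simp only [map_add, eval_add]; exact hp.add hq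
    | monomial n a ih =>
      have := ih.mul hx
      rw [pow_succ, ← mul_assoc, C_mul (a := C a * X ^ n), map_mul, map_mul, map_mul, eval_mul,
        eval_X]
      exact this
  have key : ∀ a : W.CoordinateRing, HasValueAt (f (algebraMap W.CoordinateRing _ a)) P
      (evalPt h a) := by
    intro a
    obtain ⟨p, rfl⟩ := AdjoinRoot.mk_surjective a
    change HasValueAt (f (algebraMap W.CoordinateRing _ (CoordinateRing.mk W p))) P
      (evalPt h (CoordinateRing.mk W p))
    rw [evalPt_mk]
    induction p using Polynomial.induction_on with
    | C a => rw [show evalEval x y (C a) = a.eval x by simp [evalEval]]; exact hpoly a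
    | add p q hp hq => simp only [map_add, evalEval_add]; exact hp.add hq
    | monomial n a ih =>
      have := ih.mul hy
      rw [pow_succ, ← mul_assoc, map_mul, map_mul, map_mul, evalEval_mul,
        show evalEval x y X = y by simp [evalEval]]
      exact this
  intro g v hg
  obtain ⟨a, b, e, hb, rfl⟩ := (hasValueAt_some h).mp hg
  have hb0 : algebraMap W.CoordinateRing W.FunctionField b ≠ 0 := by
    have : b ≠ 0 := by rintro rfl; simp at hb
    simpa using this
  have : g = algebraMap W.CoordinateRing W.FunctionField a / algebraMap W.CoordinateRing _ b := by
    rw [e, mul_div_cancel_right₀ _ hb0]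
  rw [this, map_div₀]
  exact (key a).div (key b) hb

/-- The addition formula describes translation by `S` near a point with a different
`x`-coordinate. -/
lemma carries_translation_of_x_ne {x y s t : F} (h : W.Nonsingular x y) (hS : W.Nonsingular s t)
    (hx : x ≠ s) : Carries (translation (.some s t hS)) (.some x y h)
      (.some x y h + .some s t hS) := by
  have hne : xFun W ≠ algebraMap F W.FunctionField s := fun e => hx <| by
    have := hasValueAt_xFun h
    rw [e] at this
    exact this.eq (hasValueAt_const (Point.some_ne_zero h) s)
  have e := map_translation_genericPoint (W := W) (.some s t hS)
  obtain ⟨h', e'⟩ := constPoint_some hS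
  rw [e', genericPoint, Point.add_of_X_ne hne, Point.map_some] at e
  obtain ⟨ex, ey⟩ := Point.some.inj e
  rw [Point.add_of_X_ne hx]
  rw [slope_of_X_ne hne] at ex ey
  have hc := fun c : F => hasValueAt_const (Point.some_ne_zero h) c
  have hℓ := ((hasValueAt_yFun h).sub (hc t)).div ((hasValueAt_xFun h).sub (hc s))
    (sub_ne_zero.mpr hx)
  have hX := ((((hℓ.mul hℓ).add ((hc W.a₁).mul hℓ)).sub (hc W.a₂)).sub (hasValueAt_xFun h)).sub
    (hc s)
  have hN := (hℓ.mul (hX.sub (hasValueAt_xFun h))).add (hasValueAt_yFun h)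
  have hY := (hN.neg.sub ((hc W.a₁).mul hX)).sub (hc W.a₃)
  refine carries_of_coordinates (Point.some_ne_zero h) _ ?_ ?_
  · rw [slope_of_X_ne hx]
    convert hX using 1
    · rw [ex]; simp only [addX, pow_two]; rfl
    · simp only [addX, pow_two]
  · rw [slope_of_X_ne hx]
    convert hY using 1
    · rw [ey]; simp only [addY, negY, negAddY, addX, pow_two]; rfl
    · simp only [addY, negY, negAddY, addX, pow_two]

lemma x_eq_iff {P Q : W.Point} : P.xRep 0 = Q.xRep 0 → P ≠ 0 → Q ≠ 0 → P = Q ∨ P = -Q := by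
  rcases P with _ | ⟨x, y, h⟩ <;> rcases Q with _ | ⟨x', y', h'⟩
  · exact fun _ h => (h rfl).elim
  · exact fun _ h => (h rfl).elim
  · exact fun _ _ h => (h rfl).elim
  · intro e _ _
    exact Point.X_eq_iff.mp e

lemma carries_translation_of_ne {P S : W.Point} (hP : P ≠ 0) (hS : S ≠ 0) (h₁ : P ≠ S)
    (h₂ : P ≠ -S) : Carries (translation S) P (P + S) := by
  have hx : P.xRep 0 ≠ S.xRep 0 := fun e => (x_eq_iff e hP hS).elim h₁ h₂
  rcases P with _ | ⟨x, y, h⟩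
  · exact (hP rfl).elim
  rcases S with _ | ⟨s, t, h'⟩
  · exact (hS rfl).elim
  exact carries_translation_of_x_ne h h' hx

lemma finite_setOf_two_nsmul_eq [CharZero F] (Q : W.Point) : {P : W.Point | 2 • P = Q}.Finite := by
  by_cases hne : ∃ P₀ : W.Point, 2 • P₀ = Q
  · obtain ⟨P₀, h₀⟩ := hne
    refine ((finite_setOf_two_torsion (W := W)).image (fun P => P + P₀)).subset ?_
    intro P hP
    refine ⟨P - P₀, ?_, by simp⟩
    have : 2 • (P - P₀) = 0 := by rw [smul_sub, h₀, show 2 • P = Q from hP, sub_self]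
    rw [two_smul] at this
    exact neg_eq_of_add_eq_zero_left this
  · exact Set.finite_empty.subset fun P hP => hne ⟨P, hP⟩

/-- Translation by `S` corresponds to `P ↦ P + S`, as long as neither point is at infinity.
The degenerate cases of the addition law are reached by splitting `S` into two general
translations. -/
theorem carries_translation [CharZero F] {P S : W.Point} (hP : P ≠ 0) (hPS : P + S ≠ 0) :
    Carries (translation S) P (P + S) := by
  obtain ⟨T, hT⟩ := ((Set.toFinite ({0, P, -P, S} : Set W.Point)).union
    (finite_setOf_two_nsmul_eq (S - P))).exists_notMem
  simp only [Set.mem_union, Set.mem_insert_iff, Set.mem_singleton_iff, not_or,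
    Set.mem_ofPred_eq] at hT
  obtain ⟨⟨hT0, hTP, hTP', hTS⟩, hT2⟩ := hT
  have h₁ : Carries (translation T) P (P + T) :=
    carries_translation_of_ne hP hT0 (Ne.symm hTP) fun e => hTP' (by rw [e, neg_neg])
  have h₂ : Carries (translation (S - T)) (P + T) (P + T + (S - T)) := by
    apply carries_translation_of_ne
    · intro e; exact hTP' (eq_neg_of_add_eq_zero_right e)
    · exact sub_ne_zero.mpr (Ne.symm hTS)
    · intro e; apply hT2
      rw [two_smul, ← sub_eq_zero]
      have : P + T - (S - T) = 0 := sub_eq_zero.mpr e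
      rw [← this]; abel
    · intro e; apply hPS
      have : P + T - -(S - T) = 0 := sub_eq_zero.mpr e
      rw [← this]; abel
  have := h₁.comp h₂
  rw [← translation_add] at this
  convert this using 1
  · congr 1; abel
  · abel

lemma exists_negation : ∃ f : W.FunctionField →ₐ[F] W.FunctionField,
    Point.map (W' := W) f (genericPoint W) = -genericPoint W :=
  exists_algHom_of_point fun ⟨P, hP⟩ => genericPoint_notMem_range
    ⟨-P, by rw [map_neg, hP, neg_neg]⟩

variable (W) in
/-- The pullback of functions under `P ↦ -P`. -/
def negation : W.FunctionField →ₐ[F] W.FunctionField := exists_negation.choose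

lemma map_negation_genericPoint :
    Point.map (W' := W) (negation W) (genericPoint W) = -genericPoint W :=
  exists_negation.choose_spec

lemma negation_coordinates : negation W (xFun W) = xFun W ∧
    negation W (yFun W) = -yFun W - algebraMap F _ W.a₁ * xFun W - algebraMap F _ W.a₃ := by
  have e := map_negation_genericPoint (W := W)
  rw [genericPoint, Point.map_some, Point.neg_some] at e
  obtain ⟨ex, ey⟩ := Point.some.inj e
  exact ⟨ex, ey⟩

lemma carries_negation {P : W.Point} (hP : P ≠ 0) : Carries (negation W) P (-P) := by
  rcases P with _ | ⟨x, y, h⟩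
  · exact (hP rfl).elim
  have hc := fun c : F => hasValueAt_const (Point.some_ne_zero h) c
  rw [Point.neg_some]
  refine carries_of_coordinates (Point.some_ne_zero h) _ ?_ ?_
  · rw [negation_coordinates.1]; exact hasValueAt_xFun h
  · rw [negation_coordinates.2]
    exact ((hasValueAt_yFun h).neg.sub ((hc _).mul (hasValueAt_xFun h))).sub (hc _)

lemma negation_negation (f : W.FunctionField) : negation W (negation W f) = f := by
  have : (negation W).comp (negation W) = AlgHom.id F W.FunctionField := by
    apply algHom_eq_of_map_genericPoint
    rw [← Point.map_map, map_negation_genericPoint, map_neg, map_negation_genericPoint, neg_neg]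
    rfl
  exact DFunLike.congr_fun this f

lemma negation_translation (S : W.Point) (f : W.FunctionField) :
    translation S (negation W f) = negation W (translation (-S) f) := by
  have : (translation S).comp (negation W) = (negation W).comp (translation (-S)) := by
    apply algHom_eq_of_map_genericPoint
    rw [← Point.map_map, ← Point.map_map, map_negation_genericPoint, map_neg,
      map_translation_genericPoint, map_translation_genericPoint, map_add,
      map_negation_genericPoint, map_constPoint, map_neg]
    abel
  exact DFunLike.congr_fun this f

lemma translation_neg_translation (S : W.Point) (f : W.FunctionField) :
    translation S (translation (-S) f) = f := by
  rw [← translation_add_apply, add_neg_cancel, translation_zero]; rfl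

/-- An automorphism `f` of the function field, semilinear over `s`, that carries `P` to `Q`
identifies the orders of vanishing at `Q` and at `P`. -/
theorem ord_eq_of_hasValueAt {f : W.FunctionField →+* W.FunctionField}
    (hf : Function.Surjective f) {s : F →+* F} {P Q : W.Point} (hQ : Q ≠ 0) (hP : P ≠ 0)
    (h : ∀ g v, HasValueAt g Q v → HasValueAt (f g) P (s v)) (g : W.FunctionField) :
    ord P (f g) = ord Q g := by
  by_cases hg : g = 0
  · have h0 : ∀ P : W.Point, ord P (0 : W.FunctionField) = 0 := fun P => by
      have := ord_inv P (0 : W.FunctionField)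
      rw [inv_zero] at this; omega
    rw [hg, map_zero, h0, h0]
  have hf0 : ∀ {g}, g ≠ 0 → f g ≠ 0 := fun hg => (_root_.map_ne_zero f).mpr hg
  rcases Q with _ | ⟨x, y, hxy⟩
  · exact (hQ rfl).elim
  rcases P with _ | ⟨x', y', hxy'⟩
  · exact (hP rfl).elim
  have hval : ∀ g ≠ 0, 0 ≤ ord (.some x y hxy) g → ∃ v, HasValueAt g (.some x y hxy) v ∧
      HasValueAt (f g) (.some x' y' hxy') (s v) := fun g hg h0 => by
    obtain ⟨v, hv⟩ := exists_hasValueAt hxy hg h0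
    exact ⟨v, hv, h g v hv⟩
  have hunit : ∀ g ≠ 0, ord (.some x y hxy) g = 0 → ord (.some x' y' hxy') (f g) = 0 := by
    intro g hg h0
    obtain ⟨v, hv, hv'⟩ := hval g hg h0.ge
    have h₁ := hv.ord_nonneg hg
    have h₂ := hv'.ord_nonneg (hf0 hg)
    rw [h0, lt_self_iff_false, false_iff] at h₁
    have := (not_iff_not.mpr h₂.2).mpr ((_root_.map_ne_zero s).mpr h₁.2)
    omega
  obtain ⟨t, ht0, ht⟩ := exists_ord_eq_one hxy
  set u := algebraMap W.CoordinateRing W.FunctionField t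
  have hu : u ≠ 0 := by simpa [u] using ht0
  have hzpow : ∀ (P : W.Point) (u : W.FunctionField), u ≠ 0 →
      ∀ k : ℤ, ord P (u ^ k) = k * ord P u := by
    intro P u hu k
    induction k using Int.induction_on with
    | zero => simp [ord_one]
    | succ i ih => rw [zpow_add_one₀ hu, ord_mul P (zpow_ne_zero _ hu) hu, ih]; ring
    | pred i ih =>
      rw [zpow_sub_one₀ hu, ord_mul P (zpow_ne_zero _ hu) (inv_ne_zero hu), ih, ord_inv]
      ring
  -- the orders are proportional
  have key : ∀ g ≠ 0, ord (.some x' y' hxy') (f g) =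
      ord (.some x y hxy) g * ord (.some x' y' hxy') (f u) := by
    intro g hg
    set k := ord (.some x y hxy) g with hk
    have hd : ord (.some x y hxy) (g / u ^ k) = 0 := by
      rw [ord_div _ hg (zpow_ne_zero _ hu), hzpow _ _ hu, ht]; omega
    have := hunit _ (div_ne_zero hg (zpow_ne_zero k hu)) hd
    rw [map_div₀, map_zpow₀, ord_div _ (hf0 hg) (zpow_ne_zero _ (hf0 hu)),
      hzpow _ _ (hf0 hu)] at this
    omega
  have hpos : 0 < ord (.some x' y' hxy') (f u) := by
    obtain ⟨v, hv, hv'⟩ := hval u hu (by omega)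
    have h₁ := hv.ord_nonneg hu
    have h₂ := hv'.ord_nonneg (hf0 hu)
    exact h₂.2.mpr (by rw [h₁.2.mp (by omega), map_zero])
  -- a uniformizer at `P` is in the image of `f`
  obtain ⟨t', ht0', ht'⟩ := exists_ord_eq_one hxy'
  obtain ⟨g', hg'⟩ := hf (algebraMap W.CoordinateRing W.FunctionField t')
  have hg'0 : g' ≠ 0 := by
    rintro rfl
    rw [map_zero, eq_comm] at hg'
    exact ht0' (by simpa using hg')
  have h1 := key g' hg'0
  rw [hg', ht'] at h1
  have : ord (.some x' y' hxy') (f u) = 1 := by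
    have := Int.eq_one_or_neg_one_of_mul_eq_one (u := ord (.some x' y' hxy') (f u))
      (by rw [mul_comm]; exact h1.symm)
    omega
  rw [key g hg, this, mul_one]

theorem Carries.ord_eq {f : W.FunctionField →ₐ[F] W.FunctionField} (hf : Function.Surjective f)
    {P Q : W.Point} (hQ : Q ≠ 0) (hP : P ≠ 0) (h : Carries f P Q) (g : W.FunctionField) :
    ord P (f g) = ord Q g :=
  ord_eq_of_hasValueAt (f := (f : W.FunctionField →+* W.FunctionField)) hf (s := RingHom.id F)
    hQ hP h g

lemma translation_surjective (S : W.Point) :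
    Function.Surjective (translation S : W.FunctionField →ₐ[F] W.FunctionField) :=
  fun f => ⟨translation (-S) f, translation_neg_translation S f⟩

lemma ord_translation_of_ne_zero [CharZero F] {P S : W.Point} (hP : P ≠ 0) (hPS : P + S ≠ 0)
    (f : W.FunctionField) : ord P (translation S f) = ord (P + S) f :=
  (carries_translation hP hPS).ord_eq (translation_surjective S) hPS hP f

lemma ord_negation_of_ne_zero {P : W.Point} (hP : P ≠ 0) (f : W.FunctionField) :
    ord P (negation W f) = ord (-P) f :=
  (carries_negation hP).ord_eq (fun f => ⟨_, negation_negation f⟩) (neg_ne_zero.mpr hP) hP f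

end

/-! ### Orders at infinity -/

section

variable {F : Type*} [Field F] [DecidableEq F] {W : WeierstrassCurve.Affine F}
open WeierstrassCurve.Affine Polynomial IsDedekindDomain
variable [IsAlgClosed F] [W.IsElliptic]

lemma ord_zero_right (P : W.Point) : ord P (0 : W.FunctionField) = 0 := by
  have := ord_inv P (0 : W.FunctionField)
  rw [inv_zero] at this
  omega

variable (W) in
/-- The finite places of the function field are the affine points. -/
def placeEquiv : {P : W.Point // P ≠ 0} ≃ HeightOneSpectrum W.CoordinateRing :=
  Equiv.ofBijective (fun P => match P with
    | ⟨.zero, h⟩ => (h rfl).elim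
    | ⟨.some _ _ h, _⟩ => place h) <| by
    constructor
    · rintro ⟨_ | ⟨x, y, h⟩, hP⟩ ⟨_ | ⟨x', y', h'⟩, hP'⟩ e
      · rfl
      · exact (hP rfl).elim
      · exact (hP' rfl).elim
      · exact Subtype.ext (place_inj.mp e)
    · intro v
      obtain ⟨x, y, h, rfl⟩ := exists_eq_place v
      exact ⟨⟨.some x y h, Point.some_ne_zero h⟩, rfl⟩

lemma count_placeEquiv (P : {P : W.Point // P ≠ 0}) (f : W.FunctionField) :
    FractionalIdeal.count W.FunctionField (placeEquiv W P)
      (FractionalIdeal.spanSingleton W.CoordinateRing⁰ f) = ord P.1 f := by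
  rcases P with ⟨_ | ⟨x, y, h⟩, hP⟩
  · exact (hP rfl).elim
  · rfl

lemma ord_zero_eq_finsum (f : W.FunctionField) :
    ord 0 f = -∑ᶠ P : {P : W.Point // P ≠ 0}, ord P.1 f := by
  rw [ord_zero_eq, ← finsum_comp_equiv (placeEquiv W)]
  simp only [count_placeEquiv]

lemma finite_support_ord (f : W.FunctionField) :
    (Function.support fun P : W.Point => ord P f).Finite := by
  have h₁ : (Function.support fun P : {P : W.Point // P ≠ 0} => ord P.1 f).Finite := by
    have := (finite_support_count f).preimage (placeEquiv W).injective.injOn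
    convert this using 1
    ext P
    simp only [Function.mem_support, Set.mem_preimage, count_placeEquiv]
  refine ((h₁.image Subtype.val).insert 0).subset fun P hP => ?_
  by_cases h0 : P = 0
  · exact Or.inl h0
  · exact Or.inr ⟨⟨P, h0⟩, hP, rfl⟩

/-- Principal divisors have degree zero. -/
theorem finsum_ord (f : W.FunctionField) : ∑ᶠ P : W.Point, ord P f = 0 := by
  have h := finsum_mem_insert' (fun P : W.Point => ord P f) (a := 0) (s := {P | P ≠ 0})
    (by simp) ((finite_support_ord f).inter_of_right _)
  have hu : insert 0 {P : W.Point | P ≠ 0} = Set.univ := by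
    ext P; simp [em]
  rw [hu, finsum_mem_univ, ord_zero_eq_finsum, finsum_subtype_eq_finsum_cond
    (fun P : W.Point => P ≠ 0) (f := fun P => ord P f)] at h
  rw [h]
  exact neg_add_cancel _

lemma ord_const (P : W.Point) (c : F) : ord P (algebraMap F W.FunctionField c) = 0 := by
  by_cases hc : c = 0
  · rw [hc, map_zero, ord_zero_right]
  have h : ∀ P : W.Point, P ≠ 0 → ord P (algebraMap F W.FunctionField c) = 0 := fun P hP => by
    have := (hasValueAt_const hP c).ord_nonneg ((_root_.map_ne_zero _).mpr hc)
    have h2 := (not_iff_not.mpr this.2).mpr hc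
    omega
  by_cases hP : P = 0
  · rw [hP, ord_zero_eq_finsum]
    simp only [fun P : {P : W.Point // P ≠ 0} => h P.1 P.2, finsum_zero, neg_zero]
  · exact h P hP

lemma ord_zero_negation (f : W.FunctionField) : ord 0 (negation W f) = ord 0 f := by
  let e : {P : W.Point // P ≠ 0} ≃ {P : W.Point // P ≠ 0} :=
    (Equiv.neg W.Point).subtypeEquiv fun P => by simp
  rw [ord_zero_eq_finsum, ord_zero_eq_finsum, ← finsum_comp_equiv e (f := fun P => ord P.1 f)]
  congr 1
  exact finsum_congr fun P => ord_negation_of_ne_zero P.2 f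

open Classical in
/-- The divisor of `x - c`, for `P` one of the points with first coordinate `c`. -/
lemma count_xFun_sub {x y : F} (h : W.Nonsingular x y) (v : HeightOneSpectrum W.CoordinateRing) :
    FractionalIdeal.count W.FunctionField v (FractionalIdeal.spanSingleton W.CoordinateRing⁰
      (xFun W - algebraMap F _ x)) =
    (if v = place ((WeierstrassCurve.Affine.nonsingular_neg ..).mpr h) then 1 else 0) +
      if v = place h then 1 else 0 := by
  have e : xFun W - algebraMap F _ x = algebraMap W.CoordinateRing W.FunctionField
      (CoordinateRing.XClass W x) := by
    rw [CoordinateRing.XClass, C_sub, map_sub, map_sub]; rfl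
  have e2 := CoordinateRing.XYIdeal_neg_mul h
  rw [CoordinateRing.XIdeal] at e2
  have h₁ : CoordinateRing.XYIdeal W x (C (W.negY x y)) =
    (place ((WeierstrassCurve.Affine.nonsingular_neg ..).mpr h)).asIdeal := rfl
  have h₂ : CoordinateRing.XYIdeal W x (C y) = (place h).asIdeal := rfl
  rw [e, ← FractionalIdeal.coeIdeal_span_singleton, ← e2, FractionalIdeal.coeIdeal_mul,
    FractionalIdeal.count_mul, h₁, h₂, FractionalIdeal.count_maximal, FractionalIdeal.count_maximal]
  · simp only [eq_comm]
  · exact FractionalIdeal.coeIdeal_ne_zero.mpr XYIdeal_ne_bot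
  · exact FractionalIdeal.coeIdeal_ne_zero.mpr XYIdeal_ne_bot

lemma ord_zero_xFun_sub (c : F) : ord 0 (xFun W - algebraMap F _ c) = -2 := by
  classical
  obtain ⟨y, h⟩ := exists_point_of_x (W := W) c
  have hs : ∀ w : HeightOneSpectrum W.CoordinateRing,
      ∑ᶠ v, (if v = w then (1 : ℤ) else 0) = 1 := fun w => by
    rw [finsum_eq_single _ w (fun v hv => if_neg hv), if_pos rfl]
  have hf : ∀ w : HeightOneSpectrum W.CoordinateRing,
      (Function.support fun v => if v = w then (1 : ℤ) else 0).Finite := fun w =>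
    (Set.finite_singleton w).subset fun v hv => by
      by_contra hne; exact hv (if_neg hne)
  rw [ord_zero_eq]
  simp only [count_xFun_sub h]
  rw [finsum_add_distrib (hf _) (hf _), hs, hs]
  norm_num

lemma ord_xFun_sub_eq_one {x y : F} (h : W.Nonsingular x y) (h2 : W.negY x y ≠ y) :
    ord (.some x y h) (xFun W - algebraMap F _ x) = 1 := by
  rw [ord_some, count_xFun_sub h, if_pos rfl, if_neg, zero_add]
  intro e
  exact h2 (Point.some.inj (place_inj.mp e)).2.symm

/-- The order at `-A` of the translate by `A` does not depend on the point `A ≠ 0`. -/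
lemma ord_neg_translation_eq [CharZero F] {A B : W.Point} (hA : A ≠ 0) (hB : B ≠ 0)
    (g : W.FunctionField) : ord (-A) (translation A g) = ord (-B) (translation B g) := by
  have h := ord_translation_of_ne_zero (P := -A) (S := A - B) (neg_ne_zero.mpr hA)
    (by rw [show -A + (A - B) = -B by abel]; exact neg_ne_zero.mpr hB) (translation B g)
  rw [← translation_add_apply, sub_add_cancel] at h
  rw [h]
  congr 1
  abel

lemma exists_ne_neg [CharZero F] : ∃ x y, ∃ _ : W.Nonsingular x y, W.negY x y ≠ y := by
  obtain ⟨P, hP⟩ := (finite_setOf_two_torsion (W := W)).exists_notMem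
  rcases P with _ | ⟨x, y, h⟩
  · exact (hP rfl).elim
  · refine ⟨x, y, h, fun e => hP ?_⟩
    rw [Set.mem_ofPred_eq, Point.neg_some]
    simp only [Point.some.injEq, true_and]
    exact e

/-- The function `x(P + A) - c` has a double pole at `-A`. This may be checked for a single `A`,
and for `A ≠ -A` it is seen from the addition formula. -/
lemma ord_neg_translation_xFun_sub [CharZero F] {A : W.Point} (hA : A ≠ 0) (c : F) :
    ord (-A) (translation A (xFun W - algebraMap F _ c)) = -2 := by
  obtain ⟨s, t, h, ht⟩ := exists_ne_neg (W := W)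
  rw [ord_neg_translation_eq hA (Point.some_ne_zero h)]
  have hne : xFun W ≠ algebraMap F W.FunctionField s := fun e => by
    have := ord_xFun_sub_eq_one h ht
    rw [e, sub_self, ord_zero_right] at this
    omega
  have hne' := sub_ne_zero.mpr hne
  have e := map_translation_genericPoint (W := W) (.some s t h)
  obtain ⟨h', e'⟩ := constPoint_some h
  rw [e', genericPoint, Point.add_of_X_ne hne, Point.map_some] at e
  have ex := (Point.some.inj e).1
  rw [slope_of_X_ne hne] at ex
  rw [Point.neg_some]
  set h₁ := (WeierstrassCurve.Affine.nonsingular_neg s t).mpr h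
  have hc := fun c : F => hasValueAt_const (Point.some_ne_zero h₁) c
  have hX := (hasValueAt_xFun h₁)
  have hY := (hasValueAt_yFun h₁).sub (hc t)
  have hXs := hX.sub (hc s)
  have hv := ((hY.mul hY).add (((hc W.a₁).mul hY).mul hXs)).sub
    (((((hc W.a₂).add hX).add (hc s)).add (hc c)).mul (hXs.mul hXs))
  set N := (yFun W - algebraMap F _ t) * (yFun W - algebraMap F _ t) +
    algebraMap F _ W.a₁ * (yFun W - algebraMap F _ t) * (xFun W - algebraMap F _ s) -
    (algebraMap F _ W.a₂ + xFun W + algebraMap F _ s + algebraMap F _ c) *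
      ((xFun W - algebraMap F _ s) * (xFun W - algebraMap F _ s)) with hN
  have key : translation (.some s t h) (xFun W - algebraMap F _ c) =
      N / ((xFun W - algebraMap F _ s) * (xFun W - algebraMap F _ s)) := by
    rw [map_sub, AlgHom.commutes, eq_div_iff (mul_ne_zero hne' hne')]
    change translation (.some s t h) (xFun W) = _ at ex
    rw [ex, hN]
    simp only [addX]
    rw [show (W⁄W.FunctionField).a₁ = algebraMap F _ W.a₁ from rfl,
      show (W⁄W.FunctionField).a₂ = algebraMap F _ W.a₂ from rfl]
    field_simp
    ring
  have hval : (W.negY s t - t) * (W.negY s t - t) + W.a₁ * (W.negY s t - t) * (s - s) -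
      (W.a₂ + s + s + c) * ((s - s) * (s - s)) ≠ 0 := by
    have := sub_ne_zero.mpr ht
    simpa using this
  have hN0 : N ≠ 0 := by
    intro h0
    rw [h0] at hv
    apply hval
    have := hc 0
    rw [map_zero] at this
    exact hv.eq this
  have hNord : ord (.some s _ h₁) N = 0 := by
    have := hv.ord_nonneg hN0
    have h2 := (not_iff_not.mpr this.2).mpr hval
    omega
  rw [key, ord_div _ hN0 (mul_ne_zero hne' hne'), hNord, ord_mul _ hne' hne',
    ord_xFun_sub_eq_one h₁]
  · norm_num
  · rw [negY_negY]; exact ht.symm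

/-- A homomorphism from the multiplicative group of the function field to `ℤ` is trivial if it is
invariant under `P ↦ -P` and trivial on constants and on the functions `x - c`: the product of an
element of the coordinate ring and its conjugate is a polynomial in `x`. -/
lemma eq_zero_of_xFun_sub {w : W.FunctionField → ℤ}
    (hmul : ∀ f ≠ 0, ∀ g ≠ 0, w (f * g) = w f + w g) (hconst : ∀ c : F, w (algebraMap F _ c) = 0)
    (hneg : ∀ f, w (negation W f) = w f) (hx : ∀ c : F, w (xFun W - algebraMap F _ c) = 0)
    (f : W.FunctionField) : w f = 0 := by
  have hinj := IsFractionRing.injective W.CoordinateRing W.FunctionField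
  have h0 : w 0 = 0 := by simpa using hconst 0
  have hpoly : ∀ p : F[X], p ≠ 0 →
      w (algebraMap W.CoordinateRing _ (CoordinateRing.mk W (C p))) = 0 := by
    have hne : ∀ p : F[X], p ≠ 0 →
        algebraMap W.CoordinateRing W.FunctionField (CoordinateRing.mk W (C p)) ≠ 0 := by
      intro p hp e
      rw [map_eq_zero_iff _ hinj] at e
      apply hp
      exact (map_eq_zero_iff _ (FaithfulSMul.algebraMap_injective F[X] W.CoordinateRing)).mp e
    intro p
    induction hp : p.natDegree generalizing p with
    | zero =>
      intro _
      rw [eq_C_of_natDegree_eq_zero hp]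
      exact hconst _
    | succ n ih =>
      intro hp0
      obtain ⟨c, hc⟩ := IsAlgClosed.exists_root p (fun h => by
        rw [degree_eq_natDegree hp0, hp] at h; exact absurd h (by norm_cast))
      obtain ⟨q, rfl⟩ := dvd_iff_isRoot.mpr hc
      have hq : q ≠ 0 := right_ne_zero_of_mul hp0
      have e : algebraMap W.CoordinateRing W.FunctionField (CoordinateRing.mk W (C (X - C c))) =
          xFun W - algebraMap F _ c := by
        rw [C_sub, map_sub, map_sub]; rfl
      rw [natDegree_mul (X_sub_C_ne_zero c) hq, natDegree_X_sub_C] at hp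
      rw [C_mul, map_mul, map_mul, hmul _ (hne _ (X_sub_C_ne_zero c)) _ (hne _ hq), e, hx, zero_add]
      exact ih q (by omega) hq
  have hring : ∀ a : W.CoordinateRing, w (algebraMap _ _ a) = 0 := by
    intro a
    by_cases ha : a = 0
    · rw [ha, map_zero, h0]
    have ha' : algebraMap W.CoordinateRing W.FunctionField a ≠ 0 := by simpa using ha
    have hna : negation W (algebraMap W.CoordinateRing W.FunctionField a) ≠ 0 :=
      (_root_.map_ne_zero _).mpr ha'
    -- the product of `a` and its conjugate is a polynomial in `x`
    obtain ⟨p, hp⟩ : ∃ p : F[X], algebraMap W.CoordinateRing W.FunctionField a *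
        negation W (algebraMap W.CoordinateRing W.FunctionField a) =
        algebraMap W.CoordinateRing _ (CoordinateRing.mk W (C p)) := by
      obtain ⟨p, q, rfl⟩ := CoordinateRing.exists_smul_basis_eq a
      refine ⟨Algebra.norm F[X] (p • (1 : W.CoordinateRing) + q • CoordinateRing.mk W X), ?_⟩
      have hn : ∀ p : F[X], negation W (algebraMap W.CoordinateRing W.FunctionField
          (CoordinateRing.mk W (C p))) =
          algebraMap W.CoordinateRing W.FunctionField (CoordinateRing.mk W (C p)) := by
        intro p
        induction p using Polynomial.induction_on with
        | C a =>
          have hC : algebraMap W.CoordinateRing W.FunctionField (CoordinateRing.mk W (C (C a))) =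
                algebraMap F _ a := rfl
          rw [hC, AlgHom.commutes]
        | add p q hp hq => simp only [map_add, hp, hq]
        | monomial n a ih =>
          rw [pow_succ, ← mul_assoc, C_mul (a := C a * X ^ n), map_mul, map_mul, map_mul, ih]
          exact congrArg _ negation_coordinates.1
      have hy : negation W (algebraMap W.CoordinateRing W.FunctionField (CoordinateRing.mk W X)) =
          algebraMap W.CoordinateRing W.FunctionField (CoordinateRing.mk W
            (-X - C (C W.a₁ * X + C W.a₃))) := by
        refine negation_coordinates.2.trans ?_
        simp only [map_sub, map_neg, map_add, map_mul]
        rw [sub_sub]; rfl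
      have e : p • (1 : W.CoordinateRing) + q • CoordinateRing.mk W X =
          CoordinateRing.mk W (C p + C q * X) := by
        rw [CoordinateRing.smul, CoordinateRing.smul, mul_one, map_add, map_mul]
      have hnorm := CoordinateRing.coe_norm_smul_basis (W' := W) p q
      have hcoe : ∀ p : F[X], CoordinateRing.mk W (C p) = algebraMap F[X] W.CoordinateRing p :=
        fun _ => rfl
      rw [hcoe (Algebra.norm F[X] _)]
      refine Eq.trans ?_ (congrArg (algebraMap W.CoordinateRing W.FunctionField) hnorm).symm
      rw [e, map_mul, map_mul]
      congr 1
      simp only [map_add, map_mul, hn, hy]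
    have hp0 : p ≠ 0 := by
      rintro rfl
      rw [C_0, map_zero, map_zero] at hp
      exact mul_ne_zero ha' hna hp
    have := hmul _ ha' _ hna
    rw [hp, hpoly p hp0, hneg] at this
    omega
  obtain ⟨a, b, hb, rfl⟩ := IsFractionRing.div_surjective (A := W.CoordinateRing) f
  have hb' : algebraMap W.CoordinateRing W.FunctionField b ≠ 0 := by
    simpa using nonZeroDivisors.ne_zero hb
  by_cases ha : a = 0
  · rw [ha, map_zero, zero_div, h0]
  have ha' : algebraMap W.CoordinateRing W.FunctionField a ≠ 0 := by simpa using ha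
  have := hmul _ (div_ne_zero ha' hb') _ hb'
  rw [div_mul_cancel₀ _ hb', hring, hring] at this
  omega

/-- Translation identifies the order at infinity, which is defined through the degree, with the
order at the affine point `-A`. In particular it is a valuation. -/
lemma ord_neg_translation [CharZero F] {A : W.Point} (hA : A ≠ 0) (g : W.FunctionField) :
    ord (-A) (translation A g) = ord 0 g := by
  rw [← sub_eq_zero]
  refine eq_zero_of_xFun_sub (w := fun g => ord (-A) (translation A g) - ord 0 g) ?_ ?_ ?_ ?_ g
  · intro f hf g hg
    have h : ∀ f ≠ 0, translation A f ≠ 0 := fun f hf => (_root_.map_ne_zero _).mpr hf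
    simp only [map_mul]
    rw [ord_mul _ (h f hf) (h g hg), ord_mul _ hf hg]
    ring
  · intro c
    simp only [AlgHom.commutes]
    rw [ord_const, ord_const, sub_zero]
  · intro f
    rw [ord_zero_negation, negation_translation, ord_negation_of_ne_zero (neg_ne_zero.mpr hA),
      neg_neg, ord_neg_translation_eq hA (neg_ne_zero.mpr hA), neg_neg]
  · intro c
    rw [ord_neg_translation_xFun_sub hA, ord_zero_xFun_sub, sub_self]

/-- Translation by `S` moves the divisor of a function by `-S`. -/
theorem ord_translation [CharZero F] (P S : W.Point) (f : W.FunctionField) :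
    ord P (translation S f) = ord (P + S) f := by
  by_cases hS : S = 0
  · subst hS; rw [translation_zero, add_zero]; rfl
  by_cases hP : P = 0
  · subst hP
    have h := ord_neg_translation (neg_ne_zero.mpr hS) (translation S f)
    rw [neg_neg, ← translation_add_apply, neg_add_cancel, translation_zero] at h
    rw [← h, zero_add]; rfl
  by_cases hPS : P + S = 0
  · rw [hPS, eq_neg_of_add_eq_zero_left hPS, ord_neg_translation hS]
  · exact ord_translation_of_ne_zero hP hPS f

/-- The ultrametric inequality. -/
theorem le_ord_add [CharZero F] (P : W.Point) {f g : W.FunctionField} {k : ℤ}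
    (hfg : f + g ≠ 0) (hf : f ≠ 0 → k ≤ ord P f) (hg : g ≠ 0 → k ≤ ord P g) :
    k ≤ ord P (f + g) := by
  by_cases hf0 : f = 0
  · rw [hf0, zero_add] at hfg ⊢; exact hg hfg
  by_cases hg0 : g = 0
  · rw [hg0, add_zero] at hfg ⊢; exact hf hfg
  have main : ∀ P : W.Point, P ≠ 0 → ∀ f g : W.FunctionField, f ≠ 0 → g ≠ 0 → f + g ≠ 0 →
      ord P f ≤ ord P g → ord P f ≤ ord P (f + g) := by
    intro P hP f g hf0 hg0 hfg hle
    rcases P with _ | ⟨x, y, h⟩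
    · exact (hP rfl).elim
    obtain ⟨v, hv⟩ := exists_hasValueAt h (div_ne_zero hg0 hf0) (by
      rw [ord_div _ hg0 hf0]; omega)
    have h1 : (1 : W.FunctionField) + g / f = (f + g) / f := by
      rw [add_div, div_self hf0]
    have hv' := (hasValueAt_const (Point.some_ne_zero h) 1).add hv
    rw [map_one, h1] at hv'
    have := (hv'.ord_nonneg (div_ne_zero hfg hf0)).1
    rw [ord_div _ hfg hf0] at this
    omega
  have main' : ∀ P : W.Point, ∀ f g : W.FunctionField, f ≠ 0 → g ≠ 0 → f + g ≠ 0 →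
      ord P f ≤ ord P g → ord P f ≤ ord P (f + g) := by
    intro P f g hf0 hg0 hfg hle
    by_cases hP : P = 0
    · subst hP
      obtain ⟨x, y, h, -⟩ := exists_ne_neg (W := W)
      have hA := Point.some_ne_zero h
      set A := Point.some x y h
      have h : ∀ f ≠ 0, translation A f ≠ 0 := fun f hf => (_root_.map_ne_zero _).mpr hf
      simp only [← ord_neg_translation hA] at hle ⊢
      rw [map_add]
      exact main _ (neg_ne_zero.mpr hA) _ _ (h _ hf0) (h _ hg0)
        (by rw [← map_add]; exact h _ hfg) hle
    · exact main P hP f g hf0 hg0 hfg hle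
  rcases le_total (ord P f) (ord P g) with hle | hle
  · exact (hf hf0).trans (main' P f g hf0 hg0 hfg hle)
  · rw [add_comm] at hfg ⊢
    exact (hg hg0).trans (main' P g f hg0 hf0 hfg hle)

/-- A function without a pole at an affine point `P` has a constant term there. -/
lemma exists_const_of_ord_nonneg {P : W.Point} (hP : P ≠ 0) {f : W.FunctionField}
    (h : f ≠ 0 → 0 ≤ ord P f) :
    ∃ c : F, f ≠ algebraMap F _ c → 0 < ord P (f - algebraMap F _ c) := by
  by_cases hf : f = 0
  · exact ⟨0, fun h => (h (by rw [hf, map_zero])).elim⟩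
  rcases P with _ | ⟨x, y, hxy⟩
  · exact (hP rfl).elim
  obtain ⟨v, hv⟩ := exists_hasValueAt hxy hf (h hf)
  refine ⟨v, fun hne => ?_⟩
  have hv' := hv.sub (hasValueAt_const hP v)
  exact (hv'.ord_nonneg (sub_ne_zero.mpr hne)).2.mpr (sub_self v)

/-- A function without poles is constant. -/
theorem exists_eq_const [CharZero F] {f : W.FunctionField} (h : ∀ P, 0 ≤ ord P f) :
    ∃ c : F, f = algebraMap F _ c := by
  obtain ⟨x, y, hA, -⟩ := exists_ne_neg (W := W)
  obtain ⟨c, hc⟩ := exists_const_of_ord_nonneg (Point.some_ne_zero hA) (f := f) (fun _ => h _)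
  refine ⟨c, ?_⟩
  by_contra hne
  have hnn : ∀ P, 0 ≤ ord P (f - algebraMap F _ c) := fun P => by
    rw [sub_eq_add_neg]
    refine le_ord_add P ?_ (fun _ => h P) fun _ => ?_
    · rw [← sub_eq_add_neg]; exact sub_ne_zero.mpr hne
    · rw [ord_neg, ord_const]
  have hpos := hc hne
  have hsum := finsum_ord (f - algebraMap F _ c)
  have := finsum_pos (fun P => hnn P) ⟨_, hpos⟩ (finite_support_ord _)
  omega

end

/-! ### Divisors -/

section

variable {F : Type*} [Field F] [DecidableEq F] {W : WeierstrassCurve.Affine F}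
open WeierstrassCurve.Affine Polynomial IsDedekindDomain

/-- The invertible fractional ideal of the coordinate ring that corresponds to the affine part of
a divisor. -/
def divisorIdeal :
    (W.Point →₀ ℤ) →+ Additive (FractionalIdeal W.CoordinateRing⁰ W.FunctionField)ˣ :=
  Finsupp.liftAddHom fun P => zmultiplesHom _ (Additive.ofMul (pointIdeal P))

lemma divisorIdeal_single (P : W.Point) (k : ℤ) :
    divisorIdeal (Finsupp.single P k) = k • Additive.ofMul (pointIdeal P) := by
  simp [divisorIdeal]

lemma toClass_eq_mk_pointIdeal (P : W.Point) :
    Point.toClass P = Additive.ofMul (ClassGroup.mk W.FunctionField (pointIdeal P)) := by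
  rcases P with _ | ⟨x, y, h⟩
  · exact (map_zero _).trans (congrArg Additive.ofMul (map_one _)).symm
  · rfl

/-- The sum of a divisor, for the group law of the curve. -/
def divisorSum : (W.Point →₀ ℤ) →+ W.Point := Finsupp.liftAddHom fun P => zmultiplesHom _ P

lemma divisorSum_single (P : W.Point) (k : ℤ) : divisorSum (Finsupp.single P k) = k • P := by
  simp [divisorSum]

lemma toClass_divisorSum (D : W.Point →₀ ℤ) : Point.toClass (divisorSum D) =
    Additive.ofMul (ClassGroup.mk W.FunctionField (divisorIdeal D).toMul) := by
  induction D using Finsupp.induction_linear with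
  | zero => simp
  | add D D' h h' => rw [map_add, map_add, h, h', map_add, toMul_add, map_mul, ofMul_mul]
  | single P k =>
    rw [divisorSum_single, divisorIdeal_single, map_zsmul, toClass_eq_mk_pointIdeal, toMul_zsmul,
      map_zpow, ofMul_zpow]; rfl

/-- A divisor has sum zero if and only if its affine part is principal, as the group of points
embeds into the class group of the coordinate ring. -/
lemma divisorSum_eq_zero_iff (D : W.Point →₀ ℤ) : divisorSum D = 0 ↔
    ((divisorIdeal D).toMul : Submodule W.CoordinateRing W.FunctionField).IsPrincipal := by
  rw [← ClassGroup.mk_eq_one_iff, ← Point.toClass_injective.eq_iff, toClass_divisorSum, map_zero]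
  rfl

variable [IsAlgClosed F] [W.IsElliptic]

open Classical in
lemma count_pointIdeal (P : W.Point) (Q : {P : W.Point // P ≠ 0}) :
    FractionalIdeal.count W.FunctionField (placeEquiv W Q) (pointIdeal P :
      FractionalIdeal W.CoordinateRing⁰ W.FunctionField) = if P = Q then 1 else 0 := by
  rcases P with _ | ⟨x, y, h⟩
  · rw [if_neg (fun e => Q.2 e.symm)]
    exact FractionalIdeal.count_one _ _
  · have e : ((pointIdeal (.some x y h : W.Point) :
      (FractionalIdeal W.CoordinateRing⁰ W.FunctionField)ˣ) :
      FractionalIdeal W.CoordinateRing⁰ W.FunctionField) =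
      ((placeEquiv W ⟨.some x y h, Point.some_ne_zero h⟩).asIdeal :
        FractionalIdeal W.CoordinateRing⁰ W.FunctionField) := rfl
    rw [e, FractionalIdeal.count_maximal]
    congr 1
    rw [(placeEquiv W).injective.eq_iff, Subtype.ext_iff]

lemma count_divisorIdeal (D : W.Point →₀ ℤ) (Q : {P : W.Point // P ≠ 0}) :
    FractionalIdeal.count W.FunctionField (placeEquiv W Q)
      ((divisorIdeal D).toMul : FractionalIdeal W.CoordinateRing⁰ W.FunctionField) = D Q := by
  classical
  induction D using Finsupp.induction_linear with
  | zero => simpa using FractionalIdeal.count_one _ _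
  | add D D' h h' =>
    rw [map_add, toMul_add, Units.val_mul, FractionalIdeal.count_mul _ _ (Units.ne_zero _)
      (Units.ne_zero _), h, h', Finsupp.add_apply]
  | single P k =>
    rw [divisorIdeal_single, toMul_zsmul, Units.val_zpow_eq_zpow_val, FractionalIdeal.count_zpow,
      toMul_ofMul, count_pointIdeal, Finsupp.single_apply]
    simp

lemma fractionalIdeal_eq_of_count {I J : FractionalIdeal W.CoordinateRing⁰ W.FunctionField}
    (hI : I ≠ 0) (hJ : J ≠ 0) (h : ∀ v, FractionalIdeal.count W.FunctionField v I =
      FractionalIdeal.count W.FunctionField v J) : I = J := by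
  rw [← FractionalIdeal.finprod_heightOneSpectrum_factorization' _ hI,
    ← FractionalIdeal.finprod_heightOneSpectrum_factorization' _ hJ]
  simp only [h]

lemma spanSingleton_eq_divisorIdeal_iff {f : W.FunctionField} (D : W.Point →₀ ℤ) :
    FractionalIdeal.spanSingleton W.CoordinateRing⁰ f = (divisorIdeal D).toMul ↔
      f ≠ 0 ∧ ∀ P ≠ 0, ord P f = D P := by
  constructor
  · intro h
    refine ⟨?_, fun P hP => ?_⟩
    · rintro rfl
      rw [FractionalIdeal.spanSingleton_zero] at h
      exact Units.ne_zero _ h.symm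
    · have := congrArg (FractionalIdeal.count W.FunctionField (placeEquiv W ⟨P, hP⟩)) h
      rwa [count_placeEquiv, count_divisorIdeal] at this
  · rintro ⟨hf, h⟩
    apply fractionalIdeal_eq_of_count (FractionalIdeal.spanSingleton_ne_zero_iff.mpr hf)
      (Units.ne_zero _)
    intro v
    obtain ⟨⟨P, hP⟩, rfl⟩ := (placeEquiv W).surjective v
    rw [count_placeEquiv, count_divisorIdeal, h P hP]

/-- The degree of a divisor. -/
def divisorDegree : (W.Point →₀ ℤ) →+ ℤ := Finsupp.liftAddHom fun _ => AddMonoidHom.id ℤ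

lemma divisorDegree_single (P : W.Point) (k : ℤ) : divisorDegree (Finsupp.single P k) = k := by
  simp [divisorDegree]

lemma divisorDegree_eq_finsum (D : W.Point →₀ ℤ) : divisorDegree D = ∑ᶠ P, D P := by
  rw [finsum_eq_sum_of_support_subset (s := D.support) _ (by simp)]
  simp [divisorDegree, Finsupp.sum]

variable (W) in
/-- The divisor of a function. -/
def divisor (f : W.FunctionField) : W.Point →₀ ℤ :=
  Finsupp.ofSupportFinite (fun P => ord P f) (finite_support_ord f)

lemma divisor_apply (f : W.FunctionField) (P : W.Point) : divisor W f P = ord P f := rfl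

/-- The sum of a principal divisor is zero. -/
theorem divisorSum_divisor {f : W.FunctionField} (hf : f ≠ 0) : divisorSum (divisor W f) = 0 := by
  rw [divisorSum_eq_zero_iff]
  have := (spanSingleton_eq_divisorIdeal_iff (divisor W f)).mpr ⟨hf, fun P _ => rfl⟩
  rw [← this]
  exact ⟨f, FractionalIdeal.coe_spanSingleton _ _⟩

lemma ord_eq_of_degree {f : W.FunctionField} {D : W.Point →₀ ℤ} (h : ∀ P ≠ 0, ord P f = D P)
    (hdeg : divisorDegree D = 0) (P : W.Point) : ord P f = D P := by
  by_cases hP : P = 0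
  · subst hP
    have h₁ : ∑ᶠ P : W.Point, (ord P f - D P) = 0 := by
      rw [finsum_sub_distrib (finite_support_ord f) D.hasFiniteSupport, finsum_ord,
        ← divisorDegree_eq_finsum, hdeg, sub_zero]
    rw [finsum_eq_single _ 0 (fun P hP => by rw [h P hP, sub_self])] at h₁
    exact sub_eq_zero.mp h₁
  · exact h P hP

/-- A divisor of degree zero and sum zero is principal. -/
theorem exists_divisor_eq {D : W.Point →₀ ℤ} (hdeg : divisorDegree D = 0)
    (hsum : divisorSum D = 0) : ∃ f : W.FunctionField, f ≠ 0 ∧ ∀ P, ord P f = D P := by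
  obtain ⟨f, hf⟩ := (divisorSum_eq_zero_iff D).mp hsum
  have : FractionalIdeal.spanSingleton W.CoordinateRing⁰ f = (divisorIdeal D).toMul := by
    apply FractionalIdeal.coeToSubmodule_injective
    exact (FractionalIdeal.coe_spanSingleton _ _).trans hf.symm
  obtain ⟨h0, h⟩ := (spanSingleton_eq_divisorIdeal_iff D).mp this
  exact ⟨f, h0, ord_eq_of_degree h hdeg⟩

/-! ### Functions with divisor `[n]^*(T) - [n]^*(0)` -/

lemma finite_fiber [CharZero F] {n : ℕ} (hn : n ≠ 0) (T : W.Point) :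
    {P : W.Point | n • P = T}.Finite := by
  obtain ⟨P₀, rfl⟩ := nsmul_surjective hn T
  have h : {P : W.Point | n • P = 0}.Finite :=
    Set.finite_of_ncard_ne_zero (by rw [ncard_torsion hn]; exact pow_ne_zero 2 hn)
  refine (h.image (P₀ + ·)).subset fun P hP => ⟨P - P₀, ?_, by simp⟩
  have hP : n • P = n • P₀ := hP
  simp only [Set.mem_ofPred_eq, smul_sub, hP, sub_self]

/-- The points `P` with `nP = T`. -/
def fiber [CharZero F] {n : ℕ} (hn : n ≠ 0) (T : W.Point) : Finset W.Point :=
  (finite_fiber hn T).toFinset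

lemma mem_fiber [CharZero F] {n : ℕ} {hn : n ≠ 0} {T P : W.Point} :
    P ∈ fiber hn T ↔ n • P = T := by simp [fiber]

lemma fiber_eq_map [CharZero F] {n : ℕ} (hn : n ≠ 0) {T P : W.Point} (hP : n • P = T) :
    fiber hn T = (fiber hn 0).map (addLeftEmbedding P) := by
  ext Q
  simp only [mem_fiber, Finset.mem_map, addLeftEmbedding_apply]
  constructor
  · intro h
    exact ⟨Q - P, by rw [smul_sub, h, hP, sub_self], by simp⟩
  · rintro ⟨Q, hQ, rfl⟩
    rw [smul_add, hQ, hP, add_zero]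

lemma card_fiber [CharZero F] {n : ℕ} (hn : n ≠ 0) (T : W.Point) : (fiber hn T).card = n ^ 2 := by
  obtain ⟨P₀, h₀⟩ := nsmul_surjective hn T
  rw [fiber_eq_map hn h₀, Finset.card_map, ← ncard_torsion (W := W) hn, fiber,
    Set.ncard_eq_toFinset_card _ (finite_fiber hn 0)]

/-- The divisor `[n]^*(T)`. -/
def pullbackPoint [CharZero F] {n : ℕ} (hn : n ≠ 0) (T : W.Point) : W.Point →₀ ℤ :=
  ∑ P ∈ fiber hn T, Finsupp.single P 1

lemma pullbackPoint_apply [CharZero F] {n : ℕ} (hn : n ≠ 0) (T P : W.Point)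
    [Decidable (n • P = T)] : pullbackPoint hn T P = if n • P = T then 1 else 0 := by
  classical
  rw [pullbackPoint, Finsupp.finsetSum_apply]
  simp only [Finsupp.single_apply, Finset.sum_ite_eq', mem_fiber]

lemma divisorDegree_pullbackPoint [CharZero F] {n : ℕ} (hn : n ≠ 0) (T : W.Point) :
    divisorDegree (pullbackPoint hn T) = (n : ℤ) ^ 2 := by
  simp [pullbackPoint, map_sum, divisorDegree_single, card_fiber]

lemma divisorSum_pullbackPoint [CharZero F] {n : ℕ} (hn : n ≠ 0) {T P : W.Point} (hP : n • P = T) :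
    divisorSum (pullbackPoint hn T) = n • T + divisorSum (pullbackPoint hn 0) := by
  simp only [pullbackPoint, map_sum, divisorSum_single, one_smul]
  rw [fiber_eq_map hn hP, Finset.sum_map]
  simp only [addLeftEmbedding_apply]
  rw [Finset.sum_add_distrib, Finset.sum_const, card_fiber, pow_two, mul_smul, hP]

lemma hasPullbackDivisor_iff_ord_of_ne_zero [CharZero F] {n : ℕ} (hn : n ≠ 0) (T : W.Point)
    (G : W.FunctionField) : HasPullbackDivisor n T G ↔ G ≠ 0 ∧
      ∀ P ≠ 0, ord P G = (pullbackPoint hn T - pullbackPoint hn 0 : W.Point →₀ ℤ) P := by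
  have hprod : ∀ T : W.Point, (∏ᶠ P : {P : W.Point // n • P = T}, pointIdeal P.1) =
      (divisorIdeal (pullbackPoint hn T)).toMul := fun T => by
    rw [finprod_subtype_eq_finprod_cond (fun P => n • P = T) (f := pointIdeal),
      pullbackPoint, map_sum, toMul_sum]
    simp only [divisorIdeal_single, one_smul, toMul_ofMul]
    rw [← finprod_mem_finset_eq_prod]
    simp only [mem_fiber]
  rw [HasPullbackDivisor, hprod, hprod, ← toMul_sub, ← map_sub, spanSingleton_eq_divisorIdeal_iff]

lemma hasPullbackDivisor_iff_ord [CharZero F] {n : ℕ} (hn : n ≠ 0) (T : W.Point)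
    (G : W.FunctionField) : HasPullbackDivisor n T G ↔
      G ≠ 0 ∧ ∀ P, ord P G = (pullbackPoint hn T - pullbackPoint hn 0 : W.Point →₀ ℤ) P := by
  rw [hasPullbackDivisor_iff_ord_of_ne_zero hn]
  refine and_congr_right fun _ => ⟨fun h P => ord_eq_of_degree h ?_ P, fun h P _ => h P⟩
  rw [map_sub, divisorDegree_pullbackPoint, divisorDegree_pullbackPoint, sub_self]

/-- The divisor `[n]^*(T) - [n]^*(0)` is principal, as its degree is zero and its sum is `nT = 0`.
-/
theorem exists_hasPullbackDivisor [CharZero F] {n : ℕ} (hn : n ≠ 0) {T : W.Point}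
    (hT : n • T = 0) : ∃ G, HasPullbackDivisor n T G := by
  obtain ⟨P, hP⟩ := nsmul_surjective hn T
  simp only [hasPullbackDivisor_iff_ord hn]
  apply exists_divisor_eq
  · rw [map_sub, divisorDegree_pullbackPoint, divisorDegree_pullbackPoint, sub_self]
  · rw [map_sub, divisorSum_pullbackPoint hn hP, hT, zero_add, sub_self]

end

/-! ### The Weil pairing -/

section

variable {F : Type*} [Field F] [DecidableEq F] {W : WeierstrassCurve.Affine F}
open WeierstrassCurve.Affine Polynomial IsDedekindDomain
variable [IsAlgClosed F] [W.IsElliptic] [CharZero F]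

lemma exists_eq_const_mul {f g : W.FunctionField} (hg : g ≠ 0) (hf : f ≠ 0)
    (h : ∀ P, ord P f = ord P g) : ∃ c : F, c ≠ 0 ∧ f = algebraMap F _ c * g := by
  obtain ⟨c, hc⟩ := exists_eq_const (f := f / g) fun P => by rw [ord_div _ hf hg, h, sub_self]
  refine ⟨c, ?_, ?_⟩
  · rintro rfl
    rw [map_zero] at hc
    exact div_ne_zero hf hg hc
  · rw [← hc, div_mul_cancel₀ _ hg]

lemma translation_ne_zero {f : W.FunctionField} (hf : f ≠ 0) (S : W.Point) :
    translation S f ≠ 0 := (_root_.map_ne_zero _).mpr hf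

lemma HasPullbackDivisor.ne_zero {n : ℕ} (hn : n ≠ 0) {T : W.Point} {G : W.FunctionField}
    (hG : HasPullbackDivisor n T G) : G ≠ 0 := ((hasPullbackDivisor_iff_ord hn T G).mp hG).1

open Classical in
lemma HasPullbackDivisor.ord_eq {n : ℕ} (hn : n ≠ 0) {T : W.Point} {G : W.FunctionField}
    (hG : HasPullbackDivisor n T G) (P : W.Point) :
    ord P G = (if n • P = T then 1 else 0) - if n • P = 0 then 1 else 0 := by
  rw [((hasPullbackDivisor_iff_ord hn T G).mp hG).2, Finsupp.sub_apply, pullbackPoint_apply,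
    pullbackPoint_apply]

/-- A function with divisor `[n]^*(T) - [n]^*(0)` is an eigenfunction of the translations by
`n`-torsion points. -/
lemma exists_translation_eq {n : ℕ} (hn : n ≠ 0) {S T : W.Point} (hS : n • S = 0)
    {G : W.FunctionField} (hG : HasPullbackDivisor n T G) :
    ∃ ζ : F, ζ ≠ 0 ∧ translation S G = algebraMap F _ ζ * G := by
  refine exists_eq_const_mul (hG.ne_zero hn) (translation_ne_zero (hG.ne_zero hn) S) fun P => ?_
  rw [ord_translation, hG.ord_eq hn, hG.ord_eq hn, smul_add, hS, add_zero]

/-- The relation `G(P + S) = ζ G(P)` holds for all `P` at which both sides are defined if and only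
if it holds as an identity of functions, since it determines `ζ` at a single general point. -/
lemma isWeilPairingValue_iff {n : ℕ} (hn : n ≠ 0) {S T : W.Point} (hS : n • S = 0) {ζ : F} :
    IsWeilPairingValue n S T ζ ↔ ∃ G, HasPullbackDivisor n T G ∧
      translation S G = algebraMap F _ ζ * G := by
  refine exists_congr fun G => and_congr_right fun hG => ⟨fun h => ?_, fun h P v v' hv hv' => ?_⟩
  · obtain ⟨ζ', -, e⟩ := exists_translation_eq hn hS hG
    have hfin := (((fiber hn T).finite_toSet.union (fiber hn 0).finite_toSet).union
      (Set.toFinite {0, -S}))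
    obtain ⟨P, hP⟩ := hfin.exists_notMem
    simp only [Set.mem_union, Finset.mem_coe, mem_fiber, Set.mem_insert_iff, not_or,
      Set.mem_singleton_iff] at hP
    obtain ⟨⟨h₁, h₂⟩, h₃, h₄⟩ := hP
    have hPS : P + S ≠ 0 := fun e => h₄ (eq_neg_of_add_eq_zero_left e)
    have h0 := hG.ne_zero hn
    have hval : ∀ P : W.Point, P ≠ 0 → n • P ≠ T → n • P ≠ 0 → ∃ v, v ≠ 0 ∧ HasValueAt G P v := by
      intro P hP h₁ h₂
      have ho : ord P G = 0 := by rw [hG.ord_eq hn, if_neg h₁, if_neg h₂, sub_self]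
      rcases P with _ | ⟨x, y, hxy⟩
      · exact (hP rfl).elim
      obtain ⟨v, hv⟩ := exists_hasValueAt hxy h0 ho.ge
      refine ⟨v, fun hv0 => ?_, hv⟩
      have := (hv.ord_nonneg h0).2.mpr hv0
      omega
    have hnPS : n • (P + S) = n • P := by rw [smul_add, hS, add_zero]
    obtain ⟨v, hv0, hv⟩ := hval P h₃ h₁ h₂
    obtain ⟨v', -, hv'⟩ := hval (P + S) hPS (by rwa [hnPS]) (by rwa [hnPS])
    have h₅ := carries_translation h₃ hPS _ _ hv'
    rw [e] at h₅
    have h₆ := h₅.eq ((hasValueAt_const h₃ ζ').mul hv)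
    rw [h P v v' hv hv'] at h₆
    rw [e, mul_right_cancel₀ hv0 h₆]
  · have h₅ := carries_translation hv.ne_zero hv'.ne_zero _ _ hv'
    rw [h] at h₅
    exact h₅.eq ((hasValueAt_const hv.ne_zero ζ).mul hv)

/-- The pairing may be computed from any function with divisor `[n]^*(T) - [n]^*(0)`. -/
lemma weilPairing_eq_of_translation_eq {n : ℕ} (hn : n ≠ 0) {S T : W.Point} (hS : n • S = 0)
    {G : W.FunctionField} (hG : HasPullbackDivisor n T G) {ζ : F}
    (h : translation S G = algebraMap F _ ζ * G) : weilPairing n S T = ζ := by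
  have hex : ∃ ζ : F, IsWeilPairingValue n S T ζ :=
    ⟨ζ, (isWeilPairingValue_iff hn hS).mpr ⟨G, hG, h⟩⟩
  rw [weilPairing, dif_pos hex]
  obtain ⟨G', hG', h'⟩ := (isWeilPairingValue_iff hn hS).mp hex.choose_spec
  obtain ⟨c, hc, e⟩ := exists_eq_const_mul (hG.ne_zero hn) (hG'.ne_zero hn)
    (fun P => by rw [hG'.ord_eq hn, hG.ord_eq hn])
  have hc' : algebraMap F W.FunctionField c ≠ 0 := (_root_.map_ne_zero _).mpr hc
  rw [e, map_mul, AlgHom.commutes, h,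
    mul_left_comm (algebraMap F _ hex.choose)] at h'
  have := mul_right_cancel₀ (hG.ne_zero hn) (mul_left_cancel₀ hc' h')
  exact (((algebraMap F W.FunctionField).injective this).symm)

lemma translation_eq_weilPairing_mul {n : ℕ} (hn : n ≠ 0) {S T : W.Point} (hS : n • S = 0)
    {G : W.FunctionField} (hG : HasPullbackDivisor n T G) :
    translation S G = algebraMap F _ (weilPairing n S T) * G := by
  obtain ⟨ζ, -, h⟩ := exists_translation_eq hn hS hG
  rw [weilPairing_eq_of_translation_eq hn hS hG h, h]

lemma isWeilPairingValue_iff_eq {n : ℕ} (hn : n ≠ 0) {S T : W.Point} (hS : n • S = 0)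
    (hT : n • T = 0) {ζ : F} : IsWeilPairingValue n S T ζ ↔ weilPairing n S T = ζ := by
  rw [isWeilPairingValue_iff hn hS]
  constructor
  · rintro ⟨G, hG, h⟩
    exact weilPairing_eq_of_translation_eq hn hS hG h
  · rintro rfl
    obtain ⟨G, hG⟩ := exists_hasPullbackDivisor hn hT
    exact ⟨G, hG, translation_eq_weilPairing_mul hn hS hG⟩

theorem weilPairing_add_left {n : ℕ} (hn : n ≠ 0) {S S' T : W.Point} (hS : n • S = 0)
    (hS' : n • S' = 0) (hT : n • T = 0) :
    weilPairing n (S + S') T = weilPairing n S T * weilPairing n S' T := by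
  obtain ⟨G, hG⟩ := exists_hasPullbackDivisor hn hT
  refine weilPairing_eq_of_translation_eq hn (by rw [smul_add, hS, hS', add_zero]) hG ?_
  rw [translation_add_apply, translation_eq_weilPairing_mul hn hS' hG, map_mul, AlgHom.commutes,
    translation_eq_weilPairing_mul hn hS hG, map_mul]
  ring

/-- Bilinearity in the second variable: if `Tᵢ = nTᵢ'` with `T₃' = T₁' + T₂'` and
`div h = (T₃') - (T₁') - (T₂') + (0)`, the product of the translates of `h` by `E[n]` is invariant
under `E[n]` and relates the three eigenfunctions. -/
theorem weilPairing_add_right {n : ℕ} (hn : n ≠ 0) {S T₁ T₂ : W.Point} (hS : n • S = 0)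
    (hT₁ : n • T₁ = 0) (hT₂ : n • T₂ = 0) :
    weilPairing n S (T₁ + T₂) = weilPairing n S T₁ * weilPairing n S T₂ := by
  classical
  obtain ⟨U₁, hU₁⟩ := nsmul_surjective hn T₁
  obtain ⟨U₂, hU₂⟩ := nsmul_surjective hn T₂
  obtain ⟨G₁, hG₁⟩ := exists_hasPullbackDivisor hn hT₁
  obtain ⟨G₂, hG₂⟩ := exists_hasPullbackDivisor hn hT₂
  obtain ⟨G₃, hG₃⟩ := exists_hasPullbackDivisor hn (T := T₁ + T₂)
    (by rw [smul_add, hT₁, hT₂, add_zero])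
  obtain ⟨h, h0, hh⟩ := exists_divisor_eq (D := Finsupp.single (U₁ + U₂) 1 - Finsupp.single U₁ 1 -
    Finsupp.single U₂ 1 + Finsupp.single (0 : W.Point) 1)
    (by simp only [map_add, map_sub, divisorDegree_single]; norm_num)
    (by simp only [map_add, map_sub, divisorSum_single, one_smul]; abel)
  set H := ∏ Q ∈ fiber (W := W) hn 0, translation Q h with hH
  have hHne : H ≠ 0 := Finset.prod_ne_zero_iff.mpr fun Q _ => translation_ne_zero h0 Q
  have hinv : translation S H = H := by
    rw [hH, map_prod]
    simp only [← translation_add_apply]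
    refine Finset.prod_nbij' (S + ·) (-S + ·) ?_ ?_ ?_ ?_ ?_ <;>
      simp +contextual [mem_fiber, smul_add, hS]
  have hsum : ∀ P U : W.Point, ∑ Q ∈ fiber (W := W) hn 0, (Finsupp.single U (1 : ℤ)) (P + Q) =
      if n • P = n • U then 1 else 0 := by
    intro P U
    simp only [Finsupp.single_apply]
    have : ∀ Q, (U = P + Q) ↔ Q = U - P := fun Q => by rw [eq_sub_iff_add_eq', eq_comm]
    simp only [this, Finset.sum_ite_eq', mem_fiber, smul_sub, sub_eq_zero, eq_comm]
  have hordprod : ∀ P, ord P H = ∑ Q ∈ fiber (W := W) hn 0, ord (P + Q) h := by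
    intro P
    rw [hH]
    simp only [← ord_translation]
    induction fiber (W := W) hn 0 using Finset.induction_on with
    | empty => simp [ord_one]
    | insert Q s hQ ih =>
      rw [Finset.prod_insert hQ, Finset.sum_insert hQ, ord_mul _ (translation_ne_zero h0 Q)
        (Finset.prod_ne_zero_iff.mpr fun Q _ => translation_ne_zero h0 Q), ih]
  have hn₁ := hG₁.ne_zero hn
  have hn₂ := hG₂.ne_zero hn
  obtain ⟨c, hc, e⟩ := exists_eq_const_mul (mul_ne_zero hHne (mul_ne_zero hn₁ hn₂))
    (hG₃.ne_zero hn) (fun P => by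
      rw [ord_mul _ hHne (mul_ne_zero hn₁ hn₂), ord_mul _ hn₁ hn₂, hG₁.ord_eq hn, hG₂.ord_eq hn,
        hG₃.ord_eq hn, hordprod]
      simp only [hh, Finsupp.add_apply, Finsupp.sub_apply, Finset.sum_add_distrib,
        Finset.sum_sub_distrib, hsum, smul_add, hU₁, hU₂, smul_zero]
      ring)
  refine weilPairing_eq_of_translation_eq hn hS hG₃ ?_
  rw [e, map_mul, map_mul, map_mul, AlgHom.commutes, hinv, translation_eq_weilPairing_mul hn hS hG₁,
    translation_eq_weilPairing_mul hn hS hG₂, map_mul]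
  ring

/-- The Weil pairing is alternating: if `nU = T`, the product of the translates by
`0, U, …, (n - 1)U` is constant, and comparing it with its translate by `U` gives the claim. -/
theorem weilPairing_self {n : ℕ} (hn : n ≠ 0) {T : W.Point} (hT : n • T = 0) :
    weilPairing n T T = 1 := by
  classical
  obtain ⟨U, hU⟩ := nsmul_surjective hn T
  have hU : n • U = T := hU
  obtain ⟨G, hG⟩ := exists_hasPullbackDivisor hn hT
  have h0 := hG.ne_zero hn
  refine weilPairing_eq_of_translation_eq hn hT hG ?_
  have hord : ∀ P (k : ℕ), ord P (∏ i ∈ Finset.range k, translation (i • U) G) =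
      (if n • P = T then 1 else 0) - if n • P + k • T = T then 1 else 0 := by
    intro P k
    induction k with
    | zero => simp [ord_one]
    | succ k ih =>
      rw [Finset.prod_range_succ, ord_mul _ (Finset.prod_ne_zero_iff.mpr fun i _ =>
        translation_ne_zero h0 _) (translation_ne_zero h0 _), ih, ord_translation, hG.ord_eq hn,
        smul_add, smul_comm n k U, hU]
      have : n • P + (k + 1) • T = T ↔ n • P + k • T = 0 := by
        rw [add_smul, one_smul, ← add_assoc, add_eq_right]
      simp only [this]
      ring
  obtain ⟨c, hc⟩ := exists_eq_const (f := ∏ i ∈ Finset.range n, translation (i • U) G)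
    (fun P => by rw [hord, hT, add_zero, sub_self])
  have hne : ∏ i ∈ Finset.range n, translation (i • U) G ≠ 0 :=
    Finset.prod_ne_zero_iff.mpr fun i _ => translation_ne_zero h0 _
  have h₁ : translation U (∏ i ∈ Finset.range n, translation (i • U) G) =
      ∏ i ∈ Finset.range n, translation ((i + 1) • U) G := by
    rw [map_prod]
    refine Finset.prod_congr rfl fun i _ => ?_
    rw [← translation_add_apply, add_smul, one_smul, add_comm]
  have h₂ := Finset.prod_range_succ' (fun i => translation (i • U) G) n
  rw [Finset.prod_range_succ, ← h₁, hc, AlgHom.commutes, ← hc, hU, zero_smul,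
    translation_zero] at h₂
  rw [mul_left_cancel₀ hne h₂, map_one, one_mul]
  rfl

lemma weilPairing_ne_zero {n : ℕ} (hn : n ≠ 0) {S T : W.Point} (hS : n • S = 0)
    (hT : n • T = 0) : weilPairing n S T ≠ 0 := by
  obtain ⟨G, hG⟩ := exists_hasPullbackDivisor hn hT
  obtain ⟨ζ, h, e⟩ := exists_translation_eq hn hS hG
  rwa [weilPairing_eq_of_translation_eq hn hS hG e]

/-- The Weil pairing is nondegenerate.  Otherwise some nonconstant `G` with divisor
`[n]^*(T) - [n]^*(0)` is invariant under `E[n]`; subtracting its value at a general point `P`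
leaves the divisor `[n]^*(nP) - [n]^*(0)`, whose sum is `n²P ≠ 0`. -/
theorem eq_zero_of_weilPairing_eq_one {n : ℕ} (hn : n ≠ 0) {T : W.Point} (hT : n • T = 0)
    (h : ∀ S : W.Point, n • S = 0 → weilPairing n S T = 1) : T = 0 := by
  classical
  by_contra hT0
  obtain ⟨G, hG⟩ := exists_hasPullbackDivisor hn hT
  have h0 := hG.ne_zero hn
  have hinv : ∀ S : W.Point, n • S = 0 → translation S G = G := fun S hS => by
    rw [translation_eq_weilPairing_mul hn hS hG, h S hS, map_one, one_mul]
  obtain ⟨P₀, hP₀⟩ := (finite_fiber (W := W) (pow_ne_zero 2 hn) 0).exists_notMem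
  have hP₀ : n • n • P₀ ≠ 0 := by rwa [← mul_smul, ← pow_two]
  have hP0 : P₀ ≠ 0 := by rintro rfl; exact hP₀ (by rw [smul_zero, smul_zero])
  have hnP0 : n • P₀ ≠ 0 := fun e => hP₀ (by rw [e, smul_zero])
  have hnPT : n • P₀ ≠ T := fun e => hP₀ (by rw [e, hT])
  have hord₀ : ord P₀ G = 0 := by rw [hG.ord_eq hn, if_neg hnPT, if_neg hnP0, sub_self]
  obtain ⟨c, hc⟩ := exists_const_of_ord_nonneg hP0 (fun _ => hord₀.ge)
  have hf : G - algebraMap F _ c ≠ 0 := by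
    intro e
    obtain ⟨U, hU⟩ := nsmul_surjective hn T
    have hU : n • U = T := hU
    have := hG.ord_eq hn U
    rw [sub_eq_zero.mp e, ord_const, if_pos hU, if_neg (by rwa [hU])] at this
    omega
  set f := G - algebraMap F _ c with hf_def
  have hfinv : ∀ S : W.Point, n • S = 0 → translation S f = f := fun S hS => by
    rw [hf_def, map_sub, hinv S hS, AlgHom.commutes]
  have hzero : ∀ P : W.Point, n • P = n • P₀ → 1 ≤ ord P f := by
    intro P hP
    have := ord_translation P₀ (P - P₀) f
    rw [hfinv _ (by rw [smul_sub, hP, sub_self]), add_sub_cancel] at this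
    rw [← this]
    exact hc (sub_ne_zero.mp hf)
  have hpole : ∀ P : W.Point, -(if n • P = 0 then 1 else 0) ≤ ord P f := by
    intro P
    rw [hf_def, sub_eq_add_neg]
    refine le_ord_add P (by rwa [← sub_eq_add_neg]) (fun _ => ?_) fun _ => ?_
    · rw [hG.ord_eq hn]; split_ifs <;> norm_num
    · rw [ord_neg, ord_const]; split_ifs <;> norm_num
  have hnonneg : ∀ P, 0 ≤ (divisor W f - (pullbackPoint hn (n • P₀) - pullbackPoint hn 0) :
      W.Point →₀ ℤ) P := by
    intro P
    rw [Finsupp.sub_apply, Finsupp.sub_apply, pullbackPoint_apply, pullbackPoint_apply,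
      divisor_apply]
    have h₁ := hpole P
    by_cases h₂ : n • P = n • P₀
    · rw [if_pos h₂, if_neg (by rwa [h₂])]
      have := hzero P h₂
      omega
    · rw [if_neg h₂]; omega
  have hdeg : divisorDegree (divisor W f) = 0 := by
    rw [divisorDegree_eq_finsum]; exact finsum_ord f
  have hzero : divisor W f - (pullbackPoint hn (n • P₀) - pullbackPoint hn 0) = 0 := by
    have hd :
        divisorDegree (divisor W f - (pullbackPoint hn (n • P₀) - pullbackPoint hn 0)) = 0 := by
      rw [map_sub, map_sub, hdeg, divisorDegree_pullbackPoint, divisorDegree_pullbackPoint]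
      simp
    ext P
    by_contra hne
    rw [divisorDegree_eq_finsum] at hd
    have := finsum_pos hnonneg ⟨P, lt_of_le_of_ne (hnonneg P) (Ne.symm hne)⟩
      (Finsupp.hasFiniteSupport _)
    omega
  have hsum := divisorSum_divisor hf
  rw [sub_eq_zero.mp hzero, map_sub, divisorSum_pullbackPoint hn rfl, add_sub_cancel_right] at hsum
  exact hP₀ hsum

end

/-! ### Galois equivariance of the Weil pairing -/

section

open WeierstrassCurve.Affine Polynomial IsDedekindDomain

section Galois

variable {k F : Type*} [Field k] [Field F] [DecidableEq F] [Algebra k F]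
  {V : WeierstrassCurve.Affine k}

/-- The action of a field automorphism on the coordinate ring, through the coefficients. -/
def conjRing (σ : F ≃ₐ[k] F) : (V⁄F).CoordinateRing →+* (V⁄F).CoordinateRing :=
  AdjoinRoot.lift ((AdjoinRoot.of _).comp (mapRingHom (σ : F →+* F))) (AdjoinRoot.root _) (by
    have h := WeierstrassCurve.Affine.baseChange_polynomial V (σ : F →ₐ[k] F)
    have h' : (V⁄F).polynomial.map (mapRingHom (σ : F →+* F)) = (V⁄F).polynomial := h.symm
    rw [← eval₂_map, h', AdjoinRoot.eval₂_root])

lemma conjRing_mk (σ : F ≃ₐ[k] F) (p : F[X][X]) :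
    conjRing (V := V) σ (CoordinateRing.mk _ p) =
      CoordinateRing.mk _ (p.map (mapRingHom (σ : F →+* F))) := by
  rw [conjRing, CoordinateRing.mk, AdjoinRoot.lift_mk, ← eval₂_map]
  exact AdjoinRoot.aeval_eq _

lemma conjRing_conjRing {σ τ : F ≃ₐ[k] F} (h : ∀ x, σ (τ x) = x) (a : (V⁄F).CoordinateRing) :
    conjRing σ (conjRing τ a) = a := by
  obtain ⟨p, rfl⟩ := AdjoinRoot.mk_surjective a
  change conjRing σ (conjRing τ (CoordinateRing.mk _ p)) = CoordinateRing.mk _ p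
  rw [conjRing_mk, conjRing_mk, Polynomial.map_map, mapRingHom_comp]
  have : (σ : F →+* F).comp (τ : F →+* F) = RingHom.id F := RingHom.ext h
  rw [this, mapRingHom_id, Polynomial.map_id]

/-- The action of a field automorphism on the coordinate ring, as an automorphism. -/
def conjEquiv (σ : F ≃ₐ[k] F) : (V⁄F).CoordinateRing ≃+* (V⁄F).CoordinateRing :=
  { conjRing σ with
    invFun := conjRing σ.symm
    left_inv := conjRing_conjRing σ.symm_apply_apply
    right_inv := conjRing_conjRing σ.apply_symm_apply }

/-- The action of a field automorphism on rational functions. -/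
def conjFun (σ : F ≃ₐ[k] F) : (V⁄F).FunctionField ≃+* (V⁄F).FunctionField :=
  IsFractionRing.ringEquivOfRingEquiv (conjEquiv (V := V) σ)

lemma conjFun_algebraMap (σ : F ≃ₐ[k] F) (a : (V⁄F).CoordinateRing) :
    conjFun σ (algebraMap _ (V⁄F).FunctionField a) = algebraMap _ _ (conjRing σ a) :=
  IsFractionRing.ringEquivOfRingEquiv_algebraMap (conjEquiv (V := V) σ) a

lemma conjFun_symm_conjFun (σ : F ≃ₐ[k] F) (g : (V⁄F).FunctionField) :
    conjFun σ.symm (conjFun σ g) = g := (conjFun σ).symm_apply_apply g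

/-- The action of a field automorphism on points. -/
abbrev conjPoint (σ : F ≃ₐ[k] F) : (V⁄F).Point →+ (V⁄F).Point :=
  Point.map (W' := V) (σ : F →ₐ[k] F)

lemma conjPoint_symm_conjPoint (σ : F ≃ₐ[k] F) (P : (V⁄F).Point) :
    conjPoint σ.symm (conjPoint σ P) = P := by
  rcases P with _ | ⟨x, y, h⟩
  · rfl
  · change Point.some _ _ _ = _
    simp

lemma conjPoint_conjPoint_symm (σ : F ≃ₐ[k] F) (P : (V⁄F).Point) :
    conjPoint σ (conjPoint σ.symm P) = P := conjPoint_symm_conjPoint σ.symm P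

lemma hasValueAt_conj (σ : F ≃ₐ[k] F) {g : (V⁄F).FunctionField} {P : (V⁄F).Point} {v : F}
    (h : HasValueAt g P v) : HasValueAt (conjFun σ g) (conjPoint σ P) (σ v) := by
  rcases P with _ | ⟨x, y, hP⟩
  · exact h.elim
  obtain ⟨a, b, e, hb, rfl⟩ := (hasValueAt_some hP).mp h
  have hP' := (V.baseChange_nonsingular (σ : F →ₐ[k] F).injective x y).mpr hP
  have hev : ∀ a, evalPt (W := V⁄F) hP' (conjRing σ a) = σ (evalPt hP a) := by
    intro a
    obtain ⟨p, rfl⟩ := AdjoinRoot.mk_surjective a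
    change evalPt (W := V⁄F) hP' (conjRing σ (CoordinateRing.mk _ p)) =
      σ (evalPt hP (CoordinateRing.mk _ p))
    rw [conjRing_mk, evalPt_mk, evalPt_mk]
    exact map_mapRingHom_evalEval (σ : F →+* F) p x y
  refine (hasValueAt_some (W := V⁄F) hP').mpr ⟨conjRing σ a, conjRing σ b, ?_, ?_, ?_⟩
  · rw [← conjFun_algebraMap, e, map_mul, conjFun_algebraMap]
  · rw [hev]; exact (_root_.map_ne_zero σ).mpr hb
  · rw [hev, hev, map_div₀]

variable [IsAlgClosed F] [(V⁄F).IsElliptic] [CharZero F]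

lemma conjPoint_ne_zero (σ : F ≃ₐ[k] F) {P : (V⁄F).Point} (hP : P ≠ 0) : conjPoint σ P ≠ 0 :=
  fun h => hP (by rw [← conjPoint_symm_conjPoint σ P, h, map_zero])

lemma ord_conj (σ : F ≃ₐ[k] F) {P : (V⁄F).Point} (hP : P ≠ 0) (g : (V⁄F).FunctionField) :
    ord (conjPoint σ P) (conjFun σ g) = ord P g := by
  have h := ord_eq_of_hasValueAt (f := (conjFun (V := V) σ).toRingHom) (conjFun σ).surjective
    (s := (σ : F →+* F)) hP (conjPoint_ne_zero σ hP) (fun _ _ h => hasValueAt_conj σ h) g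
  exact h

lemma HasPullbackDivisor.conj {n : ℕ} (hn : n ≠ 0) (σ : F ≃ₐ[k] F) {T : (V⁄F).Point}
    {G : (V⁄F).FunctionField} (hG : HasPullbackDivisor n T G) :
    HasPullbackDivisor n (conjPoint σ T) (conjFun σ G) := by
  classical
  rw [hasPullbackDivisor_iff_ord_of_ne_zero hn] at hG ⊢
  refine ⟨(_root_.map_ne_zero _).mpr hG.1, fun P hP => ?_⟩
  obtain ⟨Q, rfl⟩ : ∃ Q, conjPoint σ Q = P := ⟨_, conjPoint_conjPoint_symm σ P⟩
  have hinj : ∀ {A B : (V⁄F).Point}, conjPoint σ A = conjPoint σ B ↔ A = B := fun {A B} =>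
    ⟨fun h => by rw [← conjPoint_symm_conjPoint σ A, h, conjPoint_symm_conjPoint], congrArg _⟩
  have hQ : Q ≠ 0 := by rintro rfl; exact hP (map_zero _)
  rw [ord_conj σ hQ, hG.2 Q hQ, Finsupp.sub_apply, Finsupp.sub_apply, pullbackPoint_apply,
    pullbackPoint_apply, pullbackPoint_apply, pullbackPoint_apply]
  have h0 : n • conjPoint σ Q = 0 ↔ n • Q = 0 := by
    rw [← map_nsmul]
    exact ⟨fun h => hinj.mp (h.trans (map_zero _).symm), fun h => by rw [h, map_zero]⟩
  have h1 : n • conjPoint σ Q = conjPoint σ T ↔ n • Q = T := by rw [← map_nsmul, hinj]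
  simp only [h0, h1]

/-- The Weil pairing is Galois equivariant. -/
theorem weilPairing_conj {n : ℕ} (hn : n ≠ 0) (σ : F ≃ₐ[k] F) {S T : (V⁄F).Point}
    (hS : n • S = 0) (hT : n • T = 0) :
    weilPairing n (conjPoint σ S) (conjPoint σ T) = σ (weilPairing n S T) := by
  obtain ⟨G, hG, h⟩ := (isWeilPairingValue_iff_eq hn hS hT).mpr rfl
  refine (isWeilPairingValue_iff_eq hn (by rw [← map_nsmul, hS, map_zero])
    (by rw [← map_nsmul, hT, map_zero])).mp ⟨_, hG.conj hn σ, fun P v v' hv hv' => ?_⟩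
  have h₁ := hasValueAt_conj σ.symm hv
  have h₂ := hasValueAt_conj σ.symm hv'
  rw [conjFun_symm_conjFun] at h₁ h₂
  rw [map_add, conjPoint_symm_conjPoint] at h₂
  have := h _ _ _ h₁ h₂
  have := congrArg σ this
  rwa [map_mul, σ.apply_symm_apply, σ.apply_symm_apply] at this

end Galois

end

/-! ### Twisted group algebras -/

section

/-- A bicharacter on `M` with values in the units of a field, written in the field. -/
structure Bicharacter (M L : Type*) [AddCommGroup M] [Field L] where
  /-- The underlying function. -/
  toFun : M → M → L
  add_left' : ∀ S S' T, toFun (S + S') T = toFun S T * toFun S' T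
  add_right' : ∀ S T T', toFun S (T + T') = toFun S T * toFun S T'
  ne_zero' : ∀ S T, toFun S T ≠ 0

namespace Bicharacter

variable {M L : Type*} [AddCommGroup M] [Field L]

instance : CoeFun (Bicharacter M L) fun _ => M → M → L := ⟨toFun⟩

variable (ε : Bicharacter M L)

lemma add_left (S S' T : M) : ε (S + S') T = ε S T * ε S' T := ε.add_left' S S' T
lemma add_right (S T T' : M) : ε S (T + T') = ε S T * ε S T' := ε.add_right' S T T'
lemma ne_zero (S T : M) : ε S T ≠ 0 := ε.ne_zero' S T

lemma zero_left (T : M) : ε 0 T = 1 := by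
  have := ε.add_left 0 0 T
  rw [add_zero] at this
  exact (mul_eq_left₀ (ε.ne_zero 0 T)).mp this.symm

lemma zero_right (S : M) : ε S 0 = 1 := by
  have := ε.add_right S 0 0
  rw [add_zero] at this
  exact (mul_eq_left₀ (ε.ne_zero S 0)).mp this.symm

lemma neg_right (S T : M) : ε S (-T) = (ε S T)⁻¹ := by
  exact eq_inv_of_mul_eq_one_left (by rw [← add_right, neg_add_cancel, zero_right])

/-- The commutator pairing of `ε` is nondegenerate. -/
def Nondegenerate : Prop := ∀ T, (∀ S, ε S T = ε T S) → T = 0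

end Bicharacter

/-- The group algebra of `M` over `L`, with multiplication twisted by the bicharacter `ε`. -/
def TwistedAlgebra {M L : Type*} [AddCommGroup M] [Field L] (_ : Bicharacter M L) : Type _ := M → L

namespace TwistedAlgebra

variable {M L : Type*} [AddCommGroup M] [Field L] {ε : Bicharacter M L}

instance : AddCommGroup (TwistedAlgebra ε) := inferInstanceAs (AddCommGroup (M → L))
instance : Module L (TwistedAlgebra ε) := inferInstanceAs (Module L (M → L))

@[ext] lemma ext {z w : TwistedAlgebra ε} (h : ∀ T : M, (z : M → L) T = (w : M → L) T) : z = w :=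
  funext h

variable [Fintype M] [DecidableEq M]

instance : Module.Finite L (TwistedAlgebra ε) := inferInstanceAs (Module.Finite L (M → L))

instance : Mul (TwistedAlgebra ε) :=
  ⟨fun z w T => ∑ S : M, ε S (T - S) * (z : M → L) S * (w : M → L) (T - S)⟩

lemma mul_apply (z w : TwistedAlgebra ε) (T : M) : (z * w : TwistedAlgebra ε) T =
    ∑ S : M, ε S (T - S) * (z : M → L) S * (w : M → L) (T - S) := rfl

lemma add_apply (z w : TwistedAlgebra ε) (T : M) : (z + w : TwistedAlgebra ε) T =
    (z : M → L) T + (w : M → L) T := rfl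

lemma smul_apply (c : L) (z : TwistedAlgebra ε) (T : M) : (c • z : TwistedAlgebra ε) T =
    c * (z : M → L) T := rfl

/-- The basis element `u_S` of the twisted group algebra. -/
def single (ε : Bicharacter M L) (S : M) : TwistedAlgebra ε := Pi.single S (1 : L)

lemma single_apply (S T : M) : (single ε S : M → L) T = if T = S then 1 else 0 := by
  rw [single, Pi.single_apply]

lemma single_mul_apply (S : M) (z : TwistedAlgebra ε) (T : M) :
    (single ε S * z : TwistedAlgebra ε) T = ε S (T - S) * (z : M → L) (T - S) := by
  rw [mul_apply, Finset.sum_eq_single S]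
  · rw [single_apply, if_pos rfl, mul_one]
  · intro R _ hR
    rw [single_apply, if_neg hR, mul_zero, zero_mul]
  · simp

lemma mul_single_apply (z : TwistedAlgebra ε) (S T : M) :
    (z * single ε S : TwistedAlgebra ε) T = ε (T - S) S * (z : M → L) (T - S) := by
  rw [mul_apply, Finset.sum_eq_single (T - S)]
  · rw [sub_sub_cancel, single_apply, if_pos rfl, mul_one]
  · intro R _ hR
    rw [single_apply, if_neg, mul_zero]
    rintro rfl
    exact hR (by abel)
  · simp

instance : Ring (TwistedAlgebra ε) :=
  { (inferInstance : AddCommGroup (TwistedAlgebra ε)),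
    (inferInstance : Mul (TwistedAlgebra ε)) with
    one := single ε 0
    left_distrib := fun x y z => by
      ext T
      simp only [mul_apply, add_apply, mul_add, Finset.sum_add_distrib]
    right_distrib := fun x y z => by
      ext T
      simp only [mul_apply, add_apply, mul_add, add_mul, Finset.sum_add_distrib]
    zero_mul := fun x => by
      ext T
      exact Finset.sum_eq_zero fun S _ => by
        rw [show ((0 : TwistedAlgebra ε) : M → L) S = 0 from rfl, mul_zero, zero_mul]
    mul_zero := fun x => by
      ext T
      exact Finset.sum_eq_zero fun S _ => by
        rw [show ((0 : TwistedAlgebra ε) : M → L) (T - S) = 0 from rfl, mul_zero]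
    one_mul := fun x => by
      ext T
      change (single ε 0 * x : TwistedAlgebra ε) T = _
      rw [single_mul_apply, ε.zero_left, one_mul, sub_zero]
    mul_one := fun x => by
      ext T
      change (x * single ε 0 : TwistedAlgebra ε) T = _
      rw [mul_single_apply, ε.zero_right, one_mul, sub_zero]
    mul_assoc := fun x y z => by
      ext T
      simp only [mul_apply, Finset.mul_sum, Finset.sum_mul]
      rw [Finset.sum_comm]
      refine Finset.sum_congr rfl fun R _ => ?_
      rw [← Equiv.sum_comp (Equiv.addLeft R)]
      refine Finset.sum_congr rfl fun S _ => ?_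
      simp only [Equiv.coe_addLeft, add_sub_cancel_left, ← sub_sub]
      have h : T - R = S + (T - R - S) := by abel
      have h₁ : ε R (T - R) = ε R S * ε R (T - R - S) := by
        conv_lhs => rw [h]
        rw [ε.add_right]
      rw [h₁, ε.add_left]
      ring }

lemma one_def : (1 : TwistedAlgebra ε) = single ε 0 := rfl

instance : Algebra L (TwistedAlgebra ε) :=
  Algebra.ofModule
    (fun c x y => by
      ext T
      simp only [mul_apply, smul_apply, Finset.mul_sum]
      exact Finset.sum_congr rfl fun S _ => by ring)
    (fun c x y => by
      ext T
      simp only [mul_apply, smul_apply, Finset.mul_sum]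
      exact Finset.sum_congr rfl fun S _ => by ring)

lemma conj_apply (S : M) (z : TwistedAlgebra ε) (T : M) :
    (single ε S * z * single ε (-S) : TwistedAlgebra ε) T =
      ε S (-S) * (ε S T * (ε T S)⁻¹ * (z : M → L) T) := by
  rw [mul_single_apply, single_mul_apply, sub_neg_eq_add, add_sub_cancel_right, ε.add_left,
    ε.neg_right T]
  ring

lemma single_mul_single_neg (S : M) :
    single ε S * single ε (-S) = ε S (-S) • (1 : TwistedAlgebra ε) := by
  ext T
  rw [single_mul_apply, smul_apply, one_def, single_apply, single_apply]
  by_cases h : T = 0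
  · subst h; simp
  · rw [if_neg h, if_neg (by rwa [sub_eq_neg_self]), mul_zero, mul_zero]

lemma sum_commutator (hε : ε.Nondegenerate) {T : M} (hT : T ≠ 0) :
    ∑ S : M, ε S T * (ε T S)⁻¹ = 0 := by
  obtain ⟨S₀, hS₀⟩ : ∃ S, ε S T ≠ ε T S := by
    by_contra! h
    exact hT (hε T h)
  have h : (∑ S : M, ε S T * (ε T S)⁻¹) * (ε S₀ T * (ε T S₀)⁻¹) = ∑ S : M, ε S T * (ε T S)⁻¹ := by
    conv_rhs => rw [← Equiv.sum_comp (Equiv.addRight S₀)]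
    rw [Finset.sum_mul]
    refine Finset.sum_congr rfl fun S _ => ?_
    rw [Equiv.coe_addRight, ε.add_left, ε.add_right, mul_inv]
    ring
  by_contra hne
  have := (mul_eq_left₀ hne).mp h
  rw [mul_inv_eq_one₀ (ε.ne_zero _ _)] at this
  exact hS₀ this

instance : Nontrivial (TwistedAlgebra ε) :=
  ⟨1, 0, fun h => by
    have := congrFun h (0 : M)
    rw [one_def, single_apply, if_pos rfl] at this
    exact one_ne_zero this⟩

/-- A twisted group algebra with nondegenerate commutator pairing is simple: averaging the
conjugates of an element of an ideal by the `u_S` against a character isolates one coefficient. -/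
theorem isSimpleRing [CharZero L] (hε : ε.Nondegenerate) : IsSimpleRing (TwistedAlgebra ε) := by
  refine ⟨⟨fun I => or_iff_not_imp_left.mpr fun hI => ?_⟩⟩
  obtain ⟨z, hz, hz0⟩ : ∃ z ∈ I, z ≠ 0 := by
    by_contra! h
    exact hI (le_bot_iff.mp fun x hx => by
      rw [TwoSidedIdeal.mem_bot]; exact h x hx)
  obtain ⟨T₀, hT₀⟩ : ∃ T, (z : M → L) T ≠ 0 := by
    by_contra! h
    exact hz0 (ext h)
  have hsmul : ∀ (c : L) (x : TwistedAlgebra ε), x ∈ I → c • x ∈ I := fun c x hx => by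
    have := I.mul_mem_left (algebraMap L _ c) x hx
    rwa [← Algebra.smul_def] at this
  set y : TwistedAlgebra ε := ∑ S : M, ((ε S (-S))⁻¹ * (ε S T₀)⁻¹ * ε T₀ S) •
    (single ε S * z * single ε (-S)) with hy
  have hyI : y ∈ I := by
    refine sum_mem fun S _ => hsmul _ _ ?_
    exact I.mul_mem_right _ _ (I.mul_mem_left _ _ hz)
  have hsum : ∀ (f : M → TwistedAlgebra ε) (T : M), ((∑ S, f S : TwistedAlgebra ε) : M → L) T =
      ∑ S, (f S : M → L) T := fun f T => Finset.sum_apply T _ _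
  have hyval : y = (Fintype.card M * (z : M → L) T₀) • single ε T₀ := by
    ext T
    rw [hy, hsum, smul_apply, single_apply]
    have h₁ : ∀ S : M, ((((ε S (-S))⁻¹ * (ε S T₀)⁻¹ * ε T₀ S) •
        (single ε S * z * single ε (-S)) : TwistedAlgebra ε) : M → L) T =
        (z : M → L) T * (ε S (T - T₀) * (ε (T - T₀) S)⁻¹) := by
      intro S
      have h₂ := ε.add_right S (T - T₀) T₀
      have h₃ := ε.add_left (T - T₀) T₀ S
      rw [sub_add_cancel] at h₂ h₃
      rw [smul_apply, conj_apply, h₂, h₃]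
      have := ε.ne_zero S (-S)
      have := ε.ne_zero S T₀
      have := ε.ne_zero T₀ S
      have := ε.ne_zero (T - T₀) S
      field_simp
    simp only [h₁]
    rw [← Finset.mul_sum]
    by_cases h : T = T₀
    · subst h
      simp only [sub_self, ε.zero_left, ε.zero_right, inv_one, mul_one, if_true,
        Finset.sum_const, Finset.card_univ, nsmul_eq_mul]
      ring
    · rw [sum_commutator hε (sub_ne_zero.mpr h), if_neg h, mul_zero, mul_zero]
  have hc : (Fintype.card M * (z : M → L) T₀) ≠ 0 :=
    mul_ne_zero (Nat.cast_ne_zero.mpr Fintype.card_ne_zero) hT₀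
  have h1 : single ε T₀ ∈ I := by
    have := hsmul (Fintype.card M * (z : M → L) T₀)⁻¹ _ hyI
    rwa [hyval, inv_smul_smul₀ hc] at this
  have h2 := hsmul (ε T₀ (-T₀))⁻¹ _ (I.mul_mem_right _ (single ε (-T₀)) h1)
  rw [single_mul_single_neg, inv_smul_smul₀ (ε.ne_zero _ _)] at h2
  exact eq_top_iff.mpr fun x _ => by simpa using I.mul_mem_left x 1 h2

/-- Over an algebraically closed field, a twisted group algebra of a group of order `n²` with
nondegenerate commutator pairing is a matrix algebra. -/
theorem exists_algEquiv_matrix [CharZero L] [IsAlgClosed L] (hε : ε.Nondegenerate) {n : ℕ}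
    (hn : Fintype.card M = n ^ 2) :
    Nonempty (TwistedAlgebra ε ≃ₐ[L] Matrix (Fin n) (Fin n) L) := by
  have := isSimpleRing hε
  obtain ⟨k, hk, ⟨φ⟩⟩ := IsSimpleRing.exists_algEquiv_matrix_of_isAlgClosed L (TwistedAlgebra ε)
  have h₁ := φ.toLinearEquiv.finrank_eq
  rw [Module.finrank_matrix, Module.finrank_self, Fintype.card_fin, mul_one] at h₁
  have h₂ : Module.finrank L (TwistedAlgebra ε) = Fintype.card M :=
    Module.finrank_fintype_fun_eq_card L
  have : k = n := by
    apply Nat.pow_left_injective (n := 2) two_ne_zero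
    simp only
    rw [← hn, ← h₂, h₁, pow_two]
  subst this
  exact ⟨φ⟩

/-- In a matrix representation, the trace is `n` times the coefficient of the identity. -/
theorem trace_eq [CharZero L] (hε : ε.Nondegenerate) {n : ℕ}
    (φ : TwistedAlgebra ε →ₗ[L] Matrix (Fin n) (Fin n) L) (hmul : ∀ a b, φ (a * b) = φ a * φ b)
    (h1 : φ 1 = 1) (z : TwistedAlgebra ε) : (φ z).trace = n * (z : M → L) 0 := by
  have hsingle : ∀ T : M, T ≠ 0 → (φ (single ε T)).trace = 0 := by
    intro T hT
    obtain ⟨S, hS⟩ : ∃ S, ε S T ≠ ε T S := by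
      by_contra! h
      exact hT (hε T h)
    have h₁ : single ε S * single ε T * single ε (-S) =
        (ε S (-S) * (ε S T * (ε T S)⁻¹)) • single ε T := by
      ext R
      rw [conj_apply, smul_apply, single_apply]
      by_cases h : R = T
      · subst h; ring
      · rw [if_neg h]; ring
    have h₂ : single ε (-S) * single ε S = ε S (-S) • (1 : TwistedAlgebra ε) := by
      have := single_mul_single_neg (ε := ε) (-S)
      rw [neg_neg] at this
      rw [this, ε.neg_right S S]
      have h := ε.add_left (-S) S S
      rw [neg_add_cancel, ε.zero_left] at h
      rw [eq_inv_of_mul_eq_one_left h.symm]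
    have h₃ := congrArg (fun a => (φ a).trace) h₁
    simp only [hmul, map_smul, Matrix.trace_smul] at h₃
    rw [Matrix.mul_assoc, Matrix.trace_mul_comm, Matrix.mul_assoc, ← hmul, h₂, map_smul, h1,
      Matrix.mul_smul, Matrix.mul_one, Matrix.trace_smul, smul_eq_mul, smul_eq_mul, mul_assoc] at h₃
    have h₄ := mul_left_cancel₀ (ε.ne_zero _ _) h₃
    by_contra hne
    have := (mul_eq_right₀ hne).mp h₄.symm
    rw [mul_inv_eq_one₀ (ε.ne_zero _ _)] at this
    exact hS this
  have hz : z = ∑ T : M, (z : M → L) T • single ε T := by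
    ext R
    refine Eq.trans ?_ (Finset.sum_apply R Finset.univ (fun T => ((z : M → L) T • single ε T :
      TwistedAlgebra ε))).symm
    rw [Finset.sum_eq_single R]
    · rw [smul_apply, single_apply, if_pos rfl, mul_one]
    · intro T _ hT
      rw [smul_apply, single_apply, if_neg hT.symm, mul_zero]
    · simp
  conv_lhs => rw [hz]
  rw [map_sum, Matrix.trace_sum, Finset.sum_eq_single 0]
  · rw [map_smul, ← one_def, h1, Matrix.trace_smul, Matrix.trace_one, Fintype.card_fin, smul_eq_mul,
      mul_comm]
  · intro T _ hT
    rw [map_smul, Matrix.trace_smul, hsingle T hT, smul_zero]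
  · simp

end TwistedAlgebra

end

/-! ### The constituent fields of `R` -/

section

open WeierstrassCurve.Affine IsDedekindDomain

section Orbits

variable {E : WeierstrassCurve ℚ} {n : ℕ}

lemma coe_smul (σ : GalQ) (T : Torsion E n) : (σ • T).1 = conjPoint (V := E.toAffine) σ T.1 := rfl

lemma mem_of_forall_fixing (K : IntermediateField ℚ QBar) {x : QBar}
    (h : ∀ σ : GalQ, (∀ y ∈ K, σ y = y) → σ x = x) : x ∈ K := by
  rw [← InfiniteGalois.fixedField_fixingSubgroup K, IntermediateField.mem_fixedField_iff]
  intro σ hσ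
  exact h σ ((IntermediateField.mem_fixingSubgroup_iff K σ).mp hσ)

lemma smul_eq_self_iff (σ : GalQ) (T : Torsion E n) :
    σ • T = T ↔ ∀ x ∈ fieldOfDefinition E T.1, σ x = x := by
  rw [← Subtype.coe_inj, coe_smul]
  rcases T with ⟨_ | ⟨x, y, h⟩, hT⟩
  · refine ⟨fun _ x hx => ?_, fun _ => rfl⟩
    obtain ⟨q, rfl⟩ := IntermediateField.mem_bot.mp hx
    exact σ.commutes q
  · constructor
    · intro e z hz
      have e' : Point.some (W' := E.toAffine⁄QBar) (σ x) (σ y) _ = Point.some x y h := e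
      obtain ⟨hx, hy⟩ := Point.some.inj e'
      have hle : IntermediateField.adjoin ℚ {x, y} ≤
          IntermediateField.fixedField (Subgroup.zpowers σ) := by
        rw [IntermediateField.adjoin_le_iff]
        rintro w (rfl | rfl)
        all_goals
          rw [SetLike.mem_coe, IntermediateField.mem_fixedField_iff]
          intro τ hτ
          rw [← AlgEquiv.smul_def, ← MulAction.mem_stabilizer_iff]
          refine (Subgroup.zpowers_le.mpr ?_) hτ
          rw [MulAction.mem_stabilizer_iff, AlgEquiv.smul_def]
          assumption
      exact (IntermediateField.mem_fixedField_iff _ _).mp (hle hz) σ (Subgroup.mem_zpowers σ)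
    · intro hfix
      have hx := hfix x (IntermediateField.subset_adjoin ℚ _ (by simp))
      have hy := hfix y (IntermediateField.subset_adjoin ℚ _ (by simp))
      change Point.some (W' := E.toAffine⁄QBar) (σ x) (σ y) _ = Point.some x y h
      exact (Point.some.injEq _ _ _ _ _ _).mpr ⟨hx, hy⟩

/-- The value of an equivariant map at `T` lies in the field of definition of `T`. -/
lemma apply_mem_fieldOfDefinition (z : R E n) (T : Torsion E n) :
    z T ∈ fieldOfDefinition E T.1 :=
  mem_of_forall_fixing _ fun σ hσ => by
    rw [← z.2 σ T, (smul_eq_self_iff σ T).mpr hσ]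

/-- The embedding of a subfield of `ℚ̄` given by an automorphism of `ℚ̄`. -/
def restrictEmbedding (K : IntermediateField ℚ QBar) (σ : GalQ) : K →+* QBar :=
  (σ : QBar →+* QBar).comp (algebraMap K QBar)

lemma exists_extension {K : IntermediateField ℚ QBar} (f : K →+* QBar) :
    ∃ σ : GalQ, restrictEmbedding K σ = f := by
  let _ : Algebra ℚ K := K.algebra'
  obtain ⟨φ, hφ⟩ := IsAlgClosed.surjective_domRestrict_of_isAlgebraic (K := ℚ) (L := K)
    (E := QBar) f.toRatAlgHom
  refine ⟨AlgEquiv.ofBijective φ (Algebra.IsAlgebraic.algHom_bijective φ), ?_⟩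
  ext x
  exact DFunLike.congr_fun hφ x

variable (E n) in
/-- The Galois orbits on `E[n]`. -/
abbrev Orbits : Type := MulAction.orbitRel.Quotient GalQ (Torsion E n)

/-- The chosen representative of an orbit. -/
abbrev Orbits.rep (o : Orbits E n) : Torsion E n := Quotient.out o

/-- The constituent field of `R` that belongs to an orbit. -/
abbrev orbitField (o : Orbits E n) : IntermediateField ℚ QBar := fieldOfDefinition E o.rep.1

lemma smul_rep_inj {o : Orbits E n} {σ τ : GalQ} : σ • o.rep = τ • o.rep ↔
    restrictEmbedding (orbitField o) σ = restrictEmbedding (orbitField o) τ := by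
  rw [← inv_smul_eq_iff, ← mul_smul, smul_eq_self_iff, DFunLike.ext_iff]
  constructor
  · intro h x
    have := congrArg τ (h x x.2)
    rw [← AlgEquiv.mul_apply, mul_inv_cancel_left] at this
    exact this
  · intro h x hx
    have h' : σ x = τ x := h ⟨x, hx⟩
    rw [AlgEquiv.mul_apply, h', ← AlgEquiv.mul_apply, inv_mul_cancel, AlgEquiv.one_apply]

lemma mk_smul_rep (o : Orbits E n) (σ : GalQ) :
    (Quotient.mk (MulAction.orbitRel GalQ (Torsion E n)) (σ • o.rep)) = o := by
  conv_rhs => rw [← Quotient.out_eq o]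
  exact Quotient.sound ⟨σ, rfl⟩

variable (E n) in
/-- The points of `E[n]` correspond to the embeddings of the constituent fields: `σ • T`, for `T`
the representative of an orbit, corresponds to the restriction of `σ` to `ℚ(T)`. -/
def embeddingEquiv : (Σ o : Orbits E n, orbitField o →+* QBar) ≃ Torsion E n :=
  Equiv.ofBijective (fun p => (exists_extension p.2).choose • p.1.rep) <| by
    constructor
    · rintro ⟨o, f⟩ ⟨o', f'⟩ h
      simp only at h
      have ho : o = o' := by
        rw [← mk_smul_rep o (exists_extension f).choose, h, mk_smul_rep]
      subst ho
      rw [smul_rep_inj, (exists_extension f).choose_spec, (exists_extension f').choose_spec] at h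
      rw [h]
    · intro T
      obtain ⟨σ, hσ⟩ : ∃ σ : GalQ, σ • (Orbits.rep (Quotient.mk _ T)) = T :=
        Quotient.exact (s := MulAction.orbitRel GalQ (Torsion E n))
          (Quotient.out_eq (Quotient.mk (MulAction.orbitRel GalQ (Torsion E n)) T)).symm
      refine ⟨⟨Quotient.mk _ T, restrictEmbedding _ σ⟩, ?_⟩
      refine Eq.trans ?_ hσ
      rw [smul_rep_inj]
      exact (exists_extension _).choose_spec

lemma embeddingEquiv_comp_val (o : Orbits E n) (σ : GalQ) :
    embeddingEquiv E n ⟨o, restrictEmbedding (orbitField o) σ⟩ = σ • o.rep := by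
  change (exists_extension _).choose • o.rep = σ • o.rep
  rw [smul_rep_inj]
  exact (exists_extension _).choose_spec

lemma smul_embeddingEquiv (o : Orbits E n) (f : orbitField o →+* QBar) (σ : GalQ) :
    σ • embeddingEquiv E n ⟨o, f⟩ = embeddingEquiv E n ⟨o, (σ : QBar →+* QBar).comp f⟩ := by
  obtain ⟨τ, rfl⟩ := exists_extension f
  rw [embeddingEquiv_comp_val, ← mul_smul]
  exact (embeddingEquiv_comp_val o (σ * τ)).symm

variable (E n) in
/-- The algebra `R` is the product of its constituent fields. -/
def etaleEquiv : R E n ≃+* (∀ o : Orbits E n, orbitField o) :=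
  RingEquiv.ofBijective
    ({ toFun := fun z o => ⟨z o.rep, apply_mem_fieldOfDefinition z o.rep⟩
       map_one' := rfl
       map_mul' := fun _ _ => rfl
       map_zero' := rfl
       map_add' := fun _ _ => rfl } : R E n →+* (∀ o : Orbits E n, orbitField o)) <| by
    constructor
    · intro z w h
      apply Subtype.ext
      funext T
      obtain ⟨⟨o, f⟩, rfl⟩ := (embeddingEquiv E n).surjective T
      obtain ⟨σ, rfl⟩ := exists_extension f
      rw [embeddingEquiv_comp_val, z.2, w.2]
      exact congrArg σ (congrArg Subtype.val (congrFun h o))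
    · intro k
      refine ⟨⟨fun T => ((embeddingEquiv E n).symm T).2 (k ((embeddingEquiv E n).symm T).1), ?_⟩,
        ?_⟩
      · intro σ T
        obtain ⟨⟨o, f⟩, rfl⟩ := (embeddingEquiv E n).surjective T
        beta_reduce
        rw [smul_embeddingEquiv, Equiv.symm_apply_apply, Equiv.symm_apply_apply]
        rfl
      · funext o
        apply Subtype.ext
        have h : o.rep = embeddingEquiv E n ⟨o, algebraMap (orbitField o) QBar⟩ := by
          have := embeddingEquiv_comp_val o 1
          rw [one_smul] at this
          exact this.symm
        change ((embeddingEquiv E n).symm o.rep).2 (k ((embeddingEquiv E n).symm o.rep).1) = _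
        rw [h, Equiv.symm_apply_apply]
        rfl

lemma apply_embeddingEquiv (z : R E n) (o : Orbits E n) (f : orbitField o →+* QBar) :
    z (embeddingEquiv E n ⟨o, f⟩) = f (etaleEquiv E n z o) := by
  obtain ⟨σ, rfl⟩ := exists_extension f
  rw [embeddingEquiv_comp_val, z.2]
  rfl

end Orbits

end

/-! ### Rings of integers of products of number fields -/

section

open NumberField

section Product

variable {A : Type*} [CommRing A] {Ω : Type*} [Fintype Ω] [DecidableEq Ω] {K : Ω → Type*}
  [∀ o, Field (K o)] [∀ o, NumberField (K o)] (Φ : A ≃+* (∀ o, K o))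

include Φ in
lemma isTorsionFree_int_of_ringEquiv : Module.IsTorsionFree ℤ A :=
  (Φ.injective).moduleIsTorsionFree _ fun k x => map_zsmul Φ k x

lemma isIntegral_iff_forall {x : A} : IsIntegral ℤ x ↔ ∀ o, IsIntegral ℤ (Φ x o) := by
  constructor
  · intro h o
    exact map_isIntegral_int ((Pi.evalRingHom K o).comp Φ.toRingHom) h
  · intro h
    choose p hp hpx using h
    refine ⟨∏ o, p o, Polynomial.monic_prod_of_monic _ _ fun o _ => hp o, ?_⟩
    apply Φ.injective
    funext o
    have h₁ := Polynomial.hom_eval₂ (∏ o, p o) (algebraMap ℤ A)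
      ((Pi.evalRingHom K o).comp Φ.toRingHom) x
    have h₂ : ((Pi.evalRingHom K o).comp Φ.toRingHom).comp (algebraMap ℤ A) = algebraMap ℤ (K o) :=
      RingHom.ext_int _ _
    rw [h₂] at h₁
    exact h₁.trans ((Polynomial.eval₂_finsetProd _ _ _ _).trans <|
      (Finset.prod_eq_zero (Finset.mem_univ o) (hpx o)).trans (congrFun (map_zero Φ) o).symm)

/-- The ring of integers of a product of number fields is the product of the rings of integers. -/
def integralClosureEquiv : integralClosure ℤ A ≃+* (∀ o, 𝓞 (K o)) where
  toFun x o := ⟨Φ x o, (isIntegral_iff_forall Φ).mp x.2 o⟩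
  invFun y := ⟨Φ.symm fun o => (y o : K o), (isIntegral_iff_forall Φ).mpr fun o => by
    rw [RingEquiv.apply_symm_apply]; exact (y o).2⟩
  left_inv x := Subtype.ext (Φ.symm_apply_apply _)
  right_inv y := by
    funext o
    apply Subtype.ext
    exact congrFun (Φ.apply_symm_apply fun o => (y o : K o)) o
  map_mul' x y := by
    funext o
    apply Subtype.ext
    change Φ (x * y : A) o = _
    rw [map_mul]; rfl
  map_add' x y := by
    funext o
    apply Subtype.ext
    change Φ (x + y : A) o = _
    rw [map_add]; rfl

/-- The integral basis of a product of number fields obtained from those of the factors. -/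
def productIntegralBasis :
    Module.Basis (Σ o, Module.Free.ChooseBasisIndex ℤ (𝓞 (K o))) ℤ (integralClosure ℤ A) :=
  (Pi.basis fun o => RingOfIntegers.basis (K o)).map
    (integralClosureEquiv Φ).symm.toAddEquiv.toIntLinearEquiv

lemma productIntegralBasis_apply (o : Ω) (i : Module.Free.ChooseBasisIndex ℤ (𝓞 (K o))) (o' : Ω) :
    Φ (productIntegralBasis Φ ⟨o, i⟩ : integralClosure ℤ A) o' =
      ((Pi.single o (RingOfIntegers.basis (K o) i) : ∀ o, 𝓞 (K o)) o' : K o') := by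
  have h : (productIntegralBasis Φ ⟨o, i⟩ : integralClosure ℤ A) = (integralClosureEquiv Φ).symm
      (Pi.single o (RingOfIntegers.basis (K o) i)) := by
    rw [productIntegralBasis, Module.Basis.map_apply, Pi.basis_apply]; rfl
  have h₂ := congrFun ((integralClosureEquiv Φ).apply_symm_apply
    (Pi.single o (RingOfIntegers.basis (K o) i))) o'
  rw [← h] at h₂
  exact congrArg Subtype.val h₂

include Φ in
lemma moduleFinite_integralClosure : Module.Finite ℤ (integralClosure ℤ A) :=
  Module.Finite.of_basis (productIntegralBasis Φ)

include Φ in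
lemma exists_int_smul_mem_integralClosure (x : A) :
    ∃ k : ℤ, k ≠ 0 ∧ k • x ∈ integralClosure ℤ A := by
  have h : ∀ o, ∃ k : ℤ, k ≠ 0 ∧ IsIntegral ℤ (k • Φ x o) := fun o => by
    have : IsAlgebraic ℤ (Φ x o) :=
      (IsFractionRing.isAlgebraic_iff ℤ ℚ (K o)).mpr (Algebra.IsAlgebraic.isAlgebraic (Φ x o))
    obtain ⟨k, hk, h⟩ := this.exists_integral_multiple
    exact ⟨k, hk, h⟩
  choose k hk hint using h
  refine ⟨∏ o, k o, Finset.prod_ne_zero_iff.mpr fun o _ => hk o, ?_⟩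
  refine (isIntegral_iff_forall Φ).mpr fun o => ?_
  rw [map_zsmul, Pi.smul_apply, ← Finset.prod_erase_mul _ _ (Finset.mem_univ o), mul_smul]
  exact (hint o).smul _

/-- The inclusion of a factor into a product of fields, as a map of non-unital rings. -/
def factorInclusion (o : Ω) (x : K o) : A := Φ.symm (Pi.single o x)

lemma apply_factorInclusion (o : Ω) (x : K o) : Φ (factorInclusion Φ o x) = Pi.single o x :=
  Φ.apply_symm_apply _

lemma factorInclusion_mul (o : Ω) (x : K o) (z : A) :
    factorInclusion Φ o x * z = factorInclusion Φ o (x * Φ z o) := by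
  apply Φ.injective
  rw [map_mul, apply_factorInclusion, apply_factorInclusion]
  funext o'
  rw [Pi.mul_apply]
  by_cases h : o' = o
  · subst h; rw [Pi.single_eq_same, Pi.single_eq_same]
  · rw [Pi.single_eq_of_ne h, Pi.single_eq_of_ne h, zero_mul]

lemma factorInclusion_add (o : Ω) (x y : K o) :
    factorInclusion Φ o (x + y) = factorInclusion Φ o x + factorInclusion Φ o y := by
  rw [factorInclusion, Pi.single_add, map_add]; rfl

lemma factorInclusion_mem {o : Ω} {x : K o} (hx : IsIntegral ℤ x) :
    factorInclusion Φ o x ∈ integralClosure ℤ A := by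
  refine (isIntegral_iff_forall Φ).mpr fun o' => ?_
  rw [apply_factorInclusion]
  by_cases h : o' = o
  · subst h; rwa [Pi.single_eq_same]
  · rw [Pi.single_eq_of_ne h]; exact isIntegral_zero

lemma sum_factorInclusion_one : ∑ o, factorInclusion Φ o (1 : K o) = 1 := by
  apply Φ.injective
  rw [map_sum, map_one]
  simp only [apply_factorInclusion]
  funext o
  rw [Finset.sum_apply, Finset.sum_eq_single o]
  · rw [Pi.single_eq_same]; rfl
  · intro o' _ h
    rw [Pi.single_eq_of_ne h.symm]
  · simp

lemma mem_one_integralClosure {x : A} :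
    x ∈ (1 : Submodule (integralClosure ℤ A) A) ↔ x ∈ integralClosure ℤ A := by
  rw [Submodule.mem_one]
  exact ⟨fun ⟨y, hy⟩ => hy ▸ y.2, fun h => ⟨⟨x, h⟩, rfl⟩⟩

/-- A submodule of a product of number fields over its ring of integers is invertible if it has
bounded denominators and meets every factor: its factors are invertible fractional ideals. -/
theorem mul_one_div_eq_one {N : Submodule (integralClosure ℤ A) A}
    {k : ℤ} (hk : k ≠ 0) (hkN : ∀ x ∈ N, k • x ∈ integralClosure ℤ A)
    (hN : ∀ o, ∃ x ∈ N, Φ x o ≠ 0) : N * (1 / N) = 1 := by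
  refine le_antisymm Submodule.mul_one_div_le_one ?_
  rw [Submodule.one_le, ← sum_factorInclusion_one Φ]
  refine sum_mem fun o _ => ?_
  -- the `o`-th factor of `N`, as a fractional ideal
  have hsmul : ∀ (a : 𝓞 (K o)) (x : K o), factorInclusion Φ o (a • x) =
      (⟨factorInclusion Φ o (a : K o), factorInclusion_mem Φ a.2⟩ : integralClosure ℤ A) •
        factorInclusion Φ o x := fun a x => by
    rw [Algebra.smul_def]
    change _ = factorInclusion Φ o (a : K o) * factorInclusion Φ o x
    rw [factorInclusion_mul, apply_factorInclusion, Pi.single_eq_same]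
  let No : Submodule (𝓞 (K o)) (K o) :=
    { carrier := {x | factorInclusion Φ o x ∈ N}
      add_mem' := fun hx hy => by
        rw [Set.mem_ofPred_eq, factorInclusion_add]; exact add_mem hx hy
      zero_mem' := by
        rw [Set.mem_ofPred_eq, factorInclusion, Pi.single_zero, map_zero]; exact zero_mem N
      smul_mem' := fun a x hx => by
        rw [Set.mem_ofPred_eq, hsmul]; exact N.smul_mem _ hx }
  have hproj : ∀ x ∈ N, Φ x o ∈ No := by
    intro x hx
    change factorInclusion Φ o (Φ x o) ∈ N
    rw [← one_mul (Φ x o), ← factorInclusion_mul]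
    exact N.smul_mem ⟨_, factorInclusion_mem Φ isIntegral_one⟩ hx
  have hfrac : IsFractional (𝓞 (K o))⁰ No := by
    refine ⟨(k : 𝓞 (K o)), mem_nonZeroDivisors_of_ne_zero (by exact_mod_cast hk), fun x hx => ?_⟩
    have h := (isIntegral_iff_forall Φ).mp (hkN _ hx) o
    rw [map_zsmul, apply_factorInclusion, Pi.smul_apply, Pi.single_eq_same] at h
    refine ⟨⟨_, h⟩, ?_⟩
    refine (zsmul_eq_mul x k).trans ?_
    rw [Algebra.smul_def, map_intCast]
  let I : FractionalIdeal (𝓞 (K o))⁰ (K o) := ⟨No, hfrac⟩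
  have hI : I ≠ 0 := by
    obtain ⟨x, hx, hx0⟩ := hN o
    intro h
    have : Φ x o ∈ I := hproj x hx
    rw [h, FractionalIdeal.mem_zero_iff] at this
    exact hx0 this
  have hmul : ∀ t ∈ I * I⁻¹, factorInclusion Φ o t ∈ N * (1 / N) := by
    intro t ht
    refine FractionalIdeal.mul_induction_on ht (fun x hx y hy => ?_) fun x y hx hy => ?_
    · have e : factorInclusion Φ o (x * y) = factorInclusion Φ o x * factorInclusion Φ o y := by
        rw [factorInclusion_mul, apply_factorInclusion, Pi.single_eq_same]
      rw [e]
      refine Submodule.mul_mem_mul hx (Submodule.mem_div_iff_forall_mul_mem.mpr fun z hz => ?_)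
      rw [factorInclusion_mul, mem_one_integralClosure]
      have h := (FractionalIdeal.mem_inv_iff hI).mp hy (Φ z o) (hproj z hz)
      obtain ⟨a, ha⟩ := (FractionalIdeal.mem_one_iff _).mp h
      rw [← ha]
      exact factorInclusion_mem Φ a.2
    · rw [factorInclusion_add]; exact add_mem hx hy
  apply hmul
  rw [mul_inv_cancel₀ hI]
  exact FractionalIdeal.one_mem_one _

end Product

/-! ### Discriminants of lattices -/

section Lattices

variable {A : Type*} [CommRing A]

/-- Tensoring with an invertible module preserves the finite ring `O / b`, as the Picard group of
a finite ring is trivial. -/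
lemma card_quotient_smul_top {O : Type*} [CommRing O] [Algebra O A] [FaithfulSMul O A]
    (b : Ideal O) [Finite (O ⧸ b)] (I : (Submodule O A)ˣ) :
    Nat.card (I ⧸ (b • ⊤ : Submodule O I)) = Nat.card (O ⧸ b) := by
  have h : Module.Invertible (O ⧸ b) ((O ⧸ b) ⊗[O] I) := inferInstance
  have : Finite (MaximalSpectrum (O ⧸ b)) :=
    Finite.of_injective (fun p => p.asIdeal) fun p q h => MaximalSpectrum.ext h
  obtain ⟨e⟩ := Module.Invertible.free_iff_linearEquiv.mp
    (inferInstance : Module.Free (O ⧸ b) ((O ⧸ b) ⊗[O] I))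
  rw [← Nat.card_congr e.toEquiv]
  exact Nat.card_congr (TensorProduct.quotTensorEquivQuotSMul I b).symm.toEquiv

variable {L : Type*} [Field L] {ι : Type*} [Fintype ι] [DecidableEq ι]

/-- The squared determinant of the values of a family under a family of ring homomorphisms. -/
def discOf (ev : ι → A →+* L) (r : ι → A) : L := (Matrix.of fun i j => ev j (r i)).det ^ 2

lemma discOf_mul (ev : ι → A →+* L) (x : A) (r : ι → A) :
    discOf ev (fun i => x * r i) = (∏ j, ev j x) ^ 2 * discOf ev r := by
  rw [discOf, discOf, ← mul_pow, ← Matrix.det_mul_row]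
  simp only [map_mul, Matrix.of_apply]

/-- The discriminants of a lattice and of a sublattice differ by the square of the index. -/
lemma discOf_eq_of_basis (ev : ι → A →+* L) {N N' : Submodule ℤ A} (hle : N' ≤ N)
    (r : Module.Basis ι ℤ N) (r' : Module.Basis ι ℤ N') :
    discOf ev (fun i => (r' i : A)) =
      (N'.toAddSubgroup.relIndex N.toAddSubgroup : L) ^ 2 * discOf ev (fun i => (r i : A)) := by
  have h := AddSubgroup.relIndex_eq_natAbs_det N'.toAddSubgroup N.toAddSubgroup hle r' r
  have hc : (N'.toAddSubgroup.relIndex N.toAddSubgroup : L) ^ 2 =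
      ((r.toMatrix fun i => ⟨r' i, hle (r' i).2⟩).det : L) ^ 2 := by
    have h₂ : ((N'.toAddSubgroup.relIndex N.toAddSubgroup : ℤ)) ^ 2 =
        (r.toMatrix fun i => ⟨r' i, hle (r' i).2⟩).det ^ 2 := by
      rw [h]; exact Int.natAbs_sq _
    exact_mod_cast congrArg (Int.cast : ℤ → L) h₂
  rw [hc, discOf, discOf, ← mul_pow, ← Matrix.det_transpose
    (r.toMatrix fun i => (⟨r' i, hle (r' i).2⟩ : N)),
    show ∀ k : ℤ, (k : L) = Int.castRingHom L k from fun _ => rfl, RingHom.map_det,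
    ← Matrix.det_mul]
  congr 2
  ext i j
  rw [Matrix.mul_apply]
  simp only [Matrix.of_apply, RingHom.mapMatrix_apply, Matrix.map_apply, Matrix.transpose_apply]
  have hs := congrArg Subtype.val (r.sum_toMatrix_smul_self (fun i => (⟨r' i, hle (r' i).2⟩ : N)) i)
  refine (congrArg (ev j) hs).symm.trans ?_
  rw [AddSubmonoidClass.coe_finsetSum, map_sum]
  refine Finset.sum_congr rfl fun k _ => ?_
  rw [Submodule.coe_smul, map_zsmul, zsmul_eq_mul]
  rfl

end Lattices

end

/-! ### Invertible submodules and `n`-th powers -/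

section

open NumberField

section Invertible

variable {A : Type*} [CommRing A] {Ω : Type*} [Fintype Ω] [DecidableEq Ω] {K : Ω → Type*}
  [∀ o, Field (K o)] [∀ o, NumberField (K o)] (Φ : A ≃+* (∀ o, K o))

include Φ in
lemma exists_int_smul_mem_of_fg {N : Submodule (integralClosure ℤ A) A} (hN : N.FG) :
    ∃ k : ℤ, k ≠ 0 ∧ ∀ x ∈ N, k • x ∈ integralClosure ℤ A := by
  classical
  obtain ⟨s, rfl⟩ := hN
  choose k hk h using exists_int_smul_mem_integralClosure Φ
  refine ⟨∏ x ∈ s, k x, Finset.prod_ne_zero_iff.mpr fun x _ => hk x, fun x hx => ?_⟩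
  induction hx using Submodule.span_induction with
  | mem x hx =>
    rw [← Finset.prod_erase_mul _ _ hx, mul_smul]
    exact zsmul_mem (h x) _
  | zero => rw [smul_zero]; exact zero_mem _
  | add x y _ _ hx hy => rw [smul_add]; exact add_mem hx hy
  | smul a x _ hx =>
    rw [smul_comm]
    exact mul_mem a.2 hx

lemma mul_coeSubmodule_eq_smul {O : Type*} [CommRing O] [Algebra O A] (b : Ideal O)
    (N : Submodule O A) : IsLocalization.coeSubmodule A b * N = b • N := by
  apply le_antisymm
  · rw [Submodule.mul_le]
    rintro _ ⟨x, hx, rfl⟩ y hy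
    rw [Algebra.linearMap_apply, ← Algebra.smul_def]
    exact Submodule.smul_mem_smul hx hy
  · rw [Submodule.smul_le]
    intro x hx y hy
    rw [Algebra.smul_def]
    exact Submodule.mul_mem_mul ⟨x, hx, rfl⟩ hy

lemma coeSubmodule_pow {O : Type*} [CommRing O] [Algebra O A] (b : Ideal O) (n : ℕ) :
    IsLocalization.coeSubmodule A (b ^ n) = IsLocalization.coeSubmodule A b ^ n := by
  induction n with
  | zero => rw [pow_zero, pow_zero, Ideal.one_eq_top, IsLocalization.coeSubmodule_top]
  | succ n ih => rw [pow_succ, pow_succ, IsLocalization.coeSubmodule_mul, ih]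

lemma coeSubmodule_injective' {O : Type*} [CommRing O] [Algebra O A] [FaithfulSMul O A] :
    Function.Injective (IsLocalization.coeSubmodule A : Ideal O → Submodule O A) :=
  Submodule.map_injective_of_injective (FaithfulSMul.algebraMap_injective O A)

lemma exists_coeSubmodule_eq {O : Type*} [CommRing O] [Algebra O A] {N : Submodule O A}
    (h : N ≤ 1) : ∃ b : Ideal O, IsLocalization.coeSubmodule A b = N := by
  refine ⟨N.comap (Algebra.linearMap O A), ?_⟩
  rw [IsLocalization.coeSubmodule, Submodule.map_comap_eq, ← Submodule.one_eq_range]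
  exact inf_eq_right.mpr h

lemma natCast_submodule_le_one {O : Type*} [CommRing O] [Algebra O A] (k : ℕ) :
    (k : Submodule O A) ≤ 1 := by
  induction k with
  | zero => rw [Nat.cast_zero]; exact bot_le
  | succ k ih => rw [Nat.cast_succ, Submodule.add_eq_sup]; exact sup_le ih le_rfl

lemma sup_pow_le {O : Type*} [CommRing O] [Algebra O A] {M N X : Submodule O A} (n : ℕ)
    (h : ∀ i ≤ n, M ^ i * N ^ (n - i) ≤ X) : (M ⊔ N) ^ n ≤ X := by
  rw [← Submodule.add_eq_sup, add_pow]
  refine Finset.sum_induction _ (· ≤ X) (fun a b ha hb => ?_) bot_le fun i hi => ?_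
  · rw [Submodule.add_eq_sup]; exact sup_le ha hb
  · have h₁ := h i (by rw [Finset.mem_range] at hi; omega)
    calc M ^ i * N ^ (n - i) * (n.choose i : Submodule O A)
        ≤ M ^ i * N ^ (n - i) * 1 := mul_le_mul' le_rfl (natCast_submodule_le_one _)
      _ ≤ X := by rwa [mul_one]

include Φ in
/-- If `(α) = b c^n` and `b` is not divisible by the `n`-th power of a prime, every `z` for which
`z^n α` is integral lies in `c⁻¹`.  Here `c'` stands for `c⁻¹`: the submodule `J` generated by `z`
and `c'` satisfies `α J^n ⊆ O`, so that the inverse of `J c` is an integral ideal with `n`-th power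
dividing `b`. -/
theorem mem_of_pow_mul_isIntegral {n : ℕ} (hn : n ≠ 0)
    {b : Ideal (integralClosure ℤ A)} {c c' : Submodule (integralClosure ℤ A) A} (hcc : c * c' = 1)
    {α : A} (hα : IsLocalization.coeSubmodule A b * c ^ n = Submodule.span _ {α})
    (hfree : ∀ p : Ideal (integralClosure ℤ A), p.IsPrime → ¬ p ^ n ∣ b) {z : A}
    (hz : IsIntegral ℤ (z ^ n * α)) : z ∈ c' := by
  set b' := IsLocalization.coeSubmodule A b
  set J := Submodule.span (integralClosure ℤ A) {z} ⊔ c'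
  have hb1 : b' ≤ 1 := by
    rw [Submodule.one_eq_range]; exact LinearMap.map_le_range
  have hccn : c ^ n * c' ^ n = 1 := by rw [← mul_pow, hcc, one_pow]
  have hb' : b' = Submodule.span (integralClosure ℤ A) {α} * c' ^ n := by
    rw [← hα, mul_assoc, hccn, mul_one]
  -- `α` times the `n`-th power of `J` is integral
  have hJ : Submodule.span (integralClosure ℤ A) {α} * J ^ n ≤ 1 := by
    have : J ^ n ≤ 1 / Submodule.span (integralClosure ℤ A) {α} := by
      refine sup_pow_le n fun i hi => ?_
      rw [Submodule.span_pow, Set.singleton_pow, Submodule.le_div_iff_mul_le, mul_assoc,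
        Submodule.mul_le]
      intro x hx y hy
      obtain ⟨a, rfl⟩ := Submodule.mem_span_singleton.mp hx
      obtain ⟨y, hy', rfl⟩ := Submodule.mem_mul_span_singleton.mp hy
      rw [smul_mul_assoc]
      refine Submodule.smul_mem _ _ (mem_one_integralClosure.mpr ?_)
      refine IsIntegral.of_pow (Nat.pos_of_ne_zero hn) ?_
      have h₁ : (z ^ i * (y * α)) ^ n = (z ^ n * α) ^ i * (α ^ (n - i) * y ^ n) := by
        have : α ^ n = α ^ i * α ^ (n - i) := by rw [← pow_add, Nat.add_sub_cancel' hi]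
        rw [mul_pow, mul_pow, mul_pow, this]
        ring
      rw [h₁]
      refine (hz.pow i).mul ?_
      have h₂ : α ^ (n - i) * y ^ n ∈ b' ^ (n - i) := by
        rw [hb', mul_pow, Submodule.span_pow, Set.singleton_pow, ← pow_mul, mul_comm n (n - i),
          pow_mul]
        exact Submodule.mul_mem_mul (Submodule.mem_span_singleton_self _)
          (Submodule.pow_mem_pow _ hy' n)
      exact mem_one_integralClosure.mp ((pow_le_one' hb1 (n - i)) h₂)
    calc _ ≤ Submodule.span (integralClosure ℤ A) {α} *
          (1 / Submodule.span (integralClosure ℤ A) {α}) := mul_le_mul' le_rfl this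
      _ ≤ 1 := Submodule.mul_one_div_le_one
  -- the submodule `N = J c` contains `1` and is invertible
  set N := J * c
  have hc'N : (1 : Submodule (integralClosure ℤ A) A) ≤ N := by
    rw [← hcc, mul_comm c c']
    exact mul_le_mul' le_sup_right le_rfl
  have hNb : b' * N ^ n ≤ 1 := by
    have : b' * N ^ n = Submodule.span (integralClosure ℤ A) {α} * J ^ n := by
      rw [mul_pow, ← hα]; ring
    rwa [this]
  have hfg : N.FG := by
    have hc' : c'.FG := Submodule.fg_unit (Units.mkOfMulEqOne c' c (by rw [mul_comm]; exact hcc))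
    have hc : c.FG := Submodule.fg_unit (Units.mkOfMulEqOne c c' hcc)
    exact ((Submodule.fg_span_singleton z).sup hc').mul hc
  obtain ⟨k, hk, hkN⟩ := exists_int_smul_mem_of_fg Φ hfg
  have hmeet : ∀ {X Y : Submodule (integralClosure ℤ A) A}, X * Y = 1 →
      ∀ o, ∃ x ∈ X, Φ x o ≠ 0 := by
    intro X Y h o
    by_contra! hX
    have : ∀ t ∈ X * Y, Φ t o = 0 := by
      intro t ht
      induction ht using Submodule.mul_induction_on' with
      | mem_mul_mem x hx y hy => rw [map_mul, Pi.mul_apply, hX x hx, zero_mul]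
      | add x _ y _ hx hy => rw [map_add, Pi.add_apply, hx, hy, add_zero]
    have h1 := this 1 (by rw [h]; exact Submodule.one_le.mp le_rfl)
    rw [map_one] at h1
    exact one_ne_zero h1
  have hN : N * (1 / N) = 1 := mul_one_div_eq_one Φ hk hkN fun o =>
    ⟨1, Submodule.one_le.mp hc'N, by rw [map_one]; exact one_ne_zero⟩
  set Q := 1 / N
  have hQ1 : Q ≤ 1 := by
    calc Q = 1 * Q := (one_mul _).symm
      _ ≤ N * Q := mul_le_mul' hc'N le_rfl
      _ = 1 := hN
  obtain ⟨q, hq⟩ := exists_coeSubmodule_eq hQ1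
  by_cases hqtop : q = ⊤
  · -- then `J c = O`
    have hQ : Q = 1 := by rw [← hq, hqtop, IsLocalization.coeSubmodule_top]
    have hN1 : N = 1 := by rw [← hN, hQ, mul_one]
    have : J = c' := by
      calc J = J * (c * c') := by rw [hcc, mul_one]
        _ = c' := by rw [← mul_assoc]; change N * c' = c'; rw [hN1, one_mul]
    rw [← this]
    exact Submodule.mem_sup_left (Submodule.mem_span_singleton_self z)
  · exfalso
    obtain ⟨p, hp, hqp⟩ := Ideal.exists_le_maximal q hqtop
    set P := IsLocalization.coeSubmodule A p
    have hQP : Q ≤ P := by rw [← hq]; exact IsLocalization.coeSubmodule_mono A hqp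
    have hP1 : P ≤ 1 := by rw [Submodule.one_eq_range]; exact LinearMap.map_le_range
    have hP : P * (1 / P) = 1 := by
      refine mul_one_div_eq_one Φ one_ne_zero (fun x hx => ?_) fun o => ?_
      · rw [one_smul]; exact mem_one_integralClosure.mp (hP1 hx)
      · obtain ⟨x, hx, hx0⟩ := hmeet (X := Q) (Y := N) (by rw [mul_comm]; exact hN) o
        exact ⟨x, hQP hx, hx0⟩
    have hQP' : Q * (1 / P) ≤ 1 := (mul_le_mul' hQP le_rfl).trans hP.le
    have hD : b' * N ^ n * (Q * (1 / P)) ^ n ≤ 1 :=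
      (mul_le_mul' hNb (pow_le_one' hQP' n)).trans (one_mul _).le
    obtain ⟨d, hd⟩ := exists_coeSubmodule_eq hD
    refine hfree p hp.isPrime ⟨d, coeSubmodule_injective' (A := A) ?_⟩
    rw [IsLocalization.coeSubmodule_mul, coeSubmodule_pow, hd]
    calc b' = b' * (N * Q) ^ n * (P * (1 / P)) ^ n := by rw [hN, hP, one_pow, mul_one, mul_one]
      _ = P ^ n * (b' * N ^ n * (Q * (1 / P)) ^ n) := by ring

end Invertible

end

/-! ### Discriminants of invertible modules -/

section

open NumberField

section Volume

variable {A : Type*} [CommRing A] {Ω : Type*} [Fintype Ω] [DecidableEq Ω] {K : Ω → Type*}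
  [∀ o, Field (K o)] [∀ o, NumberField (K o)] (Φ : A ≃+* (∀ o, K o))

include Φ in
lemma exists_int_smul_mem_of_isUnit {I : Submodule (integralClosure ℤ A) A} (hI : IsUnit I) :
    ∃ k : ℤ, k ≠ 0 ∧ ∀ x ∈ integralClosure ℤ A, k • x ∈ I := by
  obtain ⟨J, hJ⟩ := hI.exists_left_inv
  have hfg : J.FG := Submodule.fg_unit (Units.mkOfMulEqOne J I hJ)
  obtain ⟨k, hk, h⟩ := exists_int_smul_mem_of_fg Φ hfg
  refine ⟨k, hk, fun x hx => ?_⟩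
  have h₁ : ∀ t ∈ J * I, k • t ∈ I := by
    intro t ht
    induction ht using Submodule.mul_induction_on' with
    | mem_mul_mem y hy z hz =>
      rw [← smul_mul_assoc]
      exact I.smul_mem ⟨_, h y hy⟩ hz
    | add y _ z _ hy hz => rw [smul_add]; exact add_mem hy hz
  exact h₁ x (by rw [hJ]; exact mem_one_integralClosure.mpr hx)

include Φ in
lemma finite_quotient_of_isUnit {b : Ideal (integralClosure ℤ A)}
    (hb : IsUnit (IsLocalization.coeSubmodule A b)) : Finite (integralClosure ℤ A ⧸ b) := by
  obtain ⟨k, hk, h⟩ := exists_int_smul_mem_of_isUnit Φ hb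
  have := moduleFinite_integralClosure Φ
  have : Module.Finite ℤ (integralClosure ℤ A ⧸ b) :=
    Module.Finite.of_surjective ((Ideal.Quotient.mk b).toIntAlgHom.toLinearMap)
      Ideal.Quotient.mk_surjective
  refine Module.finite_of_fg_torsion _ fun x => ?_
  obtain ⟨x, rfl⟩ := Ideal.Quotient.mk_surjective x
  refine ⟨⟨k, mem_nonZeroDivisors_of_ne_zero hk⟩, ?_⟩
  change k • Ideal.Quotient.mk b x = 0
  rw [← map_zsmul, Ideal.Quotient.eq_zero_iff_mem]
  obtain ⟨y, hy, hyx⟩ := h x x.2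
  have : y = k • x := Subtype.ext hyx
  rwa [← this]

variable {L : Type*} [Field L] {ι : Type*} [Fintype ι] [DecidableEq ι]

/-- The lattice `N` has a `ℤ`-basis whose squared determinant of values is `d`. -/
def HasDisc (ev : ι → A →+* L) (N : Submodule (integralClosure ℤ A) A) (d : L) : Prop :=
  ∃ r : Module.Basis ι ℤ (N.restrictScalars ℤ), discOf ev (fun i => (r i : A)) = d

lemma HasDisc.discOf_eq {ev : ι → A →+* L} {N : Submodule (integralClosure ℤ A) A} {d : L}
    (h : HasDisc ev N d) (r : Module.Basis ι ℤ (N.restrictScalars ℤ)) :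
    discOf ev (fun i => (r i : A)) = d := by
  obtain ⟨r', hr'⟩ := h
  rw [discOf_eq_of_basis ev le_rfl r' r, hr', AddSubgroup.relIndex_self, Nat.cast_one, one_pow,
    one_mul]

lemma HasDisc.unique {ev : ι → A →+* L} {N : Submodule (integralClosure ℤ A) A} {d d' : L}
    (h : HasDisc ev N d) (h' : HasDisc ev N d') : d = d' := by
  obtain ⟨r, hr⟩ := h
  rw [← hr, h'.discOf_eq r]

lemma hasDisc_one (ev : ι → A →+* L) (w : Module.Basis ι ℤ (integralClosure ℤ A)) :
    HasDisc ev 1 (discOf ev fun i => (w i : A)) := by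
  let e : integralClosure ℤ A ≃ₗ[ℤ]
      ((1 : Submodule (integralClosure ℤ A) A).restrictScalars ℤ) :=
    { toFun := fun x => ⟨x, mem_one_integralClosure.mpr x.2⟩
      invFun := fun x => ⟨x, mem_one_integralClosure.mp x.2⟩
      left_inv := fun _ => rfl
      right_inv := fun _ => rfl
      map_add' := fun _ _ => rfl
      map_smul' := fun _ _ => rfl }
  exact ⟨w.map e, rfl⟩

lemma HasDisc.span_mul {ev : ι → A →+* L} {N : Submodule (integralClosure ℤ A) A} {d : L}
    (h : HasDisc ev N d) {x : A} (hx : IsUnit x) :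
    HasDisc ev (Submodule.span _ {x} * N) ((∏ j, ev j x) ^ 2 * d) := by
  obtain ⟨r, rfl⟩ := h
  have hmem : ∀ y, y ∈ Submodule.span (integralClosure ℤ A) {x} * N ↔ ∃ z ∈ N, x * z = y :=
    fun y => Submodule.mem_span_singleton_mul
  let f : N.restrictScalars ℤ →ₗ[ℤ]
      (Submodule.span (integralClosure ℤ A) {x} * N).restrictScalars ℤ :=
    { toFun := fun z => ⟨x * z, (hmem _).mpr ⟨z, z.2, rfl⟩⟩
      map_add' := fun y z => Subtype.ext (mul_add _ _ _)
      map_smul' := fun k z => Subtype.ext (mul_smul_comm _ _ _) }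
  have hf : Function.Bijective f := by
    refine ⟨fun y z h => Subtype.ext (hx.mul_left_cancel (congrArg Subtype.val h)), fun y => ?_⟩
    obtain ⟨z, hz, h⟩ := (hmem y).mp y.2
    exact ⟨⟨z, hz⟩, Subtype.ext h⟩
  exact ⟨r.map (LinearEquiv.ofBijective f hf), discOf_mul ev x _⟩

include Φ in
/-- An invertible module has the rank of the ring of integers, since each of them contains
a multiple of the other. -/
lemma exists_hasDisc (w : Module.Basis ι ℤ (integralClosure ℤ A)) (ev : ι → A →+* L)
    {I : Submodule (integralClosure ℤ A) A} (hI : IsUnit I) : ∃ d, HasDisc ev I d := by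
  have := isTorsionFree_int_of_ringEquiv Φ
  have := moduleFinite_integralClosure Φ
  obtain ⟨u, rfl⟩ := hI
  obtain ⟨k, hk, h⟩ := exists_int_smul_mem_of_isUnit Φ u.isUnit
  have hfg : (u : Submodule (integralClosure ℤ A) A).FG := Submodule.fg_unit u
  obtain ⟨k', hk', h'⟩ := exists_int_smul_mem_of_fg Φ hfg
  set I := (u : Submodule (integralClosure ℤ A) A)
  have : Module.Finite ℤ (I.restrictScalars ℤ) := Module.Finite.iff_fg.mpr hfg.restrictScalars
  let f : integralClosure ℤ A →ₗ[ℤ] I.restrictScalars ℤ :=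
    { toFun := fun x => ⟨k • x, h x x.2⟩
      map_add' := fun y z => Subtype.ext (smul_add _ _ _)
      map_smul' := fun l z => Subtype.ext (smul_comm _ _ _) }
  let g : I.restrictScalars ℤ →ₗ[ℤ] integralClosure ℤ A :=
    { toFun := fun x => ⟨k' • x, h' x x.2⟩
      map_add' := fun y z => Subtype.ext (smul_add _ _ _)
      map_smul' := fun l z => Subtype.ext (smul_comm _ _ _) }
  have hf : Function.Injective f := fun y z hyz =>
    Subtype.ext (smul_right_injective A hk (congrArg Subtype.val hyz))
  have hg : Function.Injective g := fun y z hyz =>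
    Subtype.ext (smul_right_injective A hk' (congrArg Subtype.val hyz))
  have hrank : Module.finrank ℤ (I.restrictScalars ℤ) = Fintype.card ι := by
    rw [← Module.finrank_eq_card_basis w]
    exact le_antisymm (LinearMap.finrank_le_finrank_of_injective hg)
      (LinearMap.finrank_le_finrank_of_injective hf)
  exact ⟨_, (Module.finBasisOfFinrankEq ℤ _ hrank).reindex (Fintype.equivFin ι).symm, rfl⟩

include Φ in
lemma HasDisc.coeSubmodule_mul (w : Module.Basis ι ℤ (integralClosure ℤ A)) {ev : ι → A →+* L}
    {I : Submodule (integralClosure ℤ A) A} (hI : IsUnit I) {d : L} (h : HasDisc ev I d)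
    {b : Ideal (integralClosure ℤ A)} (hb : IsUnit (IsLocalization.coeSubmodule A b)) :
    HasDisc ev (IsLocalization.coeSubmodule A b * I)
      ((Nat.card (integralClosure ℤ A ⧸ b) : L) ^ 2 * d) := by
  have := finite_quotient_of_isUnit Φ hb
  obtain ⟨d', hd'⟩ := exists_hasDisc Φ w ev (hb.mul hI)
  obtain ⟨r, rfl⟩ := h
  obtain ⟨r', rfl⟩ := id hd'
  obtain ⟨u, rfl⟩ := hI
  have hle : IsLocalization.coeSubmodule A b * (u : Submodule (integralClosure ℤ A) A) ≤ u := by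
    rw [mul_coeSubmodule_eq_smul]; exact Submodule.smul_le_right
  have hle' : (IsLocalization.coeSubmodule A b *
      (u : Submodule (integralClosure ℤ A) A)).restrictScalars ℤ ≤
      (u : Submodule (integralClosure ℤ A) A).restrictScalars ℤ := hle
  have key := discOf_eq_of_basis ev hle' r r'
  have hcard : ((IsLocalization.coeSubmodule A b *
      (u : Submodule (integralClosure ℤ A) A)).restrictScalars ℤ).toAddSubgroup.relIndex
      ((u : Submodule (integralClosure ℤ A) A).restrictScalars ℤ).toAddSubgroup =
      Nat.card (integralClosure ℤ A ⧸ b) := by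
    rw [← card_quotient_smul_top b u]
    have : (b • ⊤ : Submodule (integralClosure ℤ A) (u : Submodule (integralClosure ℤ A) A)) =
        (IsLocalization.coeSubmodule A b * (u : Submodule (integralClosure ℤ A) A)).comap
          (Submodule.subtype _) := by
      apply Submodule.map_injective_of_injective (Submodule.subtype_injective
        (u : Submodule (integralClosure ℤ A) A))
      rw [Submodule.map_smul'', Submodule.map_top, Submodule.range_subtype,
        Submodule.map_comap_subtype, mul_coeSubmodule_eq_smul]
      exact (inf_eq_right.mpr Submodule.smul_le_right).symm
    rw [this]
    rfl
  rw [hcard] at key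
  exact ⟨r', key⟩

include Φ in
/-- If `b = α c'^n`, the ratio `s` of the discriminants of `c'` and of the ring of integers
satisfies `N(α)² s^n = N(b)²`, where `N(α)` is the product of the values of `α` and `N(b) = #(O /
b)`. -/
theorem exists_hasDisc_of_eq_span_mul_pow [CharZero L]
    (w : Module.Basis ι ℤ (integralClosure ℤ A)) (ev : ι → A →+* L)
    (hw : discOf ev (fun i => (w i : A)) ≠ 0) {b : Ideal (integralClosure ℤ A)}
    {c' : Submodule (integralClosure ℤ A) A} (hc' : IsUnit c') {α : A} (hα : IsUnit α) {n : ℕ}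
    (h : IsLocalization.coeSubmodule A b = Submodule.span _ {α} * c' ^ n) :
    ∃ s : ℚ, 0 < s ∧ HasDisc ev c' (s * discOf ev fun i => (w i : A)) ∧
      (∏ j, ev j α) ^ 2 * (s : L) ^ n = (Nat.card (integralClosure ℤ A ⧸ b) : L) ^ 2 := by
  set Δ := discOf ev fun i => (w i : A)
  have hfg : c'.FG := by obtain ⟨u, rfl⟩ := hc'; exact Submodule.fg_unit u
  have hspan : ∀ {x : A}, IsUnit x → IsUnit (Submodule.span (integralClosure ℤ A) {x}) := by
    rintro _ ⟨x, rfl⟩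
    refine IsUnit.of_mul_eq_one (Submodule.span _ {(↑x⁻¹ : A)}) ?_
    rw [Submodule.span_mul_span, Set.singleton_mul_singleton, Units.mul_inv, Submodule.one_eq_span]
  have hint : ∀ k : ℤ, k ≠ 0 → IsUnit (k : A) := fun k hk => by
    rw [← isUnit_map_iff Φ, map_intCast, Pi.isUnit_iff]
    intro o
    exact (IsUnit.mk0 (k : K o) (Int.cast_ne_zero.mpr hk))
  obtain ⟨k, hk, hkc⟩ := exists_int_smul_mem_of_fg Φ hfg
  obtain ⟨a, ha⟩ : ∃ a : Ideal (integralClosure ℤ A),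
      IsLocalization.coeSubmodule A a = Submodule.span _ {(k : A)} * c' := by
    refine exists_coeSubmodule_eq fun x hx => ?_
    obtain ⟨y, hy, rfl⟩ := Submodule.mem_span_singleton_mul.mp hx
    rw [← zsmul_eq_mul]
    exact mem_one_integralClosure.mpr (hkc y hy)
  have hau : IsUnit (IsLocalization.coeSubmodule A a) := ha ▸ (hspan (hint k hk)).mul hc'
  have hbu : IsUnit (IsLocalization.coeSubmodule A b) := h ▸ (hspan hα).mul (hc'.pow n)
  have := finite_quotient_of_isUnit Φ hau
  set q := Nat.card (integralClosure ℤ A ⧸ a)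
  have hq : q ≠ 0 := Nat.card_pos.ne'
  have hprod : ∀ l : ℤ, ∏ j, ev j (l : A) = (l : L) ^ Fintype.card ι := fun l => by
    simp only [map_intCast, Finset.prod_const, Finset.card_univ]
  have hkL : (k : L) ≠ 0 := Int.cast_ne_zero.mpr hk
  -- the discriminants of the powers of `a`
  have hpow : ∀ i, HasDisc ev (IsLocalization.coeSubmodule A a ^ i) (((q : L) ^ 2) ^ i * Δ) := by
    intro i
    induction i with
    | zero => rw [pow_zero, pow_zero, one_mul]; exact hasDisc_one ev w
    | succ i ih =>
      have := ih.coeSubmodule_mul Φ w (hau.pow i) hau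
      rwa [← pow_succ', ← mul_assoc, ← pow_succ'] at this
  have hb : HasDisc ev (IsLocalization.coeSubmodule A b)
      ((Nat.card (integralClosure ℤ A ⧸ b) : L) ^ 2 * Δ) := by
    have := (hasDisc_one ev w).coeSubmodule_mul Φ w isUnit_one hbu
    rwa [mul_one] at this
  refine ⟨(q : ℚ) ^ 2 / ((k : ℚ) ^ Fintype.card ι) ^ 2, ?_, ?_, ?_⟩
  · have : (k : ℚ) ≠ 0 := Int.cast_ne_zero.mpr hk
    have : (q : ℚ) ≠ 0 := Nat.cast_ne_zero.mpr hq
    positivity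
  · obtain ⟨d, hd⟩ := exists_hasDisc Φ w ev hc'
    have h₁ := hd.span_mul (hint k hk)
    rw [← ha] at h₁
    have h₂ := hpow 1
    rw [pow_one, pow_one] at h₂
    have h₃ := h₁.unique h₂
    rw [hprod] at h₃
    convert hd using 1
    push_cast
    rw [div_mul_eq_mul_div, ← h₃]
    field_simp
  · have h₁ := (hpow n).span_mul hα
    have h₂ := hb.span_mul ((hint k hk).pow n)
    have h₃ : Submodule.span (integralClosure ℤ A) {α} * IsLocalization.coeSubmodule A a ^ n =
        Submodule.span _ {(k : A) ^ n} * IsLocalization.coeSubmodule A b := by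
      rw [h, ha, mul_pow, Submodule.span_pow, Set.singleton_pow]
      ring
    rw [h₃] at h₁
    have h₄ := h₁.unique h₂
    have h₅ : ∏ j, ev j ((k : A) ^ n) = ((k : L) ^ Fintype.card ι) ^ n := by
      simp only [map_pow, Finset.prod_pow, hprod]
    rw [h₅] at h₄
    push_cast
    rw [div_pow, mul_div_assoc', div_eq_iff (by positivity)]
    apply mul_right_cancel₀ hw
    linear_combination h₄

end Volume

end

/-! ### The discriminant of `R` -/

section

open WeierstrassCurve.Affine NumberField

section Discriminant

lemma det_blockDiagonal'_eq_prod {o : Type*} [Fintype o] [DecidableEq o] {m : o → Type*}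
    [∀ i, Fintype (m i)] [∀ i, DecidableEq (m i)] {S : Type*} [CommRing S]
    (M : ∀ i, Matrix (m i) (m i) S) : (Matrix.blockDiagonal' M).det = ∏ i, (M i).det := by
  let _ : LinearOrder o := LinearOrder.lift' (Fintype.equivFin o) (Fintype.equivFin o).injective
  rw [(Matrix.blockTriangular_blockDiagonal' M).det_fintype]
  refine Finset.prod_congr rfl fun i _ => ?_
  rw [← Matrix.det_submatrix_equiv_self (Equiv.sigmaSubtype (β := m) i).symm]
  congr 1
  ext j k
  exact Matrix.blockDiagonal'_apply_eq M i j k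

/-- The discriminant of a number field is the squared determinant of the values of an integral
basis under the embeddings. -/
lemma exists_equiv_det_sq_eq_discr (K L : Type*) [Field K] [NumberField K] [Field L] [Algebra ℚ L]
    [CharZero L] [IsAlgClosed L] :
    ∃ e : Module.Free.ChooseBasisIndex ℤ (𝓞 K) ≃ (K →+* L),
      (Matrix.of fun i j => e j (RingOfIntegers.basis K i : K)).det ^ 2 = (discr K : L) := by
  have hcard : Fintype.card (Module.Free.ChooseBasisIndex ℤ (𝓞 K)) = Fintype.card (K →ₐ[ℚ] L) := by
    rw [AlgHom.card, ← Module.finrank_eq_card_basis (integralBasis K)]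
  let e := Fintype.equivOfCardEq hcard
  refine ⟨e.trans (RingHom.equivRatAlgHom K L).symm, ?_⟩
  have h := Algebra.discr_eq_det_embeddingsMatrixReindex_pow_two ℚ L (integralBasis K) e
  rw [← coe_discr, map_intCast] at h
  rw [h]
  congr 2
  ext i j
  rw [Algebra.embeddingsMatrixReindex, Matrix.reindex_apply, Matrix.submatrix_apply,
    Algebra.embeddingsMatrix_apply]
  simp only [Matrix.of_apply, Equiv.trans_apply, Equiv.refl_symm, Equiv.refl_apply, Equiv.symm_symm,
    integralBasis_apply]
  rfl

end Discriminant

section Torsion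

variable (E : WeierstrassCurve ℚ) [E.IsElliptic] (n : ℕ)

instance : (E.toAffine⁄QBar).IsElliptic :=
  inferInstanceAs (WeierstrassCurve.map E (algebraMap ℚ QBar)).IsElliptic

variable {n}

lemma natCard_torsion (hn : n ≠ 0) : Nat.card (Torsion E n) = n ^ 2 := by
  rw [← ncard_torsion (W := E.toAffine⁄QBar) hn]
  have : {P : GeomPoint E | n • P = 0} = (AddSubgroup.torsionBy (GeomPoint E) (n : ℤ) : Set _) := by
    ext P
    change n • P = 0 ↔ (n : ℤ) • P = 0
    rw [natCast_zsmul]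
  rw [this]
  exact Nat.card_coe_set_eq _

lemma finite_torsion (hn : n ≠ 0) : Finite (Torsion E n) :=
  Nat.finite_of_card_ne_zero (by rw [natCard_torsion E hn]; exact pow_ne_zero 2 hn)

end Torsion

section Etale

variable {E : WeierstrassCurve ℚ} {n : ℕ}

/-- The value at a point, as a ring homomorphism. -/
def evalHom (T : Torsion E n) : R E n →+* QBar where
  toFun z := z T
  map_one' := rfl
  map_mul' _ _ := rfl
  map_zero' := rfl
  map_add' _ _ := rfl

lemma isIntegral_iff_forall_apply [Fintype (Orbits E n)] {z : R E n} :
    IsIntegral ℤ z ↔ ∀ T, IsIntegral ℤ (z T) := by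
  classical
  refine ⟨fun h T => map_isIntegral_int (evalHom T) h, fun h => ?_⟩
  refine (isIntegral_iff_forall (etaleEquiv E n)).mpr fun o => ?_
  have h₁ := h (embeddingEquiv E n ⟨o, algebraMap (orbitField o) QBar⟩)
  rw [apply_embeddingEquiv] at h₁
  have h₂ : IsIntegral ℤ ((algebraMap (orbitField o) QBar).toIntAlgHom (etaleEquiv E n z o)) := h₁
  exact (isIntegral_algHom_iff _ (algebraMap (orbitField o) QBar).injective).mp h₂

variable (E n) in
/-- The discriminant of `R` is the squared determinant of the values of an integral basis. -/
theorem exists_basis_discOf_eq_discR [Fintype (Torsion E n)] [DecidableEq (Torsion E n)] :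
    ∃ w : Module.Basis (Torsion E n) ℤ (OR E n),
      discOf evalHom (fun i => (w i : R E n)) = (discR E n : QBar) := by
  classical
  have : Fintype (Orbits E n) := Fintype.ofFinite _
  choose e he using fun o : Orbits E n => exists_equiv_det_sq_eq_discr (orbitField o) QBar
  let f := (Equiv.sigmaCongrRight e).trans (embeddingEquiv E n)
  refine ⟨(productIntegralBasis (etaleEquiv E n)).reindex f, ?_⟩
  have hdiscr : (discR E n : QBar) = ∏ o : Orbits E n, (discr (orbitField o) : QBar) := by
    rw [discR, finprod_eq_prod_of_fintype, Int.cast_prod]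
  rw [discOf, hdiscr, ← Matrix.det_submatrix_equiv_self f]
  have hblock : (Matrix.of fun i j => evalHom j
      (((productIntegralBasis (etaleEquiv E n)).reindex f i : OR E n) : R E n)).submatrix f f =
      Matrix.blockDiagonal' fun o : Orbits E n => Matrix.of fun i j =>
        e o j (RingOfIntegers.basis (orbitField o) i : orbitField o) := by
    ext ⟨o, i⟩ ⟨o', j⟩
    rw [Matrix.submatrix_apply, Matrix.of_apply, Module.Basis.reindex_apply, Equiv.symm_apply_apply]
    change (productIntegralBasis (etaleEquiv E n) ⟨o, i⟩ : R E n)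
      (embeddingEquiv E n ⟨o', e o' j⟩) = _
    rw [apply_embeddingEquiv, productIntegralBasis_apply]
    by_cases h : o = o'
    · subst h
      rw [Pi.single_eq_same, Matrix.blockDiagonal'_apply_eq]
      rfl
    · rw [Pi.single_eq_of_ne' h, Matrix.blockDiagonal'_apply_ne _ _ _ h]
      exact map_zero _
  rw [hblock, det_blockDiagonal'_eq_prod, ← Finset.prod_pow]
  exact Finset.prod_congr rfl fun o _ => he o

variable (E n) in
lemma discR_ne_zero [Finite (Torsion E n)] : discR E n ≠ 0 := by
  classical
  have := Fintype.ofFinite (Orbits E n)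
  rw [discR, finprod_eq_prod_of_fintype]
  exact Finset.prod_ne_zero_iff.mpr fun o _ => discr_ne_zero _

end Etale

end

/-! ### The Weil pairing as a bicharacter -/

section

open WeierstrassCurve.Affine NumberField

namespace Bicharacter

variable {M L : Type*} [AddCommGroup M] [Field L] (e : Bicharacter M L)

/-- The power of a bicharacter. -/
def pow (k : ℕ) : Bicharacter M L where
  toFun S T := e S T ^ k
  add_left' S S' T := by rw [e.add_left, mul_pow]
  add_right' S T T' := by rw [e.add_right, mul_pow]
  ne_zero' S T := pow_ne_zero k (e.ne_zero S T)

lemma pow_apply (k : ℕ) (S T : M) : e.pow k S T = e S T ^ k := rfl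

lemma nsmul_right (k : ℕ) (S T : M) : e S (k • T) = e S T ^ k := by
  induction k with
  | zero => rw [zero_smul, e.zero_right, pow_zero]
  | succ k ih => rw [succ_nsmul, e.add_right, ih, pow_succ]

lemma mul_swap (halt : ∀ T, e T T = 1) (S T : M) : e S T * e T S = 1 := by
  have h := halt (S + T)
  rwa [e.add_left, e.add_right, e.add_right, halt, halt, one_mul, mul_one] at h

/-- The commutator pairing of `e ^ m`, with `e` alternating of odd exponent `n = 2m - 1`, is `e`. -/
lemma nondegenerate_pow (halt : ∀ T, e T T = 1) {n m : ℕ} (hn : n + 1 = 2 * m)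
    (htors : ∀ T : M, n • T = 0) (hnd : ∀ T, (∀ S, e S T = 1) → T = 0) :
    (e.pow m).Nondegenerate := by
  refine fun T hT => hnd T fun S => ?_
  have h₁ : e S T ^ m = e T S ^ m := hT S
  have h₂ : e S T ^ n = 1 := by rw [← e.nsmul_right, htors, e.zero_right]
  have h₃ : e S T ^ (n + 1) = 1 := by
    calc e S T ^ (n + 1) = e S T ^ m * e S T ^ m := by rw [hn, two_mul, pow_add]
      _ = e S T ^ m * e T S ^ m := congrArg _ h₁
      _ = 1 := by rw [← mul_pow, e.mul_swap halt, one_pow]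
  rwa [pow_succ, h₂, one_mul] at h₃

end Bicharacter

section WeilBicharacter

variable (E : WeierstrassCurve ℚ) [E.IsElliptic] {n : ℕ}

lemma nsmul_coe_torsion (T : Torsion E n) : n • T.1 = 0 := by
  rw [← natCast_zsmul]; exact T.2

/-- The Weil pairing as a bicharacter on `E[n]`. -/
def weilBicharacter (hn : n ≠ 0) : Bicharacter (Torsion E n) QBar where
  toFun S T := weilPairing n S.1 T.1
  add_left' S S' T := weilPairing_add_left hn (nsmul_coe_torsion E S) (nsmul_coe_torsion E S')
    (nsmul_coe_torsion E T)
  add_right' S T T' := weilPairing_add_right hn (nsmul_coe_torsion E S) (nsmul_coe_torsion E T)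
    (nsmul_coe_torsion E T')
  ne_zero' S T := weilPairing_ne_zero hn (nsmul_coe_torsion E S) (nsmul_coe_torsion E T)

lemma weilBicharacter_apply (hn : n ≠ 0) (S T : Torsion E n) :
    weilBicharacter E hn S T = weilPairing n S.1 T.1 := rfl

lemma weilBicharacter_self (hn : n ≠ 0) (T : Torsion E n) : weilBicharacter E hn T T = 1 :=
  weilPairing_self hn (nsmul_coe_torsion E T)

lemma weilBicharacter_smul (hn : n ≠ 0) (σ : GalQ) (S T : Torsion E n) :
    weilBicharacter E hn (σ • S) (σ • T) = σ (weilBicharacter E hn S T) :=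
  weilPairing_conj (V := E.toAffine) hn σ (nsmul_coe_torsion E S) (nsmul_coe_torsion E T)

lemma eq_zero_of_weilBicharacter_eq_one (hn : n ≠ 0) (T : Torsion E n)
    (h : ∀ S, weilBicharacter E hn S T = 1) : T = 0 := by
  refine Subtype.ext (eq_zero_of_weilPairing_eq_one hn (nsmul_coe_torsion E T) fun S hS => ?_)
  exact h ⟨S, by change (n : ℤ) • S = 0; rwa [natCast_zsmul]⟩

end WeilBicharacter

section Galois

variable {E : WeierstrassCurve ℚ} {n : ℕ}

lemma smul_add_torsion (σ : GalQ) (S T : Torsion E n) : σ • (S + T) = σ • S + σ • T :=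
  Subtype.ext (map_add (conjPoint (V := E.toAffine) σ) S.1 T.1)

lemma smul_zero_torsion (σ : GalQ) : σ • (0 : Torsion E n) = 0 :=
  Subtype.ext (map_zero (conjPoint (V := E.toAffine) σ))

lemma exists_rat_of_fixed {x : QBar} (h : ∀ σ : GalQ, σ x = x) : ∃ q : ℚ, algebraMap ℚ QBar q = x :=
  IntermediateField.mem_bot.mp (mem_of_forall_fixing ⊥ fun σ _ => h σ)

end Galois

/-! ### The obstruction algebra -/

section ObstructionAlgebra

variable {E : WeierstrassCurve ℚ} {n : ℕ} [Fintype (Torsion E n)] [DecidableEq (Torsion E n)]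

lemma twistedMul_apply (τ : R₂ E n) (z w : R E n) (T : Torsion E n) :
    twistedMul τ z w T = ∑ S, τ (S, T - S) * z S * w (T - S) := by
  let f : Torsion E n ≃ {p : Torsion E n × Torsion E n // p.1 + p.2 = T} :=
    { toFun := fun S => ⟨(S, T - S), add_sub_cancel S T⟩
      invFun := fun p => p.1.1
      left_inv := fun _ => rfl
      right_inv := fun p => Subtype.ext (Prod.ext rfl (sub_eq_of_eq_add' p.2.symm)) }
  change (∑ᶠ p : {p : Torsion E n × Torsion E n // p.1 + p.2 = T}, τ p.1 * z p.1.1 * w p.1.2) = _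
  rw [← finsum_comp_equiv f, finsum_eq_sum_of_fintype]
  rfl

variable (γ : Torsion E n → QBarˣ) {ε : Bicharacter (Torsion E n) QBar}

variable (ε) in
/-- The map `z ↦ γ z` from `R` to the twisted group algebra of `E[n]`. -/
def scaleMap (z : R E n) : TwistedAlgebra ε := fun T => (γ T : QBar) * z T

lemma scaleMap_apply (z : R E n) (T : Torsion E n) :
    (scaleMap γ ε z : Torsion E n → QBar) T = γ T * z T := rfl

lemma scaleMap_injective : Function.Injective (scaleMap γ ε : R E n → TwistedAlgebra ε) :=
  fun _ _ h => Subtype.ext (funext fun T => mul_left_cancel₀ (γ T).ne_zero (congrFun h T))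

variable {γ} in
/-- Multiplication by `γ` trivializes the coboundary `ρ`. -/
lemma scaleMap_twistedMul {τ : R₂ E n}
    (hτ : ∀ S T, τ (S, T) = ε S T * ((γ S : QBar) * (γ T : QBar) / (γ (S + T) : QBar)))
    (z w : R E n) : scaleMap γ ε (twistedMul τ z w) = scaleMap γ ε z * scaleMap γ ε w := by
  ext T
  rw [TwistedAlgebra.mul_apply, scaleMap_apply, twistedMul_apply, Finset.mul_sum]
  refine Finset.sum_congr rfl fun S _ => ?_
  rw [hτ, scaleMap_apply, scaleMap_apply, add_sub_cancel]
  have := (γ T).ne_zero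
  field_simp

variable (ε) in
/-- The linear map `c ⊗ z ↦ c γ z` from the scalar extension of `R` to the twisted group algebra. -/
def scaleLinearMap : QBar ⊗[ℚ] R E n →ₗ[QBar] TwistedAlgebra ε :=
  show QBar ⊗[ℚ] R E n →ₗ[QBar] (Torsion E n → QBar) from TensorProduct.AlgebraTensorModule.lift
    { toFun := fun c =>
        { toFun := fun z => (fun T => c * ((γ T : QBar) * z T) : Torsion E n → QBar)
          map_add' := fun z w => funext fun T => by
            change c * (γ T * (z T + w T)) = c * (γ T * z T) + c * (γ T * w T)
            ring
          map_smul' := fun q z => funext fun T => by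
            change c * (γ T * (q • z T)) = q • (c * (γ T * z T))
            rw [mul_smul_comm, mul_smul_comm] }
      map_add' := fun c d => LinearMap.ext fun z => funext fun T => add_mul _ _ _
      map_smul' := fun c d => LinearMap.ext fun z => funext fun T => mul_assoc _ _ _ }

lemma scaleLinearMap_tmul (c : QBar) (z : R E n) :
    scaleLinearMap γ ε (c ⊗ₜ z) = c • scaleMap γ ε z := rfl

/-- In an integral basis of `R` the map is given by the matrix of the values of `γ` times the basis,
which is invertible since the discriminant of `R` is not zero. -/
lemma scaleLinearMap_bijective : Function.Bijective (scaleLinearMap γ ε) := by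
  obtain ⟨w, hw⟩ := exists_basis_discOf_eq_discR E n
  set M : Matrix (Torsion E n) (Torsion E n) QBar :=
    Matrix.of fun i j => (γ j : QBar) * evalHom j (w i : R E n) with hM
  have hdet : IsUnit M := by
    rw [Matrix.isUnit_iff_isUnit_det, isUnit_iff_ne_zero, hM,
      Matrix.det_mul_row (fun j => (γ j : QBar)) (fun i j => evalHom j (w i : R E n))]
    refine mul_ne_zero (Finset.prod_ne_zero_iff.mpr fun j _ => (γ j).ne_zero) fun h => ?_
    rw [discOf] at hw
    have h' : (Matrix.of fun i j => evalHom j (w i : R E n)).det = 0 := h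
    rw [h', zero_pow two_ne_zero] at hw
    exact discR_ne_zero E n (Int.cast_eq_zero.mp hw.symm)
  let g : (Torsion E n → QBar) →ₗ[QBar] QBar ⊗[ℚ] R E n :=
    Fintype.linearCombination QBar fun i => (1 : QBar) ⊗ₜ[ℚ] (w i : R E n)
  have hg : Function.Surjective g := by
    have hint : ∀ x : OR E n, (1 : QBar) ⊗ₜ[ℚ] (x : R E n) ∈ LinearMap.range g := by
      intro x
      refine ⟨fun i => (w.repr x i : QBar), ?_⟩
      rw [Fintype.linearCombination_apply]
      conv_rhs => rw [← w.sum_repr x]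
      rw [AddSubmonoidClass.coe_finsetSum, TensorProduct.tmul_sum]
      refine Finset.sum_congr rfl fun i _ => ?_
      rw [SetLike.val_smul, ← Int.cast_smul_eq_zsmul ℚ, TensorProduct.tmul_smul,
        Int.cast_smul_eq_zsmul, Int.cast_smul_eq_zsmul]
    refine LinearMap.range_eq_top.mp (eq_top_iff.mpr fun t _ => ?_)
    induction t using TensorProduct.induction_on with
    | zero => exact zero_mem _
    | add x y hx hy => exact add_mem (hx trivial) (hy trivial)
    | tmul c x =>
      have : Fintype (Orbits E n) := Fintype.ofFinite _
      classical
      obtain ⟨k, hk, h⟩ := exists_int_smul_mem_integralClosure (etaleEquiv E n) x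
      have h₁ := (LinearMap.range g).smul_mem (c * (k : QBar)⁻¹) (hint ⟨_, h⟩)
      have h₂ : (c * (k : QBar)⁻¹) • ((1 : QBar) ⊗ₜ[ℚ] (k • x)) = c ⊗ₜ[ℚ] x := by
        rw [← Int.cast_smul_eq_zsmul ℚ, TensorProduct.tmul_smul, Int.cast_smul_eq_zsmul,
          ← Int.cast_smul_eq_zsmul QBar, smul_smul,
          inv_mul_cancel_right₀ (Int.cast_ne_zero.mpr hk), TensorProduct.smul_tmul', smul_eq_mul,
          mul_one]
      rwa [h₂] at h₁
  have hcomp : ∀ c, (scaleLinearMap γ ε (g c) : Torsion E n → QBar) = Matrix.vecMul c M := by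
    intro c
    rw [Fintype.linearCombination_apply, map_sum]
    funext T
    refine (Finset.sum_apply T _ _).trans ?_
    refine Finset.sum_congr rfl fun i _ => ?_
    rw [map_smul, scaleLinearMap_tmul, one_smul]
    rfl
  constructor
  · rw [injective_iff_map_eq_zero]
    intro t ht
    obtain ⟨c, rfl⟩ := hg t
    have h : Matrix.vecMul c M = Matrix.vecMul 0 M := by
      rw [← hcomp, ht, Matrix.zero_vecMul]; rfl
    rw [Matrix.vecMul_injective_of_isUnit hdet h, map_zero]
  · intro y
    obtain ⟨c, hc⟩ := (Matrix.vecMul_surjective_iff_isUnit.mpr hdet) y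
    exact ⟨g c, (hcomp c).trans hc⟩

variable (ε) in
/-- The isomorphism of the scalar extension of `R` with the twisted group algebra that is induced by
multiplication with `γ`. -/
def scaleEquiv : (QBar ⊗[ℚ] R E n) ≃ₗ[QBar] TwistedAlgebra ε :=
  LinearEquiv.ofBijective (scaleLinearMap γ ε) (scaleLinearMap_bijective γ)

lemma scaleEquiv_tmul (c : QBar) (z : R E n) :
    scaleEquiv γ ε (c ⊗ₜ z) = c • scaleMap γ ε z := rfl

variable {γ} {τ : R₂ E n}
  (hτ : ∀ S T, τ (S, T) = ε S T * ((γ S : QBar) * (γ T : QBar) / (γ (S + T) : QBar)))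

include hτ in
/-- The scalar extension of the obstruction algebra is a matrix algebra. -/
theorem exists_isSplitting (hε : ε.Nondegenerate) (hcard : Fintype.card (Torsion E n) = n ^ 2) :
    ∃ φ : (QBar ⊗[ℚ] R E n) ≃ₗ[QBar] Matrix (Fin n) (Fin n) QBar,
      IsSplitting n (twistedMul τ) φ := by
  obtain ⟨ψ⟩ := TwistedAlgebra.exists_algEquiv_matrix hε hcard
  refine ⟨(scaleEquiv γ ε).trans ψ.toLinearEquiv, fun z w => ?_⟩
  change ψ (scaleEquiv γ ε _) = ψ (scaleEquiv γ ε _) * ψ (scaleEquiv γ ε _)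
  rw [scaleEquiv_tmul, scaleEquiv_tmul, scaleEquiv_tmul, one_smul, one_smul, one_smul,
    scaleMap_twistedMul hτ, map_mul]

include hτ in
/-- The trace in any splitting is `n` times the coefficient at the identity of `E[n]`. -/
theorem IsSplitting.trace_eq (hε : ε.Nondegenerate)
    {φ : (QBar ⊗[ℚ] R E n) ≃ₗ[QBar] Matrix (Fin n) (Fin n) QBar}
    (hφ : IsSplitting n (twistedMul τ) φ) (z : R E n) :
    (φ (1 ⊗ₜ z)).trace = n * ((γ 0 : QBar) * z 0) := by
  let φ' : TwistedAlgebra ε ≃ₗ[QBar] Matrix (Fin n) (Fin n) QBar := (scaleEquiv γ ε).symm.trans φ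
  have hφ' : ∀ t, φ' (scaleEquiv γ ε t) = φ t := fun t => by
    change φ ((scaleEquiv γ ε).symm (scaleEquiv γ ε t)) = φ t
    rw [LinearEquiv.symm_apply_apply]
  have hmul : ∀ a b, φ' (a * b) = φ' a * φ' b := by
    intro a b
    obtain ⟨s, rfl⟩ := (scaleEquiv γ ε).surjective a
    obtain ⟨t, rfl⟩ := (scaleEquiv γ ε).surjective b
    induction s using TensorProduct.induction_on with
    | zero => simp only [map_zero, zero_mul]
    | add x y hx hy => simp only [map_add, add_mul, hx, hy]
    | tmul c x =>
      induction t using TensorProduct.induction_on with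
      | zero => simp only [map_zero, mul_zero]
      | add y z hy hz => simp only [map_add, mul_add, hy, hz]
      | tmul d y =>
        have h₁ : ∀ (c : QBar) (x : R E n), scaleEquiv γ ε (c ⊗ₜ x) = c • scaleEquiv γ ε (1 ⊗ₜ x) :=
          fun c x => by rw [scaleEquiv_tmul, scaleEquiv_tmul, one_smul]
        rw [h₁ c, h₁ d, smul_mul_smul_comm, map_smul, map_smul, map_smul, smul_mul_smul_comm,
          hφ', hφ', ← hφ, ← hφ']
        congr 2
        rw [scaleEquiv_tmul, scaleEquiv_tmul, scaleEquiv_tmul, one_smul, one_smul, one_smul,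
          scaleMap_twistedMul hτ]
  have h1 : φ' 1 = 1 := by
    obtain ⟨u, hu⟩ := φ'.surjective 1
    have := hmul 1 u
    rwa [one_mul, hu, mul_one, eq_comm] at this
  have := TwistedAlgebra.trace_eq hε φ'.toLinearMap hmul h1 (scaleEquiv γ ε (1 ⊗ₜ z))
  rw [LinearEquiv.coe_coe, hφ', scaleEquiv_tmul, one_smul] at this
  exact this

include hτ in
/-- The reduced trace is `z ↦ n γ(0) z(0)`, whatever the splitting. -/
theorem isReducedTrace_iff (hε : ε.Nondegenerate) (hcard : Fintype.card (Torsion E n) = n ^ 2)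
    {t : R E n → ℚ} : IsReducedTrace n (twistedMul τ) t ↔
      ∀ z : R E n, algebraMap ℚ QBar (t z) = n * ((γ 0 : QBar) * z 0) := by
  constructor
  · rintro ⟨φ, hφ, ht⟩ z
    rw [ht, hφ.trace_eq hτ hε]
  · intro ht
    obtain ⟨φ, hφ⟩ := exists_isSplitting hτ hε hcard
    exact ⟨φ, hφ, fun z => by rw [ht, hφ.trace_eq hτ hε]⟩

include hτ in
/-- The reduced trace takes rational values, since `γ(0) z(0)` is Galois invariant. -/
theorem exists_isReducedTrace (hε : ε.Nondegenerate) (hcard : Fintype.card (Torsion E n) = n ^ 2)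
    (hγ0 : ∀ σ : GalQ, σ (γ 0 : QBar) = γ 0) :
    ∃ t : R E n → ℚ, IsReducedTrace n (twistedMul τ) t := by
  have h : ∀ z : R E n, ∃ q : ℚ, algebraMap ℚ QBar q = n * ((γ 0 : QBar) * z 0) := fun z =>
    exists_rat_of_fixed fun σ => by
      rw [map_mul, map_mul, map_natCast, hγ0, ← z.2, smul_zero_torsion]
  choose t ht using h
  exact ⟨t, (isReducedTrace_iff hτ hε hcard).mpr ht⟩

variable (γ) in
/-- The identity element of the obstruction algebra: the map supported at `0` with value
`γ(0)⁻¹`. -/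
def obstructionOne (hγ0 : ∀ σ : GalQ, σ (γ 0 : QBar) = γ 0) : R E n :=
  ⟨fun T => if T = 0 then (γ 0 : QBar)⁻¹ else 0, fun σ T => by
    have : σ • T = 0 ↔ T = 0 := by rw [smul_eq_iff_eq_inv_smul, smul_zero_torsion]
    by_cases h : T = 0
    · simp only [if_pos (this.mpr h), if_pos h, map_inv₀, hγ0]
    · simp only [if_neg (mt this.mp h), if_neg h, map_zero]⟩

lemma scaleMap_obstructionOne (hγ0 : ∀ σ : GalQ, σ (γ 0 : QBar) = γ 0) :
    scaleMap γ ε (obstructionOne γ hγ0) = 1 := by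
  ext T
  rw [TwistedAlgebra.one_def, TwistedAlgebra.single_apply, scaleMap_apply]
  change (γ T : QBar) * (if T = 0 then (γ 0 : QBar)⁻¹ else 0) = _
  by_cases h : T = 0
  · rw [h, if_pos rfl, if_pos rfl, mul_inv_cancel₀ (γ 0).ne_zero]
  · rw [if_neg h, if_neg h, mul_zero]

include hτ in
lemma twistedMul_obstructionOne (hγ0 : ∀ σ : GalQ, σ (γ 0 : QBar) = γ 0) (z : R E n) :
    twistedMul τ (obstructionOne γ hγ0) z = z ∧ twistedMul τ z (obstructionOne γ hγ0) = z := by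
  constructor <;> apply scaleMap_injective γ (ε := ε) <;>
    rw [scaleMap_twistedMul hτ, scaleMap_obstructionOne]
  exacts [one_mul _, mul_one _]

end ObstructionAlgebra

end

section

open WeierstrassCurve.Affine NumberField

/-! ### Groups of odd exponent -/

section OddGroup

variable {M : Type*} [AddCommGroup M] [Fintype M] [DecidableEq M] {n m : ℕ}

lemma eq_zero_of_two_nsmul (hn : n + 1 = 2 * m) (htors : ∀ T : M, n • T = 0) {T : M}
    (h : T = -T) : T = 0 := by
  have h₂ : (2 : ℕ) • T = 0 := by
    rw [two_nsmul]; nth_rw 2 [h]; exact add_neg_cancel T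
  calc T = (n + 1) • T := by rw [succ_nsmul, htors, zero_add]
    _ = 0 := by rw [hn, mul_comm, mul_smul, h₂, smul_zero]

lemma sum_eq_zero_of_odd (hn : n + 1 = 2 * m) (htors : ∀ T : M, n • T = 0) : ∑ T : M, T = 0 := by
  refine eq_zero_of_two_nsmul hn htors ?_
  rw [← Finset.sum_neg_distrib]
  exact (Equiv.sum_comp (Equiv.neg M) id).symm

/-- Negation on a group of order `n²`, with `n` odd, is a product of `(n² - 1) / 2` transpositions,
and this number is even. -/
lemma sign_neg (hn : n + 1 = 2 * m) (htors : ∀ T : M, n • T = 0)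
    (hcard : Fintype.card M = n ^ 2) : Equiv.Perm.sign (Equiv.neg M) = 1 := by
  have hsq : (Equiv.neg M : Equiv.Perm M) ^ 2 = 1 := by
    ext T
    rw [pow_two]
    exact neg_neg T
  have hct := Multiset.eq_replicate_card.mpr (Equiv.Perm.pow_prime_eq_one_iff.mp hsq)
  set k := Multiset.card (Equiv.Perm.cycleType (Equiv.neg M))
  have hsum : (Equiv.Perm.cycleType (Equiv.neg M)).sum = n ^ 2 - 1 := by
    rw [Equiv.Perm.sum_cycleType, ← hcard]
    have : Equiv.Perm.support (Equiv.neg M) = Finset.univ.erase 0 := by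
      ext T
      rw [Equiv.Perm.mem_support, Finset.mem_erase]
      refine ⟨fun h => ⟨fun h0 => h (by subst h0; exact neg_zero), Finset.mem_univ _⟩,
        fun h h' => h.1 (eq_zero_of_two_nsmul hn htors h'.symm)⟩
    rw [this, Finset.card_erase_of_mem (Finset.mem_univ _), Finset.card_univ]
  have h2k : k * 2 = n ^ 2 - 1 := by
    rw [← hsum, hct, Multiset.sum_replicate, smul_eq_mul]
  have heven : Even k := by
    obtain ⟨l, rfl⟩ : ∃ l, m = l + 1 := ⟨m - 1, by omega⟩
    obtain rfl : n = 2 * l + 1 := by omega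
    have : k = 2 * (l * (l + 1)) := by
      have h : (2 * l + 1) ^ 2 - 1 = 2 * (l * (l + 1)) * 2 := by
        rw [Nat.sub_eq_iff_eq_add (Nat.one_le_pow _ _ (by omega))]; ring
      omega
    rw [this]
    exact even_two_mul _
  rw [Equiv.Perm.sign_of_cycleType, hsum, ← h2k]
  exact Even.neg_one_pow ((even_two.mul_left k).add heven)

end OddGroup

/-! ### The cocycle and its coboundary -/

section Cocycle

variable {E : WeierstrassCurve ℚ} [E.IsElliptic] {n : ℕ} {hn : n ≠ 0}
  {ξ : GalQ → Torsion E n} {γ : Torsion E n → QBarˣ}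

/-- The Galois action on `γ` in terms of the cocycle. -/
lemma conj_eq_weilBicharacter_mul (hγξ : ∀ (σ : GalQ) (T : Torsion E n),
      weilPairing n (ξ σ).1 T.1 = σ (γ (σ⁻¹ • T) : QBar) / (γ T : QBar)) (σ : GalQ)
    (T : Torsion E n) :
    σ (γ T : QBar) = weilBicharacter E hn (ξ σ) (σ • T) * (γ (σ • T) : QBar) := by
  rw [weilBicharacter_apply, hγξ, inv_smul_smul, div_mul_cancel₀ _ (Units.ne_zero _)]

variable (hγ : ∀ (σ : GalQ) (T : Torsion E n),
  σ (γ T : QBar) = weilBicharacter E hn (ξ σ) (σ • T) * (γ (σ • T) : QBar))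

include hγ in
lemma conj_zero_eq (σ : GalQ) : σ (γ 0 : QBar) = γ 0 := by
  rw [hγ, smul_zero_torsion, Bicharacter.zero_right, one_mul]

/-- The coboundary `ρ` of `γ`, as an equivariant map. -/
def coboundary : R₂ E n :=
  ⟨fun p => (γ p.1 : QBar) * (γ p.2 : QBar) / (γ (p.1 + p.2) : QBar), fun σ p => by
    change (γ (σ • p.1) : QBar) * (γ (σ • p.2) : QBar) / (γ (σ • p.1 + σ • p.2) : QBar) = _
    rw [map_div₀, map_mul, hγ, hγ, hγ, smul_add_torsion, Bicharacter.add_right]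
    have := (γ (σ • p.1 + σ • p.2)).ne_zero
    have := (weilBicharacter E hn).ne_zero (ξ σ) (σ • p.1)
    have := (weilBicharacter E hn).ne_zero (ξ σ) (σ • p.2)
    field_simp⟩

variable (E) in
/-- The `m`-th power of the Weil pairing, as an equivariant map. -/
def weilPower (hn : n ≠ 0) (m : ℕ) : R₂ E n :=
  ⟨fun p => (weilBicharacter E hn).pow m p.1 p.2, fun σ p => by
    change weilBicharacter E hn (σ • p.1) (σ • p.2) ^ m = σ (weilBicharacter E hn p.1 p.2 ^ m)
    rw [map_pow, weilBicharacter_smul]⟩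

variable [Fintype (Torsion E n)] [DecidableEq (Torsion E n)]

lemma nsmul_torsion (T : Torsion E n) : n • T = 0 := Subtype.ext (nsmul_coe_torsion E T)

include hγ in
/-- The product of all the values of `γ` is rational, since the points of `E[n]` sum to zero. -/
lemma exists_rat_prod {m : ℕ} (hnm : n + 1 = 2 * m) :
    ∃ q : ℚ, algebraMap ℚ QBar q = ∏ T, (γ T : QBar) := by
  refine exists_rat_of_fixed fun σ => ?_
  have hsum : ∀ (s : Finset (Torsion E n)) (S : Torsion E n),
      ∏ T ∈ s, weilBicharacter E hn S T = weilBicharacter E hn S (∑ T ∈ s, T) := by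
    intro s S
    classical
    induction s using Finset.induction_on with
    | empty => rw [Finset.prod_empty, Finset.sum_empty, Bicharacter.zero_right]
    | insert T s hT ih =>
      rw [Finset.prod_insert hT, Finset.sum_insert hT, ih, Bicharacter.add_right]
  have hperm : ∀ f : Torsion E n → QBar, ∏ T, f (σ • T) = ∏ T, f T := fun f =>
    Equiv.prod_comp (MulAction.toPerm σ) f
  rw [map_prod]
  simp only [hγ]
  rw [Finset.prod_mul_distrib, hperm (fun T => weilBicharacter E hn (ξ σ) T),
    hperm (fun T => (γ T : QBar)), hsum, sum_eq_zero_of_odd hnm nsmul_torsion,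
    Bicharacter.zero_right, one_mul]

end Cocycle

/-! ### The order and its discriminant -/

section Lattice

variable {E : WeierstrassCurve ℚ} {n : ℕ} [Fintype (Torsion E n)] [DecidableEq (Torsion E n)]
  {α : R E n} {γ : Torsion E n → QBarˣ} (hγα : ∀ T : Torsion E n, (γ T : QBar) ^ n = α T)
  {b : Ideal (OR E n)} {c c' : Submodule (OR E n) (R E n)} (hcc : c * c' = 1)
  (hα : IsLocalization.coeSubmodule (R E n) b * c ^ n = Submodule.span _ {α})

lemma pow_apply_torsion (z : R E n) (k : ℕ) (T : Torsion E n) : (z ^ k) T = z T ^ k :=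
  map_pow (evalHom T) z k

include hγα hcc hα in
/-- `c⁻¹` consists of the `z` for which all the values of `γ z` are integral. -/
lemma mem_iff_isIntegral_mul (hn : n ≠ 0)
    (hfree : ∀ p : Ideal (OR E n), p.IsPrime → ¬ p ^ n ∣ b) {z : R E n} :
    z ∈ c' ↔ ∀ T, IsIntegral ℤ ((γ T : QBar) * z T) := by
  classical
  have : Fintype (Orbits E n) := Fintype.ofFinite _
  have hval : ∀ T, (z ^ n * α) T = ((γ T : QBar) * z T) ^ n := fun T => by
    change (z ^ n) T * α T = _
    rw [pow_apply_torsion, ← hγα, mul_pow, mul_comm]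
  constructor
  · intro hz T
    have h₁ : z ^ n * α ∈ IsLocalization.coeSubmodule (R E n) b := by
      have h₂ : z ^ n * α ∈ c' ^ n * (IsLocalization.coeSubmodule (R E n) b * c ^ n) :=
        Submodule.mul_mem_mul (Submodule.pow_mem_pow _ hz n)
          (hα ▸ Submodule.mem_span_singleton_self α)
      have h₃ : c' ^ n * (IsLocalization.coeSubmodule (R E n) b * c ^ n) =
          IsLocalization.coeSubmodule (R E n) b * (c * c') ^ n := by rw [mul_pow]; ring
      rwa [h₃, hcc, one_pow, mul_one] at h₂
    obtain ⟨x, -, hx⟩ := h₁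
    have h₄ : IsIntegral ℤ (z ^ n * α) := hx ▸ x.2
    refine IsIntegral.of_pow (Nat.pos_of_ne_zero hn) ?_
    rw [← hval]
    exact isIntegral_iff_forall_apply.mp h₄ T
  · intro h
    refine mem_of_pow_mul_isIntegral (etaleEquiv E n) hn hcc hα hfree ?_
    refine isIntegral_iff_forall_apply.mpr fun T => ?_
    rw [hval]
    exact (h T).pow n

include hcc in
lemma fg_restrictScalars_inverse : (c'.restrictScalars ℤ).FG := by
  classical
  have : Fintype (Orbits E n) := Fintype.ofFinite _
  have := moduleFinite_integralClosure (etaleEquiv E n)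
  exact Submodule.FG.restrictScalars
    (Submodule.fg_unit (Units.mkOfMulEqOne c' c (by rw [mul_comm]; exact hcc)))

include hcc in
lemma span_rat_inverse : Submodule.span ℚ (c'.restrictScalars ℤ : Set (R E n)) = ⊤ := by
  classical
  have : Fintype (Orbits E n) := Fintype.ofFinite _
  obtain ⟨k, hk, h⟩ := exists_int_smul_mem_of_isUnit (etaleEquiv E n)
    (IsUnit.of_mul_eq_one c (show c' * c = 1 by rw [mul_comm]; exact hcc))
  refine eq_top_iff.mpr fun x _ => ?_
  obtain ⟨l, hl, hx⟩ := exists_int_smul_mem_integralClosure (etaleEquiv E n) x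
  have h₁ := Submodule.smul_mem (Submodule.span ℚ (c'.restrictScalars ℤ : Set (R E n)))
    ((k * l : ℚ)⁻¹) (Submodule.subset_span (h _ hx))
  have hkl : (k * l : ℚ) ≠ 0 := mul_ne_zero (Int.cast_ne_zero.mpr hk) (Int.cast_ne_zero.mpr hl)
  have h₂ : k • l • x = (k * l : ℚ) • x := by
    rw [mul_smul, Int.cast_smul_eq_zsmul, Int.cast_smul_eq_zsmul]
  rwa [h₂, inv_smul_smul₀ hkl] at h₁

variable {ε : Bicharacter (Torsion E n) QBar} {τ : R₂ E n}
  (hτ : ∀ S T, τ (S, T) = ε S T * ((γ S : QBar) * (γ T : QBar) / (γ (S + T) : QBar)))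

include hγα hcc hα hτ in
/-- The lattice `c⁻¹` is an order: it consists of the `z` for which `γ z` has integral values, a
condition that is preserved by the multiplication when the values of `ε` are integral. -/
theorem isOrder_twistedMul (hn : n ≠ 0) (hεint : ∀ S T, IsIntegral ℤ (ε S T))
    (hfree : ∀ p : Ideal (OR E n), p.IsPrime → ¬ p ^ n ∣ b)
    (hγ0 : ∀ σ : GalQ, σ (γ 0 : QBar) = γ 0) :
    IsOrder (twistedMul τ) (c'.restrictScalars ℤ) := by
  have hmem : ∀ z : R E n, z ∈ c'.restrictScalars ℤ ↔
      ∀ T, IsIntegral ℤ ((scaleMap γ ε z : Torsion E n → QBar) T) := fun z =>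
    mem_iff_isIntegral_mul hγα hcc hα hn hfree
  refine ⟨fg_restrictScalars_inverse hcc, span_rat_inverse hcc,
    ⟨obstructionOne γ hγ0, ?_, twistedMul_obstructionOne hτ hγ0⟩, fun z hz w hw => ?_⟩
  · rw [hmem, scaleMap_obstructionOne]
    intro T
    rw [TwistedAlgebra.one_def, TwistedAlgebra.single_apply]
    split_ifs
    exacts [isIntegral_one, isIntegral_zero]
  · rw [hmem] at hz hw ⊢
    intro T
    rw [scaleMap_twistedMul hτ, TwistedAlgebra.mul_apply]
    exact IsIntegral.sum _ fun S _ => ((hεint S _).mul (hz S)).mul (hw _)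

include hγα in
lemma isUnit_of_pow_eq : IsUnit α := by
  rw [← isUnit_map_iff (etaleEquiv E n), Pi.isUnit_iff]
  refine fun o => IsUnit.mk0 _ fun h => ?_
  have h₁ := apply_embeddingEquiv α o (algebraMap (orbitField o) QBar)
  rw [h, map_zero, ← hγα] at h₁
  exact pow_ne_zero n (γ _).ne_zero h₁

include hτ in
/-- The Gram matrix of the reduced trace is `n A Aᵀ` up to the permutation `T ↦ -T` of the rows of
`Aᵀ`, where `A` is the matrix of the values of `γ` times the basis. -/
theorem det_trace_eq {m : ℕ} (hnm : n + 1 = 2 * m) (htors : ∀ T : Torsion E n, n • T = 0)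
    (hcard : Fintype.card (Torsion E n) = n ^ 2)
    (hε : ε.Nondegenerate) (hneg : ∀ T, ε T (-T) = 1) {t : R E n → ℚ}
    (ht : IsReducedTrace n (twistedMul τ) t) (r : Torsion E n → R E n) :
    algebraMap ℚ QBar (Matrix.of fun i j => t (twistedMul τ (r i) (r j))).det =
      (n : QBar) ^ n ^ 2 * (∏ T, (γ T : QBar)) ^ 2 * discOf evalHom r := by
  rw [isReducedTrace_iff hτ hε hcard] at ht
  set A : Matrix (Torsion E n) (Torsion E n) QBar :=
    Matrix.of fun i T => (γ T : QBar) * evalHom T (r i) with hA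
  have h₁ : (algebraMap ℚ QBar).mapMatrix (Matrix.of fun i j => t (twistedMul τ (r i) (r j))) =
      (n : QBar) • (A * A.transpose.submatrix (Equiv.neg (Torsion E n)) id) := by
    ext i j
    rw [RingHom.mapMatrix_apply, Matrix.map_apply, Matrix.of_apply, ht, Matrix.smul_apply,
      smul_eq_mul, Matrix.mul_apply]
    congr 1
    have h₂ := congrFun (scaleMap_twistedMul (ε := ε) hτ (r i) (r j)) (0 : Torsion E n)
    rw [TwistedAlgebra.mul_apply] at h₂
    refine h₂.trans (Finset.sum_congr rfl fun S _ => ?_)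
    rw [zero_sub, hneg, one_mul]
    rfl
  have hdetA : A.det ^ 2 = (∏ T, (γ T : QBar)) ^ 2 * discOf evalHom r := by
    rw [discOf, ← mul_pow, ← Matrix.det_mul_row]
    rfl
  rw [RingHom.map_det, h₁, Matrix.det_smul, Matrix.det_mul, Matrix.det_permute,
    sign_neg hnm htors hcard, Units.val_one, Int.cast_one, one_mul, Matrix.det_transpose, ← pow_two,
    hdetA, hcard, mul_assoc]

include hγα hcc hα hτ in
/-- The discriminant of `c⁻¹` is `n^(n²) q² s Disc(R)`, where `q` is the product of the values of
`γ` and `s` is the ratio of the discriminants of the lattices `c⁻¹` and `O_R`. -/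
theorem exists_isDiscriminant {m : ℕ} (hnm : n + 1 = 2 * m) (htors : ∀ T : Torsion E n, n • T = 0)
    (hcard : Fintype.card (Torsion E n) = n ^ 2)
    (hε : ε.Nondegenerate) (hneg : ∀ T, ε T (-T) = 1)
    (hγ0 : ∀ σ : GalQ, σ (γ 0 : QBar) = γ 0)
    {q : ℚ} (hq : algebraMap ℚ QBar q = ∏ T, (γ T : QBar)) :
    ∃ d : ℚ, IsDiscriminant n (twistedMul τ) (c'.restrictScalars ℤ) d ∧
      (d : ℝ) = (n : ℝ) ^ (n ^ 2) *
        (Nat.card (OR E n ⧸ b) : ℝ) ^ (2 / (n : ℝ)) * (discR E n : ℝ) := by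
  classical
  have : Fintype (Orbits E n) := Fintype.ofFinite _
  have hn : n ≠ 0 := by omega
  obtain ⟨w, hw⟩ := exists_basis_discOf_eq_discR E n
  have hw0 : discOf evalHom (fun i => (w i : R E n)) ≠ 0 := by
    rw [hw]; exact Int.cast_ne_zero.mpr (discR_ne_zero E n)
  have hb : IsLocalization.coeSubmodule (R E n) b = Submodule.span _ {α} * c' ^ n := by
    rw [← hα, mul_assoc, ← mul_pow, hcc, one_pow, mul_one]
  obtain ⟨s, hs, hdisc, hsn⟩ := exists_hasDisc_of_eq_span_mul_pow (etaleEquiv E n) w evalHom hw0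
    (IsUnit.of_mul_eq_one c (show c' * c = 1 by rw [mul_comm]; exact hcc))
    (isUnit_of_pow_eq hγα) hb
  have hgn : ∏ T, evalHom T α = algebraMap ℚ QBar (q ^ n) := by
    rw [map_pow, hq, ← Finset.prod_pow]
    exact Finset.prod_congr rfl fun T _ => (hγα T).symm
  -- `q² s` is the positive `n`-th root of the square of the norm of `b`
  have hpow : (q ^ 2 * s) ^ n = (Nat.card (OR E n ⧸ b) : ℚ) ^ 2 := by
    apply (algebraMap ℚ QBar).injective
    rw [hgn] at hsn
    rw [map_pow, map_pow (algebraMap ℚ QBar) _ 2, map_natCast, ← hsn, map_mul, map_pow, map_pow,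
      eq_ratCast (algebraMap ℚ QBar) s]
    ring
  have hroot : ((q ^ 2 * s : ℚ) : ℝ) = (Nat.card (OR E n ⧸ b) : ℝ) ^ (2 / (n : ℝ)) := by
    have h₀ : (0 : ℝ) ≤ ((q ^ 2 * s : ℚ) : ℝ) := Rat.cast_nonneg.mpr (by positivity)
    have h₁ : ((q ^ 2 * s : ℚ) : ℝ) ^ n = (Nat.card (OR E n ⧸ b) : ℝ) ^ 2 := by exact_mod_cast hpow
    rw [← Real.pow_rpow_inv_natCast h₀ hn, h₁, ← Real.rpow_natCast, ← Real.rpow_mul (by positivity)]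
    congr 1
  let f : Torsion E n ≃ Fin (n ^ 2) := Fintype.equivFinOfCardEq hcard
  refine ⟨(n : ℚ) ^ n ^ 2 * (q ^ 2 * s) * discR E n,
    ⟨exists_isReducedTrace hτ hε hcard hγ0, ?_, fun t ht r => ?_⟩, ?_⟩
  · obtain ⟨r, -⟩ := hdisc
    exact ⟨r.reindex f⟩
  · have h₁ := det_trace_eq hτ hnm htors hcard hε hneg ht fun T => (r (f T) : R E n)
    have h₂ := hdisc.discOf_eq (r.reindex f.symm)
    simp only [Module.Basis.reindex_apply, Equiv.symm_symm] at h₂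
    rw [h₂, hw, ← hq] at h₁
    apply (algebraMap ℚ QBar).injective
    rw [← Matrix.det_submatrix_equiv_self f]
    refine h₁.trans ?_
    rw [map_mul, map_mul, map_pow, map_natCast, map_mul, map_pow, map_intCast,
      eq_ratCast (algebraMap ℚ QBar) s]
    ring
  · rw [Rat.cast_mul, Rat.cast_mul, hroot]
    push_cast
    rfl

end Lattice

end

end ObstructionOrder

end

theorem mainTheorem5 (E : WeierstrassCurve ℚ) [E.IsElliptic] (n m : ℕ) (hn : n + 1 = 2 * m)
    (ξ : GalQ → Torsion E n) (hξ_cont : IsLocallyConstant ξ)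
    (hξ_cocycle : ∀ σ τ : GalQ, ξ (σ * τ) = ξ σ + σ • ξ τ)
    (α : R E n) (γ : Torsion E n → QBarˣ)
    (hγα : ∀ T : Torsion E n, (γ T : QBar) ^ n = α T)
    (hγξ : ∀ (σ : GalQ) (T : Torsion E n),
      weilPairing n (ξ σ).1 T.1 = σ (γ (σ⁻¹ • T) : QBar) / (γ T : QBar))
    (b : Ideal (OR E n)) (c : (FractionalIdeal (nonZeroDivisors (OR E n)) (R E n))ˣ)
    (hfactor : (((b : FractionalIdeal (nonZeroDivisors (OR E n)) (R E n)) *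
        (c : FractionalIdeal (nonZeroDivisors (OR E n)) (R E n)) ^ n :
          FractionalIdeal (nonZeroDivisors (OR E n)) (R E n)) : Submodule (OR E n) (R E n)) =
      Submodule.span (OR E n) {α})
    (hfree : ∀ p : Ideal (OR E n), p.IsPrime → ¬ p ^ n ∣ b) :
    ∃ ε ρ : R₂ E n,
      (∀ S T : Torsion E n, ε (S, T) = weilPairing n S.1 T.1 ^ m) ∧
      (∀ S T : Torsion E n, ρ (S, T) = (γ S : QBar) * (γ T : QBar) / (γ (S + T) : QBar)) ∧
      IsOrder (twistedMul (ε * ρ)) (invLattice c) ∧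
      ∃ d : ℚ, IsDiscriminant n (twistedMul (ε * ρ)) (invLattice c) d ∧
        (d : ℝ) = (n : ℝ) ^ (n ^ 2) *
          (Nat.card (OR E n ⧸ b) : ℝ) ^ (2 / (n : ℝ)) * (discR E n : ℝ) := by
  classical
  have hn0 : n ≠ 0 := by omega
  have := finite_torsion E hn0
  have : Fintype (Torsion E n) := Fintype.ofFinite _
  have hcard : Fintype.card (Torsion E n) = n ^ 2 := by
    rw [← Nat.card_eq_fintype_card, natCard_torsion E hn0]
  have hγ := conj_eq_weilBicharacter_mul (hn := hn0) hγξ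
  have hγ0 := conj_zero_eq hγ
  set e := weilBicharacter E hn0
  have hself : ∀ T, e T T = 1 := weilBicharacter_self E hn0
  have hε : (e.pow m).Nondegenerate := e.nondegenerate_pow hself hn nsmul_torsion
    (eq_zero_of_weilBicharacter_eq_one E hn0)
  have hneg : ∀ T, e.pow m T (-T) = 1 := fun T => by
    rw [Bicharacter.neg_right, Bicharacter.pow_apply, hself, one_pow, inv_one]
  -- the values of `ε` are roots of unity
  have hint : ∀ S T, IsIntegral ℤ (e.pow m S T) := fun S T => by
    refine IsIntegral.pow (IsIntegral.of_pow (Nat.pos_of_ne_zero hn0) ?_) m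
    rw [← e.nsmul_right, nsmul_torsion, e.zero_right]
    exact isIntegral_one
  have hτ : ∀ S T, (weilPower E hn0 m * coboundary hγ) (S, T) =
      e.pow m S T * ((γ S : QBar) * (γ T : QBar) / (γ (S + T) : QBar)) := fun S T => rfl
  have hcc : ((c : FractionalIdeal (OR E n)⁰ (R E n)) : Submodule (OR E n) (R E n)) *
      (((c⁻¹ : (FractionalIdeal (OR E n)⁰ (R E n))ˣ) : FractionalIdeal (OR E n)⁰ (R E n)) :
        Submodule (OR E n) (R E n)) = 1 := by
    rw [← FractionalIdeal.coe_mul, Units.mul_inv, FractionalIdeal.coe_one]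
  have hα := hfactor
  rw [FractionalIdeal.coe_mul, FractionalIdeal.coe_pow, FractionalIdeal.coe_coeIdeal] at hα
  obtain ⟨q, hq⟩ := exists_rat_prod hγ hn
  exact ⟨weilPower E hn0 m, coboundary hγ, fun S T => rfl, fun S T => rfl,
    isOrder_twistedMul hγα hcc hα hτ hn0 hint hfree hγ0,
    exists_isDiscriminant hγα hcc hα hτ hn nsmul_torsion hcard hε hneg hγ0 hq⟩
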